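/- Let $(A(m))_{m\ge 1}$ be real numbers that are the coefficients of an $L$-function in the Selberg class without a pole, that is: $L$ is an entire function of finite order such that, for $\Re(s)>1$, $$L(s)=\sum_{m\ge 1}\frac{A(m)}{m^s}=\prod_p\Big(\sum_{k\ge 0}\frac{A(p^k)}{p^{ks}}\Big)$$ (both absolutely convergent), and there are an integer $d\ge 1$, complex numbers $\mu_1,\dots,\mu_d$, a real number $Q>0$ and $w\in\mathbb{C}$ with $|w|=1$ such that, with $\gamma(s)=\prod_{j=1}^d\Gamma\big(\tfrac{s+\mu_j}{2}\big)$, $$L(s)=w\,Q^{1-2s}\,\frac{\gamma(1-s)}{\gamma(s)}\,L(1-s).$$ Let $\theta\ge 0$ and $\kappa>0$ be such that for every $\eta>0$: * $L(\tfrac12+it)\ll_\eta (1+|t|)^{\theta+\eta}$ for all real $t$; * $\sum_{m\le X}|A(m)|^2\ll_\eta X^{1+\eta}$ for all $X\ge 1$; * $\sum_{X<m\le 2X}|A(m)|\gg_\eta X^{\kappa-\eta}$ for all sufficiently large $X$. The number of sign changes in $(A(m))_{m\le X}$ is the number of $m\le X$ with $A(m)\neq 0$ whose last preceding non-zero term $A(n)$,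 $1\le n<m$, exists and has the opposite sign. Let $\varepsilon>0$ and $\delta=\sqrt{2-2\kappa+\varepsilon}$. Then for all sufficiently large $X$ (in terms of the sequence $A$, $\theta$, $\kappa$ and $\varepsilon$): 1. if $\theta\ge \tfrac12$ and $\kappa\ge 1-\Big(2\big(7\theta+3+\sqrt{(7\theta+3)^2+2}\big)^2\Big)^{-1}$, the number of sign changes in $(A(m))_{m\le X}$ is at least $$X^{\,2\kappa-2+\frac{1}{2\theta}-\delta-\frac{6\delta+2\delta^2}{2\theta}};$$ 2. if $\theta\le \tfrac12$ and $\kappa\ge -\tfrac{17}{2}+3\sqrt{10}$, the number of sign changes in $(A(m))_{m\le X}$ is at least $$X^{\,2\kappa-1-6\delta}.$$ -/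

import Mathlib

/-- The gamma factor `γ(s) = ∏_j Γ((s + μ_j) / 2)`. -/
noncomputable def gammaFactor {d : ℕ} (μ : Fin d → ℂ) (s : ℂ) : ℂ :=
  ∏ j, Complex.Gamma ((s + μ j) / 2)

/-- The local factor `L_p(s) = ∑_{k ≥ 0} A(p^k) p^{-ks}`. -/
noncomputable def localFactor (A : ℕ → ℝ) (p : ℕ) (s : ℂ) : ℂ :=
  ∑' k : ℕ, (A (p ^ k) : ℂ) / (p : ℂ) ^ ((k : ℂ) * s)

/-- `L(1-s)` is tied to `L(s)` by a functional equation of degree `d` with gamma shifts `μ`,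
conductor parameter `Q > 0` and root number `w`. The equation is asserted wherever `γ(1-s)` has
no pole. At a pole of `γ(s)` the quotient by `γ(s)` is `0`, which is the value of the entire
function `1/γ` there. -/
def FunctionalEquation (L : ℂ → ℂ) (d : ℕ) (μ : Fin d → ℂ) (Q : ℝ) (w : ℂ) : Prop :=
  ∀ s : ℂ, (∀ (j : Fin d) (n : ℕ), (1 - s + μ j) / 2 ≠ -(n : ℂ)) →
    L s = w * (Q : ℂ) ^ (1 - 2 * s) * (gammaFactor μ (1 - s) / gammaFactor μ s) * L (1 - s)

/-- `L` is the (analytically continued) `L`-function with real coefficients `A(m)`, `m ≥ 1`,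
in the Selberg class, without a pole. The value `A 0` plays no role. -/
structure IsSelbergLFunction (A : ℕ → ℝ) (L : ℂ → ℂ) : Prop where
  /-- Dirichlet series in `Re s > 1`. -/
  dirichlet_series : ∀ s : ℂ, 1 < s.re → LSeriesHasSum (fun m => (A m : ℂ)) s (L s)
  /-- Euler product in `Re s > 1`. -/
  euler_product : ∀ s : ℂ, 1 < s.re →
    HasProd (fun p : Nat.Primes => localFactor A (p : ℕ) s) (L s)
  /-- `L` is entire. -/
  entire : Differentiable ℂ L
  /-- `L` has finite order. -/
  finite_order : ∃ C ρ : ℝ, ∀ s : ℂ, ‖L s‖ ≤ C * Real.exp ((1 + ‖s‖) ^ ρ)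
  /-- Functional equation. -/
  functional_equation : ∃ (d : ℕ) (μ : Fin d → ℂ) (Q : ℝ) (w : ℂ),
    1 ≤ d ∧ 0 < Q ∧ ‖w‖ = 1 ∧ FunctionalEquation L d μ Q w

/-- `L(1/2 + it) ≪_ε (1 + |t|)^{θ + ε}` for every `ε > 0`. -/
def LindelofExponent (L : ℂ → ℂ) (θ : ℝ) : Prop :=
  ∀ ε : ℝ, 0 < ε → ∃ C : ℝ, ∀ t : ℝ,
    ‖L (1 / 2 + (t : ℂ) * Complex.I)‖ ≤ C * (1 + |t|) ^ (θ + ε)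

/-- `∑_{m ≤ X} |A(m)|² ≪_ε X^{1 + ε}` for every `ε > 0`. -/
def RankinSelbergBound (A : ℕ → ℝ) : Prop :=
  ∀ ε : ℝ, 0 < ε → ∃ C : ℝ, ∀ X : ℝ, 1 ≤ X →
    ∑ m ∈ Finset.Icc 1 ⌊X⌋₊, |A m| ^ 2 ≤ C * X ^ (1 + ε)

/-- `∑_{X < m ≤ 2X} |A(m)| ≫_ε X^{κ - ε}` for every `ε > 0`, as `X → ∞`. -/
def NonvanishingExponent (A : ℕ → ℝ) (κ : ℝ) : Prop :=
  ∀ ε : ℝ, 0 < ε → ∃ c : ℝ, 0 < c ∧ ∃ X₀ : ℝ, ∀ X : ℝ, X₀ ≤ X → 1 ≤ X →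
    c * X ^ (κ - ε) ≤ ∑ m ∈ Finset.Ioc ⌊X⌋₊ ⌊2 * X⌋₊, |A m|

open Classical in
/-- The number of sign changes in `(A(m))_{1 ≤ m ≤ X}`, zero terms being disregarded: the number
of `m ≤ X` such that `A(m)` and the last non-zero term before it have opposite signs. -/
noncomputable def signChanges (A : ℕ → ℝ) (X : ℝ) : ℕ :=
  {m ∈ Finset.Icc 1 ⌊X⌋₊ |
    ∃ n : ℕ, 1 ≤ n ∧ n < m ∧ A n * A m < 0 ∧ ∀ j : ℕ, n < j → j < m → A j = 0}.card

/-! The integers examined for sign changes are products nm with n ≤ X^δ and m at most about X^(1-δ),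
n and m coprime, so that A(nm) = A(n)A(m). Put σ = 1/2 + η with a tiny η, T = X^τ, and cover the
scale of log(nm) by smooth windows of length about 1/T. Let S(w) be the sum of A(nm)(nm)^(-σ),
suitably cut off, over the window at w, and S'(w) the same sum with absolute values. If no sign
change falls in the window then |S(w)| = S'(w). So if the mean square of S is small compared with
what the total mass W of the absolute values would force, most of that mass sits in windows meeting
a sign change, and Cauchy–Schwarz gives at least a constant times W²/F sign changes, where F bounds
the mean square of S' (`le_signChanges_of_short_sums`). Here W is at least of order X^(κ-1/2-3η) by
the lower bound for sums of |A| (`exists_mass_lower`), and F has order X^(1-τ+2η) by counting terms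
in a window (`exists_absolute_moment`). This yields X^(2κ-2+τ-8η).

By Plancherel, the smallness of S amounts to a bound for the integral of |D|² over |ξ| ≤ X^(τ+η),
where D is the Dirichlet polynomial of the coprime products. There are about T log X windows, so the
integral has to be a little below W², and W² is at least about X^(1-δ²) since 2 - 2κ ≤ δ². The mean
value theorem applied to D, of length X, gives only about X. The missing X^(δ²) comes from the
factorisation of D (`exists_integral_coprimePoly_le`). Where the square of the short factor is at
most Λ = X^(δ(1-2δ)), the mean value theorem for the long factor gives about X^(1-2δ²). Where it
exceeds Λ, the moment of the short factor of order k ≈ 1/δ shows that the set is thin, and there |D|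
is bounded pointwise by X^(δ/2) T^θ up to X^(O(η)). The choice τ = (1-6δ)/(2θ) + 10η makes this
second contribution admissible.

The pointwise bound rests on smoothed sums of A(m)m^(-s) being no larger than L itself when Re s >
1/2 (`IsSelbergLFunction.norm_smooth_sum_le`): Fourier inversion writes them as averages of vertical
translates of L, and the bound on the critical line extends to the right by Phragmén–Lindelöf. The
condition that m be coprime to n is imposed by removing the primes of n one at a time, each at the
cost of a factor 2 (`norm_smoothSum_le_two_pow`); small primes are excluded from n beforehand. In
mean values coprimality is handled by Möbius inversion. Multiplicativity of A is itself extracted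
from the Euler product.

If the claimed exponent is not positive, one sign change suffices. Without any, A would be
nonnegative, and a smoothed sum at a real point just right of 1/2 would be both bounded and
unbounded, because κ > 1/2. -/

open Filter Topology

/-! ### Multiplicativity of the coefficients from the Euler product. -/

lemma HasProd.tendsto_cofinite_one_of_ne_zero {ι : Type*} {f : ι → ℂ} {a : ℂ}
    (h : HasProd f a) (ha : a ≠ 0) : Tendsto f cofinite (𝓝 1) := by
  classical
  rw [Metric.tendsto_nhds]
  intro ε hε
  have ha' : 0 < ‖a‖ := norm_pos_iff.mpr ha
  -- Adjoining one factor to a finite product already within r of a moves it by less than 2r. The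
  -- bound r ≤ ‖a‖/2 keeps the product away from 0, and 2r < ε‖a‖/2 turns this into a bound for the
  -- factor.
  obtain ⟨r, hr, hr1, hr2⟩ : ∃ r : ℝ, 0 < r ∧ r ≤ ‖a‖ / 2 ∧ 2 * r < ε * (‖a‖ / 2) := by
    refine ⟨min (‖a‖ / 2) (ε * ‖a‖ / 8), by positivity, min_le_left _ _, ?_⟩
    have := min_le_right (‖a‖ / 2) (ε * ‖a‖ / 8)
    have h2 : 0 < ε * ‖a‖ := by positivity
    linarith
  have h1 : ∀ᶠ s : Finset ι in atTop, dist (∏ i ∈ s, f i) a < r := by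
    have := (Metric.tendsto_nhds.mp h) r hr
    simpa using this
  obtain ⟨s, hs⟩ := eventually_atTop.mp h1
  have hfin : (s : Set ι)ᶜ ∈ cofinite := s.finite_toSet.compl_mem_cofinite
  filter_upwards [hfin] with p hp
  have hp' : p ∉ s := by simpa using hp
  have e1 := hs s le_rfl
  have e2 := hs (insert p s) (Finset.subset_insert p s)
  rw [Finset.prod_insert hp'] at e2
  set x := ∏ i ∈ s, f i
  rw [dist_eq_norm] at e1 e2 ⊢
  have hx : ‖a‖ / 2 ≤ ‖x‖ := by
    have := norm_sub_norm_le a (a - x)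
    rw [sub_sub_cancel, norm_sub_rev a x] at this
    linarith
  have h3 : ‖f p - 1‖ * ‖x‖ < 2 * r := by
    rw [← norm_mul]
    calc ‖(f p - 1) * x‖ = ‖(f p * x - a) - (x - a)‖ := by ring_nf
      _ ≤ _ := norm_sub_le _ _
      _ < 2 * r := by linarith
  by_contra hcon
  push Not at hcon
  have : ε * (‖a‖ / 2) ≤ ‖f p - 1‖ * ‖x‖ := by gcongr
  linarith

namespace LSeries

lemma term_prime_pow (A : ℕ → ℝ) (s : ℂ) {p : ℕ} (hp : p.Prime) (k : ℕ) :
    LSeries.term (fun m => (A m : ℂ)) s (p ^ k) = (A (p ^ k) : ℂ) / (p : ℂ) ^ ((k : ℂ) * s) := by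
  rw [LSeries.term_of_ne_zero (pow_ne_zero _ hp.ne_zero), Complex.natCast_cpow_natCast_mul]
  push_cast
  rfl

end LSeries

lemma localFactor_eq_tsum_term (A : ℕ → ℝ) (s : ℂ) {p : ℕ} (hp : p.Prime) :
    localFactor A p s = ∑' k, LSeries.term (fun m => (A m : ℂ)) s (p ^ k) := by
  simp only [localFactor, LSeries.term_prime_pow A s hp]

lemma summable_primes_tsum_pow {f : ℕ → ℝ} (hf : Summable f) :
    Summable (fun p : Nat.Primes => ∑' k : ℕ, f ((p : ℕ) ^ (k + 1))) := by
  have h1 : Summable (fun q : {n : ℕ // IsPrimePow n} => f q) := hf.subtype _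
  have h2 := (Nat.Primes.prodNatEquiv.summable_iff (f := fun q : {n : ℕ // IsPrimePow n} => f q)).mpr h1
  have h3 : Summable (fun x : Nat.Primes × ℕ => f ((x.1 : ℕ) ^ (x.2 + 1))) := by
    refine h2.congr fun x => ?_
    simp [Nat.Primes.prodNatEquiv]
  exact h3.prod

lemma summable_prime_pow {f : ℕ → ℝ} (hf : Summable f) {p : ℕ} (hp : p.Prime) :
    Summable (fun k : ℕ => f (p ^ k)) :=
  hf.comp_injective (Nat.pow_right_injective hp.two_le)

/-- A function which is multiplicative on coprime arguments is summable as soon as its values at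
prime powers are dominated by a summable function. -/
lemma summable_of_multiplicative_of_prime_pow {F g : ℕ → ℝ} (hF0 : F 0 = 0) (hF1 : F 1 = 1)
    (hFn : ∀ n, 0 ≤ F n) (hFm : ∀ {m n : ℕ}, m.Coprime n → F (m * n) = F m * F n)
    (hg : Summable g) (hgn : ∀ n, 0 ≤ g n)
    (hFg : ∀ p k : ℕ, p.Prime → F (p ^ k) = g (p ^ k)) : Summable F := by
  have hs : ∀ {p : ℕ}, p.Prime → Summable (fun k : ℕ => ‖F (p ^ k)‖) := by
    intro p hp
    refine (summable_prime_pow hg hp).congr fun k => ?_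
    rw [hFg p k hp, Real.norm_of_nonneg (hgn _)]
  set x : Nat.Primes → ℝ := fun p => ∑' k : ℕ, g ((p : ℕ) ^ (k + 1)) with hx
  have hxs : Summable x := summable_primes_tsum_pow hg
  have hxn : ∀ p, 0 ≤ x p := fun p => tsum_nonneg fun k => hgn _
  refine summable_of_sum_le (c := Real.exp (∑' p, x p)) hFn fun u => ?_
  -- Every positive element of u is N-smooth, so the finite sum is at most the finite Euler product
  -- over primes below N, which is bounded through 1 + x ≤ exp x.
  set N := u.sup id + 1
  have hsm := EulerProduct.summable_and_hasSum_smoothNumbers_prod_primesBelow_tsum hF1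
    (fun {m n} h => hFm h) hs N
  have h1 : ∑ n ∈ u, F n ≤ ∑' m : N.smoothNumbers, F m := by
    have h2 : ∑ n ∈ u, F n = ∑ n ∈ u.filter (· ∈ N.smoothNumbers), F n := by
      symm
      refine Finset.sum_subset (Finset.filter_subset _ _) fun n hn hn' => ?_
      have h0 : n = 0 := by
        by_contra h0
        apply hn'
        refine Finset.mem_filter.mpr ⟨hn, Nat.mem_smoothNumbers_of_lt (Nat.pos_of_ne_zero h0) ?_⟩
        exact Nat.lt_succ_of_le (Finset.le_sup (f := id) hn)
      rw [h0, hF0]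
    rw [h2, ← Finset.sum_subtype_eq_sum_filter]
    exact hsm.2.summable.sum_le_tsum _ (fun m _ => hFn _)
  refine h1.trans ?_
  rw [hsm.2.tsum_eq]
  have h4 : ∀ p : Nat.Primes, ∑' k, F ((p : ℕ) ^ k) = 1 + x p := by
    intro p
    have : Summable fun k => F ((p : ℕ) ^ k) := (hs p.2).of_norm
    rw [this.tsum_eq_zero_add, pow_zero, hF1]
    congr 1
    exact tsum_congr fun k => hFg _ _ p.2
  have h5 : ∀ p ∈ N.primesBelow, p.Prime := fun p hp => Nat.prime_of_mem_primesBelow hp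
  let S : Finset Nat.Primes := N.primesBelow.subtype Nat.Prime
  calc ∏ p ∈ N.primesBelow, ∑' k, F (p ^ k)
      = ∏ p ∈ S, ∑' k, F ((p : ℕ) ^ k) :=
        (Finset.prod_subtype_of_mem (fun p => ∑' k, F (p ^ k)) h5).symm
    _ = ∏ p ∈ S, (1 + x p) := Finset.prod_congr rfl fun p _ => h4 p
    _ ≤ ∏ p ∈ S, Real.exp (x p) :=
        Finset.prod_le_prod (fun p _ => by have := hxn p; linarith)
          (fun p _ => by rw [add_comm]; exact Real.add_one_le_exp _)
    _ = Real.exp (∑ p ∈ S, x p) := (Real.exp_sum _ _).symm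
    _ ≤ Real.exp (∑' p, x p) := Real.exp_le_exp.mpr (hxs.sum_le_tsum S fun p _ => hxn p)

namespace IsSelbergLFunction

variable {A : ℕ → ℝ} {L : ℂ → ℂ}

lemma abscissa_lt_top (hL : IsSelbergLFunction A L) :
    LSeries.abscissaOfAbsConv (fun m => (A m : ℂ)) < ⊤ := by
  have h := (hL.dirichlet_series 2 (by simp)).LSeriesSummable.abscissaOfAbsConv_le
  refine h.trans_lt ?_
  simp

lemma summable_norm_term (hL : IsSelbergLFunction A L) {s : ℂ} (hs : 1 < s.re) :
    Summable fun n => ‖LSeries.term (fun m => (A m : ℂ)) s n‖ :=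
  (hL.dirichlet_series s hs).LSeriesSummable.norm

lemma exists_ne_zero (hL : IsSelbergLFunction A L) (hA : ∃ m ≠ 0, A m ≠ 0) :
    ∃ s : ℂ, 1 < s.re ∧ L s ≠ 0 := by
  by_contra! hcon
  obtain ⟨m, hm, hAm⟩ := hA
  apply hAm
  have h := LSeries.eq_of_LSeries_eventually_eq (f := fun m => (A m : ℂ)) (g := 0)
    hL.abscissa_lt_top (LSeriesSummable_zero (s := 2) |>.abscissaOfAbsConv_le.trans_lt (by simp)) ?_ hm
  · simpa using h
  · filter_upwards [eventually_gt_atTop (1 : ℝ)] with x hx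
    rw [LSeries_zero, (hL.dirichlet_series x (by simpa using hx)).LSeries_eq]
    exact hcon x (by simpa using hx)

/-- Every local factor has constant term A(1), and the remaining terms tend to 0 along the primes.
So the local factors tend to A(1); but at a point where L does not vanish they also tend to 1. -/
lemma map_one (hL : IsSelbergLFunction A L) (hA : ∃ m ≠ 0, A m ≠ 0) : A 1 = 1 := by
  obtain ⟨s, hs, hs0⟩ := hL.exists_ne_zero hA
  have h1 := (hL.euler_product s hs).tendsto_cofinite_one_of_ne_zero hs0
  have hsum := hL.summable_norm_term hs
  have hx := (summable_primes_tsum_pow hsum).tendsto_cofinite_zero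
  have h2 : Tendsto (fun p : Nat.Primes => localFactor A (p : ℕ) s) cofinite (𝓝 (A 1 : ℂ)) := by
    rw [tendsto_iff_norm_sub_tendsto_zero]
    refine squeeze_zero (fun _ => norm_nonneg _) (fun p => ?_) hx
    have hsp := summable_prime_pow hsum p.2
    rw [localFactor_eq_tsum_term A s p.2, hsp.of_norm.tsum_eq_zero_add]
    have h3 : LSeries.term (fun m => (A m : ℂ)) s ((p : ℕ) ^ 0) = A 1 := by
      rw [LSeries.term_prime_pow A s p.2]
      simp
    rw [h3, add_sub_cancel_left]
    have h4 : Summable fun k : ℕ =>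
        ‖LSeries.term (fun m => (A m : ℂ)) s ((p : ℕ) ^ (k + 1))‖ :=
      hsp.comp_injective (add_left_injective 1)
    exact norm_tsum_le_tsum_norm h4
  have : (cofinite : Filter Nat.Primes).NeBot := cofinite_neBot
  have := tendsto_nhds_unique h1 h2
  exact_mod_cast this.symm

/-- The coefficients are multiplicative, as a consequence of the Euler product. -/
lemma map_mul_of_coprime (hL : IsSelbergLFunction A L) (hA : ∃ m ≠ 0, A m ≠ 0) :
    ∀ m n : ℕ, m.Coprime n → m ≠ 0 → n ≠ 0 → A (m * n) = A m * A n := by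
  have hA1 := hL.map_one hA
  -- B is the multiplicative function agreeing with A at prime powers. Its Dirichlet series has the
  -- Euler product of L, so A = B by uniqueness of Dirichlet coefficients.
  set B : ℕ → ℝ := fun n => n.factorization.prod fun p k => A (p ^ k) with hB
  have hB1 : B 1 = 1 := by simp [hB]
  have hBm : ∀ {m n : ℕ}, m.Coprime n → B (m * n) = B m * B n := by
    intro m n h
    simp only [hB]
    rw [Nat.factorization_mul_of_coprime h]
    exact Finsupp.prod_add_index_of_disjoint (by simpa using h.disjoint_primeFactors) _
  have hBp : ∀ p k : ℕ, p.Prime → B (p ^ k) = A (p ^ k) := by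
    intro p k hp
    simp only [hB]
    rw [hp.factorization_pow, Finsupp.prod_single_index]
    simp [hA1]
  set F : ℂ → ℕ → ℂ := fun s n => LSeries.term (fun m => (B m : ℂ)) s n with hF
  have hF0 : ∀ s, F s 0 = 0 := fun s => by simp [hF]
  have hF1 : ∀ s, F s 1 = 1 := fun s => by simp [hF, LSeries.term_of_ne_zero, hB1]
  have hFm : ∀ s, ∀ {m n : ℕ}, m.Coprime n → F s (m * n) = F s m * F s n := by
    intro s m n h
    rcases eq_or_ne m 0 with rfl | hm
    · simp [hF0]
    rcases eq_or_ne n 0 with rfl | hn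
    · simp [hF0]
    simp only [hF]
    rw [LSeries.term_of_ne_zero hm, LSeries.term_of_ne_zero hn,
      LSeries.term_of_ne_zero (mul_ne_zero hm hn), hBm h]
    push_cast
    rw [Complex.natCast_mul_natCast_cpow]
    field_simp
  have hFp : ∀ s, ∀ p k : ℕ, p.Prime →
      F s (p ^ k) = LSeries.term (fun m => (A m : ℂ)) s (p ^ k) := by
    intro s p k hp
    simp only [hF]
    rw [LSeries.term_of_ne_zero (pow_ne_zero _ hp.ne_zero),
      LSeries.term_of_ne_zero (pow_ne_zero _ hp.ne_zero), hBp p k hp]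
  have hFs : ∀ s : ℂ, 1 < s.re → Summable fun n => ‖F s n‖ := by
    intro s hs
    refine summable_of_multiplicative_of_prime_pow (by simp [hF0]) (by simp [hF1])
      (fun _ => norm_nonneg _) (fun h => by rw [hFm s h, norm_mul]) (hL.summable_norm_term hs)
      (fun _ => norm_nonneg _) (fun p k hp => by rw [hFp s p k hp])
  have hLB : ∀ s : ℂ, 1 < s.re → LSeries (fun m => (B m : ℂ)) s = L s := by
    intro s hs
    have h1 := EulerProduct.eulerProduct_hasProd (hF1 s) (fun {m n} h => hFm s h) (hFs s hs) (hF0 s)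
    have h2 := hL.euler_product s hs
    have h3 : (fun p : Nat.Primes => ∑' e, F s ((p : ℕ) ^ e)) =
        fun p : Nat.Primes => localFactor A (p : ℕ) s := by
      funext p
      rw [localFactor_eq_tsum_term A s p.2]
      exact tsum_congr fun k => hFp s p k p.2
    rw [h3] at h1
    exact h1.unique h2
  have hBabs : LSeries.abscissaOfAbsConv (fun m => (B m : ℂ)) < ⊤ := by
    have h : LSeriesSummable (fun m => (B m : ℂ)) 2 := (hFs 2 (by simp)).of_norm
    refine h.abscissaOfAbsConv_le.trans_lt ?_
    simp
  have hAB : ∀ n ≠ 0, A n = B n := by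
    intro n hn
    have h := LSeries.eq_of_LSeries_eventually_eq (f := fun m => (A m : ℂ))
      (g := fun m => (B m : ℂ)) hL.abscissa_lt_top hBabs ?_ hn
    · exact_mod_cast h
    · filter_upwards [eventually_gt_atTop (1 : ℝ)] with x hx
      rw [hLB x (by simpa using hx), (hL.dirichlet_series x (by simpa using hx)).LSeries_eq]
  intro m n h hm hn
  rw [hAB m hm, hAB n hn, hAB _ (mul_ne_zero hm hn), hBm h]

end IsSelbergLFunction

/-! ### Growth of L to the right of the critical line. -/

namespace IsSelbergLFunction

variable {A : ℕ → ℝ} {L : ℂ → ℂ}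

lemma norm_le_tsum (hL : IsSelbergLFunction A L) {s : ℂ} {x : ℝ} (hx : 1 < x) (hs : x ≤ s.re) :
    ‖L s‖ ≤ ∑' n, ‖LSeries.term (fun m => (A m : ℂ)) x n‖ := by
  have h1 := hL.summable_norm_term (s := x) (by simpa using hx)
  rw [← (hL.dirichlet_series s (hx.trans_le hs)).LSeries_eq, LSeries]
  exact tsum_of_norm_bounded h1.hasSum fun n => LSeries.norm_term_le_of_re_le_re _ (by simpa using hs) n

/-- The Phragmén–Lindelöf bound to the right of the critical line. -/
lemma norm_le_rpow (hL : IsSelbergLFunction A L) {θ : ℝ} (hθ : 0 ≤ θ) (hLθ : LindelofExponent L θ)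
    {η : ℝ} (hη : 0 < η) :
    ∃ C : ℝ, 0 < C ∧ ∀ s : ℂ, 1 / 2 ≤ s.re → ‖L s‖ ≤ C * (1 + ‖s‖) ^ (θ + η) := by
  obtain ⟨C₁, hC₁⟩ := hLθ η hη
  obtain ⟨C₂, ρ, hC₂⟩ := hL.finite_order
  set a := θ + η with ha
  have ha0 : 0 < a := by positivity
  set M := ∑' n, ‖LSeries.term (fun m => (A m : ℂ)) (2 : ℝ) n‖ with hM
  have hM0 : 0 ≤ M := tsum_nonneg fun _ => norm_nonneg _
  have hC₁0 : 0 ≤ C₁ := by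
    have := (norm_nonneg _).trans (hC₁ 0)
    simpa using this
  -- Dividing by (s+1)^a makes both edges of the strip 1/2 ≤ Re s ≤ 2 bounded. The shift by 1 keeps
  -- the base in the slit plane and its norm at least 1.
  set f : ℂ → ℂ := fun s => L s * (s + 1) ^ ((-a : ℝ) : ℂ) with hf
  have hnf : ∀ s, ‖f s‖ = ‖L s‖ * ‖s + 1‖ ^ (-a) := fun s => by
    rw [hf, norm_mul, Complex.norm_cpow_real]
  have hs1 : ∀ s : ℂ, 1 / 2 ≤ s.re → 1 ≤ ‖s + 1‖ := fun s hs => by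
    have := Complex.re_le_norm (s + 1)
    simp at this
    linarith
  have hfL : ∀ s : ℂ, 1 / 2 ≤ s.re → ‖f s‖ ≤ ‖L s‖ := fun s hs => by
    rw [hnf]
    exact mul_le_of_le_one_right (norm_nonneg _)
      (Real.rpow_le_one_of_one_le_of_nonpos (hs1 s hs) (by linarith))
  set K := max (C₁ * 2 ^ a) M with hK
  have hstrip : ∀ s : ℂ, 1 / 2 ≤ s.re → s.re ≤ 2 → ‖f s‖ ≤ K := by
    intro s h1 h2
    refine PhragmenLindelof.vertical_strip (a := 1 / 2) (b := 2) (f := f) ?_ ?_ ?_ ?_ h1 h2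
    · apply DifferentiableOn.diffContOnCl
      intro z hz
      have hz' : 1 / 2 ≤ z.re := by
        have : z ∈ Complex.re ⁻¹' Set.Ici (1 / 2 : ℝ) := by
          refine closure_minimal ?_ (isClosed_Ici.preimage Complex.continuous_re) hz
          intro w hw
          exact hw.1.le
        exact this
      have h3 : z + 1 ∈ Complex.slitPlane := Or.inl (by simp; linarith)
      exact ((hL.entire z).mul
        ((differentiableAt_id.add_const 1).cpow_const h3)).differentiableWithinAt
    -- The strip has width 3/2 and 1 < π/(3/2), so growth exp(exp|Im z|) is allowed. Finite order
    -- gives exp of a power of |Im z|, which is less.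
    · refine ⟨1, ?_, 1, ?_⟩
      · rw [lt_div_iff₀ (by norm_num)]
        have := Real.pi_gt_three
        linarith
      · refine Asymptotics.IsBigO.of_bound |C₂| ?_
        rw [eventually_inf_principal]
        have h4 : ∀ᶠ x : ℝ in atTop, (4 + x) ^ |ρ| ≤ Real.exp x := by
          have h5 : Tendsto (fun x : ℝ => 4 + x) atTop atTop := tendsto_atTop_add_const_left _ _ tendsto_id
          have h6 := (isLittleO_rpow_exp_atTop |ρ|).comp_tendsto h5
          have h7 := h6.def (c := Real.exp (-4)) (Real.exp_pos _)
          filter_upwards [h7, eventually_ge_atTop 0] with x hx hx0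
          simp only [Function.comp] at hx
          rw [Real.norm_of_nonneg (by positivity), Real.norm_of_nonneg (Real.exp_pos _).le,
            ← Real.exp_add] at hx
          simpa using hx
        have h8 := (tendsto_comap (f := (_root_.abs ∘ Complex.im))).eventually h4
        filter_upwards [h8] with z hz hzs
        have hz1 : 1 / 2 ≤ z.re := hzs.1.le
        have hz2 : z.re ≤ 2 := hzs.2.le
        simp only [Function.comp] at hz
        refine (hfL z hz1).trans ((hC₂ z).trans ?_)
        rw [Real.norm_of_nonneg (Real.exp_pos _).le, one_mul, one_mul]
        have h9 : ‖z‖ ≤ 2 + |z.im| := by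
          refine (Complex.norm_le_abs_re_add_abs_im z).trans ?_
          rw [abs_of_nonneg (by linarith : 0 ≤ z.re)]
          linarith
        calc C₂ * Real.exp ((1 + ‖z‖) ^ ρ) ≤ |C₂| * Real.exp ((1 + ‖z‖) ^ ρ) := by
              gcongr; exact le_abs_self _
          _ ≤ _ := by
              gcongr
              calc (1 + ‖z‖) ^ ρ ≤ (1 + ‖z‖) ^ |ρ| := by
                    apply Real.rpow_le_rpow_of_exponent_le
                    · linarith [norm_nonneg z]
                    · exact le_abs_self _
                _ ≤ (4 + |z.im|) ^ |ρ| := by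
                    apply Real.rpow_le_rpow (by positivity) (by linarith) (abs_nonneg _)
                _ ≤ _ := hz
    · intro z hz
      refine le_max_of_le_left ?_
      have hz' : z = 1 / 2 + (z.im : ℂ) * Complex.I := by
        apply Complex.ext <;> simp [hz]
      have h3 := hC₁ z.im
      rw [← hz'] at h3
      have h4 : (1 + |z.im|) / 2 ≤ ‖z + 1‖ := by
        have h5 := Complex.abs_re_le_norm (z + 1)
        have h6 := Complex.abs_im_le_norm (z + 1)
        simp only [Complex.add_re, Complex.one_re, hz, Complex.add_im, Complex.one_im, add_zero] at h5 h6
        rw [abs_of_nonneg (by norm_num)] at h5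
        linarith
      have h7 : 0 < 1 + |z.im| := by positivity
      rw [hnf]
      calc ‖L z‖ * ‖z + 1‖ ^ (-a) ≤ (C₁ * (1 + |z.im|) ^ a) * ((1 + |z.im|) / 2) ^ (-a) := by
            have h8 : ‖z + 1‖ ^ (-a) ≤ ((1 + |z.im|) / 2) ^ (-a) :=
              Real.rpow_le_rpow_of_nonpos (by positivity) h4 (neg_nonpos.mpr ha0.le)
            exact mul_le_mul h3 h8 (by positivity) (by positivity)
        _ = C₁ * 2 ^ a := by
            rw [Real.div_rpow h7.le (by norm_num), Real.rpow_neg h7.le, Real.rpow_neg (by norm_num)]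
            have : 0 < (1 + |z.im|) ^ a := by positivity
            field_simp
    · intro z hz
      refine le_max_of_le_right ?_
      exact (hfL z (by rw [hz]; norm_num)).trans (hL.norm_le_tsum one_lt_two hz.ge)
  refine ⟨K + 1, ?_, fun s hs => ?_⟩
  · have : M ≤ K := le_max_right _ _
    linarith
  have h1 : ‖s + 1‖ ≤ 1 + ‖s‖ := by
    have := norm_add_le s 1
    simp at this
    linarith
  have h2 : 1 ≤ (1 + ‖s‖) ^ a := Real.one_le_rpow (by linarith [norm_nonneg s]) ha0.le
  have hK0 : 0 ≤ K := hM0.trans (le_max_right _ _)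
  rcases le_total s.re 2 with h | h
  · have h3 := hstrip s hs h
    rw [hnf, Real.rpow_neg (by positivity)] at h3
    have h4 : 0 < ‖s + 1‖ ^ a := Real.rpow_pos_of_pos (by linarith [hs1 s hs]) _
    rw [← div_eq_mul_inv, div_le_iff₀ h4] at h3
    refine h3.trans ?_
    gcongr
    linarith
  · calc ‖L s‖ ≤ M := hL.norm_le_tsum one_lt_two h
      _ ≤ K + 1 := (le_max_right _ _).trans (by linarith)
      _ ≤ _ := le_mul_of_one_le_right (by positivity) h2

end IsSelbergLFunction

/-! ### Smoothed sums of the Dirichlet series through Fourier inversion. -/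

open MeasureTheory FourierTransform SchwartzMap

/-- A smooth bump function, equal to `1` on `[-1, 1]` and supported in `[-2, 2]`. -/
noncomputable def bump : ContDiffBump (0 : ℝ) := ⟨1, 2, one_pos, one_lt_two⟩

lemma bump_eq_one {u : ℝ} (hu : |u| ≤ 1) : bump u = 1 :=
  bump.one_of_mem_closedBall (by simpa [bump] using hu)

lemma bump_eq_zero {u : ℝ} (hu : 2 ≤ |u|) : bump u = 0 :=
  bump.zero_of_le_dist (by simpa [bump] using hu)

lemma abs_lt_two_of_bump_ne_zero {u : ℝ} (hu : bump u ≠ 0) : |u| < 2 := by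
  by_contra h
  exact hu (bump_eq_zero (not_lt.mp h))

/-- The bump function as a complex-valued Schwartz function. -/
noncomputable def schwartzBump : 𝓢(ℝ, ℂ) :=
  HasCompactSupport.toSchwartzMap (f := fun u => ((bump u : ℝ) : ℂ))
    (bump.hasCompactSupport.comp_left (g := fun x : ℝ => (x : ℂ)) Complex.ofReal_zero)
    (Complex.ofRealCLM.contDiff.comp bump.contDiff)

lemma schwartzBump_apply (u : ℝ) : schwartzBump u = ((bump u : ℝ) : ℂ) := rfl

/-- The Fourier transform of the bump function. -/
noncomputable def bumpHat : 𝓢(ℝ, ℂ) := 𝓕 schwartzBump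

lemma bump_eq_integral (u : ℝ) :
    ((bump u : ℝ) : ℂ) = ∫ ξ : ℝ, Complex.exp (2 * Real.pi * ξ * u * Complex.I) * bumpHat ξ := by
  have h1 : 𝓕⁻ bumpHat = schwartzBump := FourierTransform.fourierInv_fourier_eq schwartzBump
  have h2 : (𝓕⁻ bumpHat) u = ((bump u : ℝ) : ℂ) := by rw [h1, schwartzBump_apply]
  rw [← h2, SchwartzMap.fourierInv_coe, Real.fourierInv_eq']
  refine integral_congr_ae (Eventually.of_forall fun ξ => ?_)
  simp only [smul_eq_mul]
  congr 2
  simp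
  ring

lemma integrable_bumpHat_mul_rpow (a : ℝ) (ha : 0 ≤ a) :
    Integrable fun ξ : ℝ => ‖bumpHat ξ‖ * (1 + 2 * Real.pi * |ξ|) ^ a := by
  obtain ⟨k, hk⟩ := exists_nat_ge a
  obtain ⟨C, hC⟩ : ∃ C, ∀ ξ : ℝ, (1 + ‖ξ‖) ^ (k + 2) * ‖bumpHat ξ‖ ≤ C := by
    refine ⟨2 ^ (k + 2) * ((Finset.Iic (k + 2, 0)).sup fun m => SchwartzMap.seminorm ℝ m.1 m.2) bumpHat, fun ξ => ?_⟩
    have := SchwartzMap.one_add_le_sup_seminorm_apply (𝕜 := ℝ) (m := (k + 2, 0)) (le_refl (k+2)) (le_refl 0) bumpHat ξ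
    simpa using this
  have hint : Integrable fun ξ : ℝ => (C * (2 * Real.pi) ^ a) * (1 + ‖ξ‖) ^ (-(2 : ℝ)) :=
    (integrable_one_add_norm (by simp)).const_mul _
  refine hint.mono' ?_ (Eventually.of_forall fun ξ => ?_)
  · refine Continuous.aestronglyMeasurable ?_
    refine bumpHat.continuous.norm.mul (Continuous.rpow_const (by fun_prop) fun ξ => Or.inr ha)
  · have hp := Real.pi_gt_three
    have h1 : 0 < 1 + ‖ξ‖ := by positivity
    rw [Real.norm_of_nonneg (by positivity)]
    have h2 : (1 + 2 * Real.pi * |ξ|) ^ a ≤ (2 * Real.pi) ^ a * (1 + ‖ξ‖) ^ (k : ℝ) := by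
      calc (1 + 2 * Real.pi * |ξ|) ^ a ≤ (2 * Real.pi * (1 + ‖ξ‖)) ^ a := by
            apply Real.rpow_le_rpow (by positivity) _ ha
            rw [Real.norm_eq_abs]; linarith
        _ = (2 * Real.pi) ^ a * (1 + ‖ξ‖) ^ a := Real.mul_rpow (by positivity) h1.le
        _ ≤ _ := by
            gcongr
            linarith [norm_nonneg ξ]
    calc ‖bumpHat ξ‖ * (1 + 2 * Real.pi * |ξ|) ^ a
        ≤ ‖bumpHat ξ‖ * ((2 * Real.pi) ^ a * (1 + ‖ξ‖) ^ (k : ℝ)) := by gcongr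
      _ = (2 * Real.pi) ^ a * ((1 + ‖ξ‖) ^ (k + 2) * ‖bumpHat ξ‖) * (1 + ‖ξ‖) ^ (-(2 : ℝ)) := by
          rw [Real.rpow_neg h1.le, Real.rpow_natCast, pow_add]
          norm_cast
          field_simp
      _ ≤ (2 * Real.pi) ^ a * C * (1 + ‖ξ‖) ^ (-(2 : ℝ)) := by
          gcongr
          exact hC ξ
      _ = _ := by ring

namespace IsSelbergLFunction

variable {A : ℕ → ℝ} {L : ℂ → ℂ}

lemma integrand_bound {C a : ℝ} (ha : 0 ≤ a) (hC : 0 ≤ C)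
    (hb : ∀ s : ℂ, 1 / 2 ≤ s.re → ‖L s‖ ≤ C * (1 + ‖s‖) ^ a) {s : ℂ} (hs : 1 / 2 ≤ s.re) (ξ : ℝ) :
    ‖L (s - 2 * Real.pi * ξ * Complex.I)‖ ≤
      C * (1 + ‖s‖) ^ a * (1 + 2 * Real.pi * |ξ|) ^ a := by
  have hp := Real.pi_pos
  refine (hb _ (by simpa using hs)).trans ?_
  rw [mul_assoc C, ← Real.mul_rpow (by positivity) (by positivity)]
  gcongr
  have h1 : ‖s - 2 * Real.pi * ξ * Complex.I‖ ≤ ‖s‖ + 2 * Real.pi * |ξ| := by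
    refine (norm_sub_le _ _).trans ?_
    simp [abs_of_pos hp]
  nlinarith [mul_nonneg (norm_nonneg s) (mul_nonneg hp.le (abs_nonneg ξ))]

/-- The Mellin-type representation of a smoothed sum, in the half-plane of absolute convergence. -/
lemma smooth_sum_eq_integral (hL : IsSelbergLFunction A L) {s : ℂ} (hs : 1 < s.re) (x : ℝ) {M : ℕ}
    (hM : Real.exp (x + 2) ≤ M) :
    ∑ m ∈ Finset.Icc 1 M, (A m : ℂ) * (bump (Real.log m - x) : ℝ) * (m : ℂ) ^ (-s) =
      ∫ ξ : ℝ, Complex.exp (-(2 * Real.pi * ξ * x * Complex.I)) * bumpHat ξ *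
        L (s - 2 * Real.pi * ξ * Complex.I) := by
  -- Fourier inversion of the bump turns the weight at m into an integral of m^(2πiξ), that is, into
  -- a vertical shift of s. Absolute convergence for Re s > 1 permits exchanging sum and integral.
  set F : ℕ → ℝ → ℂ := fun m ξ => Complex.exp (-(2 * Real.pi * ξ * x * Complex.I)) * bumpHat ξ *
    LSeries.term (fun m => (A m : ℂ)) (s - 2 * Real.pi * ξ * Complex.I) m with hF
  have hterm : ∀ m ≠ 0, ∀ ξ : ℝ, F m ξ = (A m : ℂ) * (m : ℂ) ^ (-s) *
      (Complex.exp (2 * Real.pi * ξ * (Real.log m - x : ℝ) * Complex.I) * bumpHat ξ) := by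
    intro m hm ξ
    have hm' : (m : ℂ) ≠ 0 := Nat.cast_ne_zero.mpr hm
    simp only [hF]
    rw [LSeries.term_of_ne_zero hm, div_eq_mul_inv, ← Complex.cpow_neg, neg_sub, sub_eq_add_neg,
      Complex.cpow_add _ _ hm', Complex.cpow_def_of_ne_zero hm' (2 * Real.pi * ξ * Complex.I),
      ← Complex.natCast_log]
    have : Complex.exp (2 * Real.pi * ξ * (Real.log m - x : ℝ) * Complex.I) =
        Complex.exp (-(2 * Real.pi * ξ * x * Complex.I)) *
          Complex.exp ((Real.log m : ℂ) * (2 * Real.pi * ξ * Complex.I)) := by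
      rw [← Complex.exp_add]
      congr 1
      push_cast
      ring
    rw [this]
    ring
  have hnorm : ∀ m ξ, ‖F m ξ‖ = ‖LSeries.term (fun m => (A m : ℂ)) s m‖ * ‖bumpHat ξ‖ := by
    intro m ξ
    simp only [hF, norm_mul]
    have h1 : ‖Complex.exp (-(2 * Real.pi * ξ * x * Complex.I))‖ = 1 := by
      have := Complex.norm_exp_ofReal_mul_I (-(2 * Real.pi * ξ * x))
      rw [← this]
      congr 2
      push_cast
      ring
    rw [h1, one_mul, mul_comm, LSeries.norm_term_eq, LSeries.norm_term_eq]
    simp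
  have hmeas : ∀ m, Integrable (F m) := by
    intro m
    rcases eq_or_ne m 0 with rfl | hm
    · have : F 0 = fun _ => 0 := by funext ξ; simp [hF]
      rw [this]; exact integrable_zero _ _ _
    refine Integrable.mono' (g := fun ξ => ‖LSeries.term (fun m => (A m : ℂ)) s m‖ * ‖bumpHat ξ‖)
      (bumpHat.integrable.norm.const_mul _) ?_ (Eventually.of_forall fun ξ => (hnorm m ξ).le)
    rw [funext (hterm m hm)]
    refine Continuous.aestronglyMeasurable ?_
    have := bumpHat.continuous
    fun_prop
  have hsum := hasSum_integral_of_summable_integral_norm hmeas (by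
    simp_rw [hnorm, integral_const_mul]
    exact (hL.summable_norm_term hs).mul_right _)
  have hR : ∀ ξ, ∑' m, F m ξ = Complex.exp (-(2 * Real.pi * ξ * x * Complex.I)) * bumpHat ξ *
        L (s - 2 * Real.pi * ξ * Complex.I) := by
    intro ξ
    rw [tsum_mul_left, ← (hL.dirichlet_series (s - 2 * Real.pi * ξ * Complex.I)
      (by simpa using hs)).LSeries_eq, LSeries]
  simp_rw [hR] at hsum
  rw [← hsum.tsum_eq]
  have hI : ∀ m ≠ 0, ∫ ξ, F m ξ = (A m : ℂ) * (bump (Real.log m - x) : ℝ) * (m : ℂ) ^ (-s) := by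
    intro m hm
    rw [funext (hterm m hm), integral_const_mul, ← bump_eq_integral]
    ring
  -- The bump vanishes once log m ≥ x + 2, so M ≥ exp(x+2) makes the finite sum complete.
  rw [tsum_eq_sum (s := Finset.Icc 1 M)]
  · refine Finset.sum_congr rfl fun m hm => ?_
    rw [hI m (by have := Finset.mem_Icc.mp hm; omega)]
  · intro m hm
    rcases eq_or_ne m 0 with rfl | hm0
    · simp [hF]
    rw [hI m hm0]
    have h1 : M < m := by
      simp only [Finset.mem_Icc] at hm; omega
    have h2 : x + 2 ≤ Real.log m := by
      rw [Real.le_log_iff_exp_le (by positivity)]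
      exact hM.trans (by exact_mod_cast h1.le)
    rw [bump_eq_zero (by rw [abs_of_nonneg] <;> linarith)]
    simp

/-- The smoothed sums satisfy the representation throughout `Re s > 1/2`. -/
lemma differentiableOn_integral (hL : IsSelbergLFunction A L) {C a : ℝ} (ha : 0 ≤ a) (hC : 0 ≤ C)
    (hb : ∀ s : ℂ, 1 / 2 ≤ s.re → ‖L s‖ ≤ C * (1 + ‖s‖) ^ a) (x : ℝ) :
    DifferentiableOn ℂ (fun s : ℂ => ∫ ξ : ℝ, Complex.exp (-(2 * Real.pi * ξ * x * Complex.I)) *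
      bumpHat ξ * L (s - 2 * Real.pi * ξ * Complex.I)) {s | 1 / 2 < s.re} := by
  intro s₀ hs₀
  have hs₀' : 1 / 2 < s₀.re := hs₀
  obtain ⟨r, hr, hr2⟩ : ∃ r : ℝ, 0 < r ∧ 1 / 2 + 2 * r ≤ s₀.re :=
    ⟨(s₀.re - 1 / 2) / 2, by linarith, by linarith⟩
  have hLd : Differentiable ℂ (deriv L) := hL.entire.contDiff.differentiable_deriv_two
  have hLc : Continuous L := hL.entire.continuous
  have hgc := bumpHat.continuous
  have hball : ∀ s ∈ Metric.ball s₀ r, ∀ w ∈ Metric.closedBall s r, 1 / 2 ≤ w.re := by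
    intro s hs w hw
    rw [Metric.mem_ball, dist_eq_norm] at hs
    rw [Metric.mem_closedBall, dist_eq_norm] at hw
    have h1 := (Complex.abs_re_le_norm (s - s₀)).trans hs.le
    have h2 := (Complex.abs_re_le_norm (w - s)).trans hw
    rw [Complex.sub_re, abs_le] at h1 h2
    linarith [h1.1, h2.1]
  have hnb : ∀ s ∈ Metric.ball s₀ r, ∀ w ∈ Metric.closedBall s r, ‖w‖ ≤ ‖s₀‖ + 2 * r := by
    intro s hs w hw
    rw [Metric.mem_ball, dist_eq_norm] at hs
    rw [Metric.mem_closedBall, dist_eq_norm] at hw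
    calc ‖w‖ = ‖s₀ + (s - s₀) + (w - s)‖ := by ring_nf
      _ ≤ ‖s₀‖ + ‖s - s₀‖ + ‖w - s‖ := norm_add₃_le
      _ ≤ _ := by linarith
  have hder := hasDerivAt_integral_of_dominated_loc_of_deriv_le (𝕜 := ℂ) (μ := volume)
    (F := fun (s : ℂ) (ξ : ℝ) => Complex.exp (-(2 * Real.pi * ξ * x * Complex.I)) *
      bumpHat ξ * L (s - 2 * Real.pi * ξ * Complex.I))
    (F' := fun (s : ℂ) (ξ : ℝ) => Complex.exp (-(2 * Real.pi * ξ * x * Complex.I)) *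
      bumpHat ξ * deriv L (s - 2 * Real.pi * ξ * Complex.I))
    (x₀ := s₀) (s := Metric.ball s₀ r)
    (bound := fun ξ => (C * (1 + (‖s₀‖ + 2 * r)) ^ a / r) *
      (‖bumpHat ξ‖ * (1 + 2 * Real.pi * |ξ|) ^ a))
    (Metric.ball_mem_nhds s₀ hr) ?_ ?_ ?_ ?_ ?_ ?_
  · exact hder.2.differentiableAt.differentiableWithinAt
  · refine Eventually.of_forall fun s => Continuous.aestronglyMeasurable ?_
    fun_prop
  · refine Integrable.mono' ((integrable_bumpHat_mul_rpow a ha).const_mul (C * (1 + ‖s₀‖) ^ a)) ?_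
      (Eventually.of_forall fun ξ => ?_)
    · refine Continuous.aestronglyMeasurable ?_
      fun_prop
    · rw [norm_mul, norm_mul, Complex.norm_exp]
      simp only [Complex.neg_re, Complex.mul_I_re, neg_neg]
      have h1 := integrand_bound ha hC hb hs₀'.le ξ
      have h2 : ((2 * Real.pi * ξ * x : ℂ)).im = 0 := by
        rw [show (2 * Real.pi * ξ * x : ℂ) = ((2 * Real.pi * ξ * x : ℝ) : ℂ) by push_cast; ring]
        exact Complex.ofReal_im _
      rw [h2, Real.exp_zero, one_mul]
      calc ‖bumpHat ξ‖ * ‖L (s₀ - 2 * Real.pi * ξ * Complex.I)‖ ≤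
          ‖bumpHat ξ‖ * (C * (1 + ‖s₀‖) ^ a * (1 + 2 * Real.pi * |ξ|) ^ a) := by gcongr
        _ = _ := by ring
  · refine Continuous.aestronglyMeasurable ?_
    have := hLd.continuous
    fun_prop
  · refine Eventually.of_forall fun ξ s hs => ?_
    rw [norm_mul, norm_mul, Complex.norm_exp]
    simp only [Complex.neg_re, Complex.mul_I_re, neg_neg]
    have h2 : ((2 * Real.pi * ξ * x : ℂ)).im = 0 := by
      rw [show (2 * Real.pi * ξ * x : ℂ) = ((2 * Real.pi * ξ * x : ℝ) : ℂ) by push_cast; ring]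
      exact Complex.ofReal_im _
    rw [h2, Real.exp_zero, one_mul]
    -- Cauchy's estimate on a circle of radius r, chosen so that all circles stay in Re ≥ 1/2,
    -- bounds L' by the growth of L.
    have h3 : ‖deriv L (s - 2 * Real.pi * ξ * Complex.I)‖ ≤
        C * (1 + (‖s₀‖ + 2 * r)) ^ a * (1 + 2 * Real.pi * |ξ|) ^ a / r := by
      refine Complex.norm_deriv_le_of_forall_mem_sphere_norm_le hr
        hL.entire.diffContOnCl fun w hw => ?_
      have hw' : w + 2 * Real.pi * ξ * Complex.I ∈ Metric.closedBall s r := by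
        rw [Metric.mem_closedBall, dist_eq_norm]
        rw [Metric.mem_sphere, dist_eq_norm] at hw
        rw [← hw]
        apply le_of_eq
        congr 1
        ring
      have h4 := integrand_bound ha hC hb (hball s hs _ hw') ξ
      rw [add_sub_cancel_right] at h4
      refine h4.trans ?_
      have := Real.pi_pos
      gcongr
      exact hnb s hs _ hw'
    calc ‖bumpHat ξ‖ * ‖deriv L (s - 2 * Real.pi * ξ * Complex.I)‖ ≤ ‖bumpHat ξ‖ *
          (C * (1 + (‖s₀‖ + 2 * r)) ^ a * (1 + 2 * Real.pi * |ξ|) ^ a / r) := by gcongr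
      _ = _ := by ring
  · exact (integrable_bumpHat_mul_rpow a ha).const_mul _
  · refine Eventually.of_forall fun ξ s _ => ?_
    have h1 : HasDerivAt L (deriv L (s - 2 * Real.pi * ξ * Complex.I))
        (s - 2 * Real.pi * ξ * Complex.I) := (hL.entire _).hasDerivAt
    have h2 := h1.comp s ((hasDerivAt_id s).sub_const (2 * Real.pi * ξ * Complex.I))
    simp only [mul_one] at h2
    exact h2.const_mul _

/-- Smoothed sums of `A(m) m^{-s}` are bounded like `L` itself, uniformly in their length. -/
lemma norm_smooth_sum_le (hL : IsSelbergLFunction A L) {θ : ℝ} (hθ : 0 ≤ θ)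
    (hLθ : LindelofExponent L θ) {η : ℝ} (hη : 0 < η) :
    ∃ C : ℝ, 0 < C ∧ ∀ (s : ℂ) (x : ℝ) (M : ℕ), 1 / 2 < s.re → Real.exp (x + 2) ≤ M →
      ‖∑ m ∈ Finset.Icc 1 M, (A m : ℂ) * (bump (Real.log m - x) : ℝ) * (m : ℂ) ^ (-s)‖ ≤
        C * (1 + ‖s‖) ^ (θ + η) := by
  obtain ⟨C, hC, hb⟩ := hL.norm_le_rpow hθ hLθ hη
  set a := θ + η
  have ha : 0 ≤ a := by positivity
  set J := ∫ ξ : ℝ, ‖bumpHat ξ‖ * (1 + 2 * Real.pi * |ξ|) ^ a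
  have hJ : 0 ≤ J := integral_nonneg fun ξ => by
    have := Real.pi_pos
    positivity
  refine ⟨C * (J + 1), by positivity, fun s x M hs hM => ?_⟩
  set U : Set ℂ := {s | 1 / 2 < s.re} with hU
  have hUo : IsOpen U := isOpen_lt continuous_const Complex.continuous_re
  have hUc : IsPreconnected U := (convex_halfSpace_re_gt (1 / 2)).isPreconnected
  have hd1 : DifferentiableOn ℂ (fun s => ∑ m ∈ Finset.Icc 1 M,
      (A m : ℂ) * (bump (Real.log m - x) : ℝ) * (m : ℂ) ^ (-s)) U := by
    refine DifferentiableOn.fun_sum fun m hm => ?_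
    have hm0 : (m : ℂ) ≠ 0 := Nat.cast_ne_zero.mpr (by have := Finset.mem_Icc.mp hm; omega)
    refine DifferentiableOn.const_mul ?_ _
    exact (differentiable_id.neg.const_cpow (Or.inl hm0)).differentiableOn
  have hd2 := hL.differentiableOn_integral ha hC.le hb x
  -- No contour is shifted: the finite sum and the integral are both holomorphic in Re s > 1/2 and
  -- agree near s = 2, hence agree throughout by the identity theorem.
  have heq := (hd1.analyticOnNhd hUo).eqOn_of_preconnected_of_eventuallyEq
    (hd2.analyticOnNhd hUo) hUc (z₀ := 2) (by simp [hU]; norm_num) (by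
      have h1 : {s : ℂ | 1 < s.re} ∈ 𝓝 (2 : ℂ) :=
        (isOpen_lt continuous_const Complex.continuous_re).mem_nhds (by simp)
      filter_upwards [h1] with z hz
      exact hL.smooth_sum_eq_integral hz x hM)
  have h2 := heq hs
  simp only at h2
  rw [h2]
  calc _ ≤ ∫ ξ : ℝ, C * (1 + ‖s‖) ^ a * (‖bumpHat ξ‖ * (1 + 2 * Real.pi * |ξ|) ^ a) := by
        refine norm_integral_le_of_norm_le ((integrable_bumpHat_mul_rpow a ha).const_mul _)
          (Eventually.of_forall fun ξ => ?_)
        rw [norm_mul, norm_mul, Complex.norm_exp]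
        simp only [Complex.neg_re, Complex.mul_I_re, neg_neg]
        have h1 := integrand_bound ha hC.le hb hs.le ξ
        have h2 : ((2 * Real.pi * ξ * x : ℂ)).im = 0 := by
          rw [show (2 * Real.pi * ξ * x : ℂ) = ((2 * Real.pi * ξ * x : ℝ) : ℂ) by push_cast; ring]
          exact Complex.ofReal_im _
        rw [h2, Real.exp_zero, one_mul]
        calc ‖bumpHat ξ‖ * ‖L (s - 2 * Real.pi * ξ * Complex.I)‖ ≤
            ‖bumpHat ξ‖ * (C * (1 + ‖s‖) ^ a * (1 + 2 * Real.pi * |ξ|) ^ a) := by gcongr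
          _ = _ := by ring
    _ = C * (1 + ‖s‖) ^ a * J := integral_const_mul _ _
    _ ≤ C * (1 + ‖s‖) ^ a * (J + 1) := by gcongr; linarith
    _ = _ := by ring

end IsSelbergLFunction

/-! ### Removing primes from sums over multiplicative coefficients. -/

/-- The bijection sends an integer to its exponent of p and its p-free part. Because h vanishes
beyond M, the condition that the product be at most M can be dropped on the right, which leaves the
two variables independent. -/
lemma sum_filter_not_dvd_eq {E : Type*} [AddCommMonoid E] {S : Finset ℕ} (hS : ∀ q ∈ S, q.Prime)
    {p : ℕ} (hp : p.Prime) (hpS : p ∉ S) {M K : ℕ} (hMK : M < 2 ^ K) (h : ℕ → E)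
    (hh : ∀ m, M < m → h m = 0) :
    ∑ m ∈ Finset.Icc 1 M with ∀ q ∈ S, ¬ q ∣ m, h m =
      ∑ k ∈ Finset.range K, ∑ m ∈ Finset.Icc 1 M with ∀ q ∈ insert p S, ¬ q ∣ m, h (p ^ k * m) := by
  classical
  rw [← Finset.sum_product' (f := fun k m => h (p ^ k * m))]
  set Q := Finset.range K ×ˢ {m ∈ Finset.Icc 1 M | ∀ q ∈ insert p S, ¬ q ∣ m} with hQ
  rw [← Finset.sum_subset (Finset.filter_subset (fun x : ℕ × ℕ => p ^ x.1 * x.2 ≤ M) Q)]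
  · refine Finset.sum_nbij' (fun m => (m.factorization p, ordCompl[p] m))
      (fun x => p ^ x.1 * x.2) ?_ ?_ ?_ ?_ ?_
    · intro m hm
      simp only [Finset.mem_filter, Finset.mem_Icc] at hm
      obtain ⟨⟨h1, h2⟩, h3⟩ := hm
      have hm0 : m ≠ 0 := by omega
      simp only [hQ, Finset.mem_filter, Finset.mem_product, Finset.mem_range, Finset.mem_Icc,
        Finset.mem_insert, forall_eq_or_imp]
      refine ⟨⟨?_, ⟨Nat.ordCompl_pos p hm0, (Nat.ordCompl_le m p).trans h2⟩,
        Nat.not_dvd_ordCompl hp hm0, fun q hq hd => h3 q hq (hd.trans (Nat.ordCompl_dvd m p))⟩,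
        ?_⟩
      · have h4 : 2 ^ m.factorization p ≤ m :=
          (Nat.pow_le_pow_left hp.two_le _).trans (Nat.ordProj_le p hm0)
        exact (Nat.pow_lt_pow_iff_right one_lt_two).mp (h4.trans_lt (h2.trans_lt hMK))
      · rwa [Nat.ordProj_mul_ordCompl_eq_self]
    · intro x hx
      simp only [hQ, Finset.mem_filter, Finset.mem_product, Finset.mem_range, Finset.mem_Icc,
        Finset.mem_insert, forall_eq_or_imp] at hx
      obtain ⟨⟨h1, ⟨h2, h3⟩, h4, h5⟩, h6⟩ := hx
      simp only [Finset.mem_filter, Finset.mem_Icc]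
      refine ⟨⟨Nat.mul_pos (pow_pos hp.pos _) h2, h6⟩, fun q hq hd => ?_⟩
      rcases (hS q hq).dvd_mul.mp hd with h7 | h7
      · have := (Nat.prime_dvd_prime_iff_eq (hS q hq) hp).mp ((hS q hq).dvd_of_dvd_pow h7)
        exact hpS (this ▸ hq)
      · exact h5 q hq h7
    · intro m _
      exact Nat.ordProj_mul_ordCompl_eq_self m p
    · intro x hx
      simp only [hQ, Finset.mem_filter, Finset.mem_product, Finset.mem_range, Finset.mem_Icc,
        Finset.mem_insert, forall_eq_or_imp] at hx
      obtain ⟨⟨h1, ⟨h2, h3⟩, h4, h5⟩, h6⟩ := hx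
      have hf : (p ^ x.1 * x.2).factorization p = x.1 := by
        rw [Nat.factorization_mul (pow_ne_zero _ hp.ne_zero) (by omega), hp.factorization_pow]
        simp [Nat.factorization_eq_zero_of_not_dvd h4]
      ext
      · exact hf
      · simp only [hf]
        exact Nat.mul_div_cancel_left _ (pow_pos hp.pos _)
    · intro m _
      simp only [Nat.ordProj_mul_ordCompl_eq_self]
  · intro x hx hx'
    refine hh _ ?_
    simp only [Finset.mem_filter, not_and, not_le] at hx'
    exact hx' hx

/-- Multiplicativity on nonzero coprime arguments. -/
def CoprimeMul (A : ℕ → ℝ) : Prop :=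
  A 1 = 1 ∧ ∀ m n : ℕ, m.Coprime n → m ≠ 0 → n ≠ 0 → A (m * n) = A m * A n

/-- The smoothed sum of `A(m) m^{-s}` over `log m ≈ x`, with `m` free of prime factors in `S`. -/
noncomputable def smoothSum (A : ℕ → ℝ) (S : Finset ℕ) (M : ℕ) (x : ℝ) (s : ℂ) : ℂ :=
  ∑ m ∈ Finset.Icc 1 M with ∀ q ∈ S, ¬ q ∣ m, (A m : ℂ) * (bump (Real.log m - x) : ℝ) * (m : ℂ) ^ (-s)

/-- In the logarithmic variable, splitting off p^k merely translates the bump by k log p, so the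
sieved sums reappear at smaller x with the same M. -/
lemma smoothSum_recursion {A : ℕ → ℝ} (hA : CoprimeMul A) {S : Finset ℕ} (hS : ∀ q ∈ S, q.Prime)
    {p : ℕ} (hp : p.Prime) (hpS : p ∉ S) {M K : ℕ} (hMK : M < 2 ^ K) {x : ℝ}
    (hM : Real.exp (x + 2) ≤ M) (s : ℂ) :
    smoothSum A S M x s = ∑ k ∈ Finset.range K, (A (p ^ k) : ℂ) * ((p ^ k : ℕ) : ℂ) ^ (-s) *
      smoothSum A (insert p S) M (x - k * Real.log p) s := by
  rw [smoothSum, sum_filter_not_dvd_eq hS hp hpS hMK]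
  · refine Finset.sum_congr rfl fun k _ => ?_
    rw [smoothSum, Finset.mul_sum]
    refine Finset.sum_congr rfl fun m hm => ?_
    simp only [Finset.mem_filter, Finset.mem_Icc, Finset.mem_insert, forall_eq_or_imp] at hm
    have hm0 : m ≠ 0 := by omega
    have hpk : p ^ k ≠ 0 := pow_ne_zero _ hp.ne_zero
    rw [hA.2 _ _ (Nat.Coprime.pow_left k ((Nat.Prime.coprime_iff_not_dvd hp).mpr hm.2.1)) hpk hm0]
    have h1 : Real.log ((p ^ k * m : ℕ) : ℝ) - x = Real.log m - (x - k * Real.log p) := by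
      push_cast
      rw [Real.log_mul (by exact_mod_cast hpk) (by exact_mod_cast hm0), Real.log_pow]
      ring
    rw [h1, Nat.cast_mul, Complex.natCast_mul_natCast_cpow]
    push_cast
    ring
  · intro m hm
    have h2 : x + 2 ≤ Real.log m := by
      have : 0 < m := by omega
      rw [Real.le_log_iff_exp_le (by positivity)]
      exact hM.trans (by exact_mod_cast hm.le)
    rw [bump_eq_zero (by rw [abs_of_nonneg] <;> linarith)]
    simp

lemma smoothSum_eq_zero (A : ℕ → ℝ) (S : Finset ℕ) (M : ℕ) {x : ℝ} (hx : x < -2) (s : ℂ) :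
    smoothSum A S M x s = 0 := by
  refine Finset.sum_eq_zero fun m hm => ?_
  simp only [Finset.mem_filter, Finset.mem_Icc] at hm
  have h1 : 0 ≤ Real.log m := Real.log_nonneg (by exact_mod_cast hm.1.1)
  rw [bump_eq_zero (by rw [abs_of_nonneg] <;> linarith)]
  simp

/-- The recursion is solved for its k = 0 term. The terms with k ≥ 1 have x lowered by at least log
2 and total weight at most 1/2, so by induction they contribute at most (1/2)(2B), and B + B = 2B.
The induction in steps of log 2 starts at x < -2, where the sums are empty. -/
lemma norm_smoothSum_insert_le {A : ℕ → ℝ} (hA : CoprimeMul A) {S : Finset ℕ}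
    (hS : ∀ q ∈ S, q.Prime) {p : ℕ} (hp : p.Prime) (hpS : p ∉ S) {M : ℕ} {s : ℂ} {B : ℝ}
    (hB : 0 ≤ B) (hgood : ∀ K, ∑ k ∈ Finset.Ico 1 K, |A (p ^ k)| * ((p ^ k : ℕ) : ℝ) ^ (-s.re) ≤ 1 / 2)
    (hbound : ∀ x, Real.exp (x + 2) ≤ M → ‖smoothSum A S M x s‖ ≤ B) :
    ∀ x, Real.exp (x + 2) ≤ M → ‖smoothSum A (insert p S) M x s‖ ≤ 2 * B := by
  have key : ∀ j : ℕ, ∀ x, x < -2 + j * Real.log 2 → Real.exp (x + 2) ≤ M →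
      ‖smoothSum A (insert p S) M x s‖ ≤ 2 * B := by
    intro j
    induction j with
    | zero =>
      intro x hx _
      rw [smoothSum_eq_zero _ _ _ (by simpa using hx), norm_zero]
      positivity
    | succ j ih =>
      intro x hx hM
      obtain ⟨K, hK⟩ : ∃ K, M < 2 ^ K := ⟨M, Nat.lt_two_pow_self⟩
      have hK0 : 0 < K := by
        by_contra h0
        have : K = 0 := by omega
        subst this
        have hM0 : M = 0 := by simpa using hK
        rw [hM0] at hM
        exact absurd hM (not_le.mpr (by simpa using Real.exp_pos _))
      have h1 := smoothSum_recursion hA hS hp hpS hK hM s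
      rw [← Finset.sum_range_add_sum_Ico _ (show 1 ≤ K from hK0), Finset.sum_range_one] at h1
      simp only [pow_zero, hA.1, Nat.cast_one, Complex.ofReal_one, Complex.one_cpow, mul_one,
        one_mul, CharP.cast_eq_zero, zero_mul, sub_zero] at h1
      have h2 : ‖∑ k ∈ Finset.Ico 1 K, (A (p ^ k) : ℂ) * ((p ^ k : ℕ) : ℂ) ^ (-s) *
          smoothSum A (insert p S) M (x - k * Real.log p) s‖ ≤ 1 / 2 * (2 * B) := by
        calc _ ≤ ∑ k ∈ Finset.Ico 1 K, |A (p ^ k)| * ((p ^ k : ℕ) : ℝ) ^ (-s.re) * (2 * B) := by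
              refine norm_sum_le_of_le _ fun k hk => ?_
              have hk1 : 1 ≤ k := (Finset.mem_Ico.mp hk).1
              have hlog : Real.log 2 ≤ k * Real.log p := by
                have h3 : Real.log 2 ≤ Real.log p :=
                  Real.log_le_log (by norm_num) (by exact_mod_cast hp.two_le)
                have h4 : (1 : ℝ) ≤ k := by exact_mod_cast hk1
                have h5 := Real.log_pos one_lt_two
                nlinarith
              rw [norm_mul, norm_mul, Complex.norm_real, Real.norm_eq_abs,
                Complex.norm_natCast_cpow_of_pos (pow_pos hp.pos k), Complex.neg_re]
              gcongr
              refine ih _ ?_ ?_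
              · push_cast at hx
                linarith
              · refine le_trans (Real.exp_le_exp.mpr ?_) hM
                have := Real.log_pos one_lt_two
                linarith
          _ ≤ _ := by
              rw [← Finset.sum_mul]
              gcongr
              exact hgood K
      have h3 : smoothSum A (insert p S) M x s = smoothSum A S M x s -
          ∑ k ∈ Finset.Ico 1 K, (A (p ^ k) : ℂ) * ((p ^ k : ℕ) : ℂ) ^ (-s) *
          smoothSum A (insert p S) M (x - k * Real.log p) s := by
        rw [h1]; ring
      rw [h3]
      refine (norm_sub_le _ _).trans ?_
      have := hbound x hM
      linarith
  intro x hM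
  obtain ⟨j, hj⟩ := exists_nat_gt ((x + 2) / Real.log 2)
  refine key j x ?_ hM
  rw [div_lt_iff₀ (Real.log_pos one_lt_two)] at hj
  linarith

lemma norm_smoothSum_le_two_pow {A : ℕ → ℝ} (hA : CoprimeMul A) {M : ℕ} {s : ℂ} {B : ℝ}
    (hB : 0 ≤ B) (hbound : ∀ x, Real.exp (x + 2) ≤ M → ‖smoothSum A ∅ M x s‖ ≤ B)
    (S : Finset ℕ) (hS : ∀ q ∈ S, q.Prime)
    (hgood : ∀ p ∈ S, ∀ K,
      ∑ k ∈ Finset.Ico 1 K, |A (p ^ k)| * ((p ^ k : ℕ) : ℝ) ^ (-s.re) ≤ 1 / 2) :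
    ∀ x, Real.exp (x + 2) ≤ M → ‖smoothSum A S M x s‖ ≤ 2 ^ S.card * B := by
  induction S using Finset.induction with
  | empty => simpa using hbound
  | insert p S hpS ih =>
    intro x hM
    have hS' : ∀ q ∈ S, q.Prime := fun q hq => hS q (Finset.mem_insert_of_mem hq)
    have h1 := ih hS' (fun q hq => hgood q (Finset.mem_insert_of_mem hq))
    have h2 := norm_smoothSum_insert_le hA hS' (hS p (Finset.mem_insert_self _ _)) hpS
      (by positivity) (hgood p (Finset.mem_insert_self _ _)) h1 x hM
    rw [Finset.card_insert_of_notMem hpS, pow_succ]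
    linarith

/-- The sum of `|A(m)| m^{-σ}` over `m ≤ M` free of prime factors in `S`. -/
noncomputable def absSum (A : ℕ → ℝ) (S : Finset ℕ) (M : ℕ) (σ : ℝ) : ℝ :=
  ∑ m ∈ Finset.Icc 1 M with ∀ q ∈ S, ¬ q ∣ m, |A m| * (m : ℝ) ^ (-σ)

lemma absSum_nonneg (A : ℕ → ℝ) (S : Finset ℕ) (M : ℕ) (σ : ℝ) : 0 ≤ absSum A S M σ :=
  Finset.sum_nonneg fun m _ => by positivity

/-- The counterpart for absolute values: by positivity the truncation of the product can be relaxed,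
and the local series factors out. -/
lemma absSum_le_mul_insert {A : ℕ → ℝ} (hA : CoprimeMul A) {S : Finset ℕ}
    (hS : ∀ q ∈ S, q.Prime) {p : ℕ} (hp : p.Prime) (hpS : p ∉ S) {M : ℕ} {σ Z : ℝ}
    (hZ : ∀ K, ∑ k ∈ Finset.range K, |A (p ^ k)| * ((p ^ k : ℕ) : ℝ) ^ (-σ) ≤ Z) :
    absSum A S M σ ≤ Z * absSum A (insert p S) M σ := by
  have h1 : absSum A S M σ = ∑ m ∈ Finset.Icc 1 M with ∀ q ∈ S, ¬ q ∣ m,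
      if m ≤ M then |A m| * (m : ℝ) ^ (-σ) else 0 := by
    refine Finset.sum_congr rfl fun m hm => ?_
    simp only [Finset.mem_filter, Finset.mem_Icc] at hm
    rw [if_pos hm.1.2]
  rw [h1, sum_filter_not_dvd_eq hS hp hpS (Nat.lt_two_pow_self (n := M))]
  · calc _ ≤ ∑ k ∈ Finset.range M, |A (p ^ k)| * ((p ^ k : ℕ) : ℝ) ^ (-σ) *
          absSum A (insert p S) M σ := by
          refine Finset.sum_le_sum fun k _ => ?_
          rw [absSum, Finset.mul_sum]
          refine Finset.sum_le_sum fun m hm => ?_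
          simp only [Finset.mem_filter, Finset.mem_Icc, Finset.mem_insert, forall_eq_or_imp] at hm
          split_ifs
          · rw [hA.2 _ _ (Nat.Coprime.pow_left k ((Nat.Prime.coprime_iff_not_dvd hp).mpr hm.2.1))
              (pow_ne_zero _ hp.ne_zero) (by omega), abs_mul, Nat.cast_mul,
              Real.mul_rpow (by positivity) (by positivity)]
            apply le_of_eq
            ring
          · positivity
      _ ≤ _ := by
          rw [← Finset.sum_mul]
          gcongr
          · exact absSum_nonneg _ _ _ _
          · exact hZ M
  · intro m hm
    rw [if_neg (by omega)]

lemma absSum_le_pow_mul {A : ℕ → ℝ} (hA : CoprimeMul A) {M : ℕ} {σ Z : ℝ} (hZ0 : 0 ≤ Z)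
    (S : Finset ℕ) (hS : ∀ q ∈ S, q.Prime)
    (hZ : ∀ p ∈ S, ∀ K, ∑ k ∈ Finset.range K, |A (p ^ k)| * ((p ^ k : ℕ) : ℝ) ^ (-σ) ≤ Z) :
    absSum A ∅ M σ ≤ Z ^ S.card * absSum A S M σ := by
  induction S using Finset.induction with
  | empty => simp
  | insert p S hpS ih =>
    have hS' : ∀ q ∈ S, q.Prime := fun q hq => hS q (Finset.mem_insert_of_mem hq)
    have h1 := ih hS' (fun q hq => hZ q (Finset.mem_insert_of_mem hq))
    have h2 := absSum_le_mul_insert (M := M) hA hS' (hS p (Finset.mem_insert_self _ _)) hpS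
      (hZ p (Finset.mem_insert_self _ _))
    rw [Finset.card_insert_of_notMem hpS, pow_succ, mul_assoc]
    exact h1.trans (by gcongr)

/-! ### Divisor bound and local series. -/

/-- For p ≥ 2^(1/ε) one has p^ε ≥ 2, so a + 1 ≤ 2^a ≤ p^(εa) without loss. Each of the boundedly
many smaller primes costs a factor c at most. -/
lemma card_divisors_le_rpow {ε : ℝ} (hε : 0 < ε) :
    ∃ C : ℝ, 1 ≤ C ∧ ∀ n : ℕ, n ≠ 0 → (n.divisors.card : ℝ) ≤ C * (n : ℝ) ^ ε := by
  obtain ⟨N, hN⟩ := exists_nat_ge ((2 : ℝ) ^ (1 / ε))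
  have hl : 0 < Real.log 2 := Real.log_pos one_lt_two
  set c := max 1 (1 / (ε * Real.log 2)) with hc
  have hc1 : 1 ≤ c := le_max_left _ _
  refine ⟨c ^ N, one_le_pow₀ hc1, fun n hn => ?_⟩
  have hpow : (n : ℝ) ^ ε = ∏ p ∈ n.primeFactors, ((p : ℝ) ^ ε) ^ n.factorization p := by
    conv_lhs => rw [← Nat.prod_factorization_pow_eq_self hn]
    rw [Finsupp.prod, Nat.support_factorization]
    push_cast
    rw [← Real.finsetProd_rpow _ _ (fun p _ => by positivity)]
    refine Finset.prod_congr rfl fun p _ => ?_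
    rw [← Real.rpow_natCast, ← Real.rpow_natCast, ← Real.rpow_mul (by positivity),
      ← Real.rpow_mul (by positivity), mul_comm]
  have hcard : c ^ ((n.primeFactors.filter (· < N)).card) ≤ c ^ N := by
    refine pow_le_pow_right₀ hc1 ?_
    calc _ ≤ (Finset.range N).card := Finset.card_le_card fun p hp => by
          simpa using (Finset.mem_filter.mp hp).2
      _ = N := Finset.card_range N
  rw [Nat.card_divisors hn, hpow]
  push_cast
  calc ∏ p ∈ n.primeFactors, ((n.factorization p : ℝ) + 1)
      ≤ ∏ p ∈ n.primeFactors, ((if p < N then c else 1) * ((p : ℝ) ^ ε) ^ n.factorization p) := by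
        refine Finset.prod_le_prod (fun p _ => by positivity) fun p hp => ?_
        have hpp := Nat.prime_of_mem_primeFactors hp
        have hp2 : (2 : ℝ) ≤ p := by exact_mod_cast hpp.two_le
        set a := n.factorization p
        split_ifs with h
        · have h1 : 1 + a * (ε * Real.log 2) ≤ ((p : ℝ) ^ ε) ^ a := by
            calc 1 + a * (ε * Real.log 2) ≤ Real.exp (a * (ε * Real.log 2)) := by
                  rw [add_comm]; exact Real.add_one_le_exp _
              _ = ((2 : ℝ) ^ ε) ^ a := by
                  rw [Real.rpow_def_of_pos two_pos, ← Real.exp_nat_mul]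
                  ring_nf
              _ ≤ _ := by gcongr
          have h2 : (1 : ℝ) ≤ c * (ε * Real.log 2) := by
            have : 1 / (ε * Real.log 2) ≤ c := le_max_right _ _
            rwa [div_le_iff₀ (by positivity)] at this
          calc (a : ℝ) + 1 ≤ c * (1 + a * (ε * Real.log 2)) := by
                have : (a : ℝ) * 1 ≤ a * (c * (ε * Real.log 2)) := by gcongr
                nlinarith
            _ ≤ _ := by gcongr
        · rw [one_mul]
          have h1 : (2 : ℝ) ≤ (p : ℝ) ^ ε := by
            calc (2 : ℝ) = ((2 : ℝ) ^ (1 / ε)) ^ ε := by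
                  rw [← Real.rpow_mul two_pos.le, one_div_mul_cancel hε.ne', Real.rpow_one]
              _ ≤ (p : ℝ) ^ ε := by
                  gcongr
                  exact hN.trans (by exact_mod_cast not_lt.mp h)
          calc (a : ℝ) + 1 ≤ 2 ^ a := by exact_mod_cast Nat.lt_two_pow_self
            _ ≤ _ := by gcongr
    _ = c ^ ((n.primeFactors.filter (· < N)).card) *
        ∏ p ∈ n.primeFactors, ((p : ℝ) ^ ε) ^ n.factorization p := by
        rw [Finset.prod_mul_distrib, Finset.prod_ite, Finset.prod_const, Finset.prod_const_one,
          mul_one]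
    _ ≤ _ := by gcongr

lemma two_pow_card_primeFactors_le {n : ℕ} (hn : n ≠ 0) :
    2 ^ n.primeFactors.card ≤ n.divisors.card := by
  rw [Nat.card_divisors hn, ← Finset.prod_const]
  refine Finset.prod_le_prod' fun p hp => ?_
  have := (Nat.prime_of_mem_primeFactors hp).factorization_pos_of_dvd hn
    (Nat.dvd_of_mem_primeFactors hp)
  omega

namespace RankinSelbergBound

variable {A : ℕ → ℝ}

lemma abs_le_rpow (hRS : RankinSelbergBound A) {ε : ℝ} (hε : 0 < ε) :
    ∃ C : ℝ, 1 ≤ C ∧ ∀ m : ℕ, m ≠ 0 → |A m| ≤ C * (m : ℝ) ^ (1 / 2 + ε) := by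
  obtain ⟨C, hC⟩ := hRS (2 * ε) (by positivity)
  refine ⟨max 1 (Real.sqrt C), le_max_left _ _, fun m hm => ?_⟩
  have hm1 : (1 : ℝ) ≤ m := by exact_mod_cast Nat.pos_of_ne_zero hm
  have h1 := hC m hm1
  rw [Nat.floor_natCast] at h1
  have h2 : |A m| ^ 2 ≤ ∑ k ∈ Finset.Icc 1 m, |A k| ^ 2 :=
    Finset.single_le_sum (f := fun k => |A k| ^ 2) (fun k _ => by positivity)
      (Finset.mem_Icc.mpr ⟨Nat.pos_of_ne_zero hm, le_rfl⟩)
  have h3 : |A m| ≤ Real.sqrt (C * (m : ℝ) ^ (1 + 2 * ε)) := Real.le_sqrt_of_sq_le (h2.trans h1)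
  have h4 : Real.sqrt (C * (m : ℝ) ^ (1 + 2 * ε)) = Real.sqrt C * (m : ℝ) ^ (1 / 2 + ε) := by
    rw [Real.sqrt_mul' _ (by positivity), Real.sqrt_eq_rpow ((m : ℝ) ^ _),
      ← Real.rpow_mul (by positivity)]
    congr 2
    ring
  rw [h4] at h3
  refine h3.trans ?_
  gcongr
  exact le_max_right _ _

lemma summable_sq (hRS : RankinSelbergBound A) {ε : ℝ} (hε : 0 < ε) :
    Summable fun m : ℕ => |A m| ^ 2 * (m : ℝ) ^ (-(1 + ε)) := by
  obtain ⟨C, hC⟩ := hRS (ε / 2) (by positivity)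
  have h1 : LSeriesSummable (fun m => ((|A m| ^ 2 : ℝ) : ℂ)) ((1 + ε : ℝ) : ℂ) := by
    refine LSeriesSummable_of_sum_norm_bigO_and_nonneg (r := 1 + ε / 2) ?_
      (fun n => by positivity) (by positivity) (by rw [Complex.ofReal_re]; linarith)
    refine Asymptotics.IsBigO.of_bound C ?_
    filter_upwards [eventually_ge_atTop 1] with n hn
    have := hC n (by exact_mod_cast hn)
    rw [Nat.floor_natCast] at this
    rw [Real.norm_of_nonneg (Finset.sum_nonneg fun k _ => by positivity),
      Real.norm_of_nonneg (by positivity)]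
    exact this
  refine h1.norm.congr fun m => ?_
  rw [LSeries.norm_term_eq]
  split_ifs with h
  · subst h
    rw [Nat.cast_zero, Real.zero_rpow (by linarith), mul_zero]
  · rw [Complex.norm_real, Complex.ofReal_re, Real.norm_of_nonneg (by positivity),
      Real.rpow_neg (by positivity), div_eq_mul_inv]

/-- The local series at `Re s = 1/2 + η` are uniformly bounded, and close to `1` at large primes. -/
lemma local_sums (hRS : RankinSelbergBound A) {η : ℝ} (hη : 0 < η) :
    ∃ Z : ℝ, 1 ≤ Z ∧ ∃ p₀ : ℕ, ∀ p : ℕ, p.Prime →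
      (∀ K, ∑ k ∈ Finset.range K, |A (p ^ k)| * ((p ^ k : ℕ) : ℝ) ^ (-(1 / 2 + η)) ≤ Z) ∧
      (p₀ ≤ p → ∀ K,
        ∑ k ∈ Finset.Ico 1 K, |A (p ^ k)| * ((p ^ k : ℕ) : ℝ) ^ (-(1 / 2 + η)) ≤ 1 / 2) := by
  -- A single term of the second moment already gives |A(m)| ≪ m^(1/2+η/2), so at 1/2 + η the local
  -- series is dominated by a geometric series of ratio p^(-η/2).
  obtain ⟨C, hC1, hC⟩ := hRS.abs_le_rpow (ε := η / 2) (by positivity)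
  have hq : ∀ p : ℕ, p.Prime → ∀ k, |A (p ^ k)| * ((p ^ k : ℕ) : ℝ) ^ (-(1 / 2 + η)) ≤
      C * ((p : ℝ) ^ (-(η / 2))) ^ k := by
    intro p hp k
    have hp0 : (0 : ℝ) < p := by exact_mod_cast hp.pos
    have hpk : (0 : ℝ) < ((p ^ k : ℕ) : ℝ) := by exact_mod_cast pow_pos hp.pos k
    calc _ ≤ C * ((p ^ k : ℕ) : ℝ) ^ (1 / 2 + η / 2) * ((p ^ k : ℕ) : ℝ) ^ (-(1 / 2 + η)) := by
          gcongr
          exact hC _ (pow_ne_zero _ hp.ne_zero)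
      _ = C * ((p ^ k : ℕ) : ℝ) ^ (-(η / 2)) := by
          rw [mul_assoc, ← Real.rpow_add hpk]
          ring_nf
      _ = _ := by
          push_cast
          rw [← Real.rpow_natCast, ← Real.rpow_natCast, ← Real.rpow_mul hp0.le,
            ← Real.rpow_mul hp0.le, mul_comm (k : ℝ)]
  set q₂ := (2 : ℝ) ^ (-(η / 2)) with hq2
  have hq2_lt : q₂ < 1 := Real.rpow_lt_one_of_one_lt_of_neg one_lt_two (by linarith)
  have hq2_pos : 0 < q₂ := by positivity
  have hZ1 : 1 ≤ C / (1 - q₂) := by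
    rw [le_div_iff₀ (by linarith)]
    linarith
  have htend : Tendsto (fun p : ℕ => (p : ℝ) ^ (-(η / 2))) atTop (𝓝 0) :=
    (tendsto_rpow_neg_atTop (by positivity)).comp tendsto_natCast_atTop_atTop
  obtain ⟨p₀, hp₀⟩ := eventually_atTop.mp
    (htend.eventually_le_const (show (0 : ℝ) < min (1 / 2) (1 / (4 * C)) by positivity))
  refine ⟨C / (1 - q₂), hZ1, p₀, fun p hp => ⟨fun K => ?_, fun hpp K => ?_⟩⟩
  · have h1 : (p : ℝ) ^ (-(η / 2)) ≤ q₂ :=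
      Real.rpow_le_rpow_of_nonpos two_pos (by exact_mod_cast hp.two_le) (by linarith)
    calc _ ≤ ∑ k ∈ Finset.range K, C * q₂ ^ k := by
          refine Finset.sum_le_sum fun k _ => (hq p hp k).trans ?_
          gcongr
      _ = C * ∑ k ∈ Finset.Ico 0 K, q₂ ^ k := by rw [Finset.mul_sum, Finset.range_eq_Ico]
      _ ≤ C * (q₂ ^ 0 / (1 - q₂)) := by
          gcongr
          exact geom_sum_Ico_le_of_lt_one hq2_pos.le hq2_lt
      _ = _ := by ring
  · have h1 := hp₀ p hpp
    set q := (p : ℝ) ^ (-(η / 2)) with hqd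
    have hq0 : 0 ≤ q := by positivity
    have h2 : q ≤ 1 / 2 := h1.trans (min_le_left _ _)
    have h3 : q ≤ 1 / (4 * C) := h1.trans (min_le_right _ _)
    rw [le_div_iff₀ (by positivity)] at h3
    calc _ ≤ ∑ k ∈ Finset.Ico 1 K, C * q ^ k := Finset.sum_le_sum fun k _ => hq p hp k
      _ = C * ∑ k ∈ Finset.Ico 1 K, q ^ k := by rw [Finset.mul_sum]
      _ ≤ C * (q ^ 1 / (1 - q)) := by
          gcongr
          exact geom_sum_Ico_le_of_lt_one hq0 (by linarith)
      _ ≤ 1 / 2 := by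
          rw [pow_one, ← mul_div_assoc, div_le_iff₀ (by linarith)]
          linarith

end RankinSelbergBound

/-! ### Plancherel and the mean value theorem for Dirichlet polynomials. -/

lemma norm_exp_neg_two_pi (ξ z : ℝ) : ‖Complex.exp (-(2 * Real.pi * ξ * z * Complex.I))‖ = 1 := by
  have := Complex.norm_exp_ofReal_mul_I (-(2 * Real.pi * ξ * z))
  rw [← this]
  congr 2
  push_cast
  ring

/-- Plancherel's identity for combinations of translates of the bump function. -/
lemma integral_norm_sq_sum_bump {ι : Type} (I : Finset ι) (b : ι → ℂ) (z : ι → ℝ) :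
    ∫ w : ℝ, ‖∑ i ∈ I, b i * (bump (w - z i) : ℝ)‖ ^ 2 =
      ∫ ξ : ℝ, ‖bumpHat ξ‖ ^ 2 *
        ‖∑ i ∈ I, b i * Complex.exp (-(2 * Real.pi * ξ * z i * Complex.I))‖ ^ 2 := by
  set f₀ : ℝ → ℂ := fun w => ∑ i ∈ I, b i * schwartzBump (w - z i) with hf₀
  have hsm : ContDiff ℝ (⊤ : ℕ∞) f₀ := by
    refine ContDiff.sum fun i _ => contDiff_const.mul ?_
    exact (schwartzBump.smooth ⊤).comp (contDiff_id.sub contDiff_const)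
  have hcs : HasCompactSupport f₀ := by
    set R := 2 + ∑ i ∈ I, |z i| with hR
    refine HasCompactSupport.of_support_subset_isCompact (isCompact_Icc (a := -R) (b := R)) ?_
    intro w hw
    by_contra hcon
    apply hw
    refine Finset.sum_eq_zero fun i hi => ?_
    have h1 : |z i| ≤ ∑ i ∈ I, |z i| :=
      Finset.single_le_sum (f := fun i => |z i|) (fun _ _ => abs_nonneg _) hi
    have h2 : R < |w| := by
      by_contra h3
      exact hcon (abs_le.mp (not_lt.mp h3))
    have h4 : 2 ≤ |w - z i| := by
      have := abs_sub_abs_le_abs_sub w (z i)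
      linarith
    rw [schwartzBump_apply, bump_eq_zero h4]
    simp
  set f : 𝓢(ℝ, ℂ) := hcs.toSchwartzMap hsm with hf
  have hfa : ∀ w, f w = f₀ w := fun w => rfl
  have hF : ∀ ξ : ℝ, (𝓕 f) ξ =
      bumpHat ξ * ∑ i ∈ I, b i * Complex.exp (-(2 * Real.pi * ξ * z i * Complex.I)) := by
    intro ξ
    rw [SchwartzMap.fourier_coe, Real.fourier_eq']
    have h1 : ∀ w : ℝ, Complex.exp (((-2 * Real.pi * inner ℝ w ξ : ℝ) : ℂ) * Complex.I) • f w =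
        ∑ i ∈ I, b i * Complex.exp (-(2 * Real.pi * ξ * z i * Complex.I)) *
          (Complex.exp (((-2 * Real.pi * inner ℝ (w - z i) ξ : ℝ) : ℂ) * Complex.I) •
            schwartzBump (w - z i)) := by
      intro w
      rw [hfa, smul_eq_mul, Finset.mul_sum]
      refine Finset.sum_congr rfl fun i _ => ?_
      have h2 : Complex.exp (((-2 * Real.pi * inner ℝ w ξ : ℝ) : ℂ) * Complex.I) =
          Complex.exp (-(2 * Real.pi * ξ * z i * Complex.I)) *
          Complex.exp (((-2 * Real.pi * inner ℝ (w - z i) ξ : ℝ) : ℂ) * Complex.I) := by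
        rw [← Complex.exp_add]
        congr 1
        simp
        ring
      rw [h2, smul_eq_mul]
      ring
    have h3 : Integrable fun w : ℝ =>
        Complex.exp (((-2 * Real.pi * inner ℝ w ξ : ℝ) : ℂ) * Complex.I) • schwartzBump w := by
      refine Integrable.mono' schwartzBump.integrable.norm ?_ (Eventually.of_forall fun w => ?_)
      · refine Continuous.aestronglyMeasurable ?_
        have := schwartzBump.continuous
        fun_prop
      · rw [norm_smul, Complex.norm_exp_ofReal_mul_I, one_mul]
    simp_rw [h1]
    rw [integral_finsetSum]
    · simp_rw [integral_const_mul]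
      rw [Finset.mul_sum]
      refine Finset.sum_congr rfl fun i _ => ?_
      rw [integral_sub_right_eq_self (fun w : ℝ =>
        Complex.exp (((-2 * Real.pi * inner ℝ w ξ : ℝ) : ℂ) * Complex.I) • schwartzBump w)]
      rw [← Real.fourier_eq', ← SchwartzMap.fourier_coe, bumpHat, mul_comm]
    · intro i _
      exact (h3.comp_sub_right (z i)).const_mul _
  have h := SchwartzMap.integral_norm_sq_fourier f
  simp_rw [hF, norm_mul, mul_pow] at h
  rw [h]
  rfl

/-- The extreme elements satisfy log(l₁/l₀) ≤ 4/T, and 1 - l₀/l₁ ≤ log(l₁/l₀) turns this into l₁ -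
l₀ ≤ 4N/T. -/
lemma card_le_of_log_window {F : Finset ℕ} {N : ℕ} {T w : ℝ} (hT : 0 < T)
    (hF : ∀ l ∈ F, 1 ≤ l ∧ l ≤ N ∧ |w - T * Real.log l| < 2) : (F.card : ℝ) ≤ 1 + 4 * N / T := by
  rcases F.eq_empty_or_nonempty with rfl | hne
  · simp
    positivity
  obtain ⟨h01, h0N, h0w⟩ := hF _ (F.min'_mem hne)
  obtain ⟨h11, h1N, h1w⟩ := hF _ (F.max'_mem hne)
  set l₀ := F.min' hne
  set l₁ := F.max' hne
  have hle : l₀ ≤ l₁ := F.min'_le _ (F.max'_mem hne)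
  have hcard : F.card ≤ l₁ + 1 - l₀ := by
    rw [← Nat.card_Icc]
    exact Finset.card_le_card fun l hl => Finset.mem_Icc.mpr ⟨F.min'_le _ hl, F.le_max' _ hl⟩
  have hcard' : (F.card : ℝ) ≤ l₁ + 1 - l₀ := by
    have : F.card + l₀ ≤ l₁ + 1 := by omega
    have : (F.card : ℝ) + l₀ ≤ l₁ + 1 := by exact_mod_cast this
    linarith
  have hp0 : (0 : ℝ) < l₀ := by exact_mod_cast h01
  have hp1 : (0 : ℝ) < l₁ := by exact_mod_cast h11
  rw [abs_lt] at h0w h1w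
  have h2 : T * (Real.log l₁ - Real.log l₀) ≤ 4 := by linarith
  have h3 : 1 - ((l₁ : ℝ) / l₀)⁻¹ ≤ Real.log l₁ - Real.log l₀ := by
    rw [← Real.log_div hp1.ne' hp0.ne']
    exact Real.one_sub_inv_le_log_of_pos (by positivity)
  have h4 : (l₁ : ℝ) - l₀ ≤ 4 * N / T := by
    rw [inv_div] at h3
    rw [le_div_iff₀ hT]
    have h5 : (l₁ : ℝ) - l₀ = l₁ * (1 - l₀ / l₁) := by field_simp
    rw [h5]
    have h6 : (l₁ : ℝ) ≤ N := by exact_mod_cast h1N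
    calc (l₁ : ℝ) * (1 - l₀ / l₁) * T ≤ l₁ * (Real.log l₁ - Real.log l₀) * T := by gcongr
      _ = l₁ * (T * (Real.log l₁ - Real.log l₀)) := by ring
      _ ≤ l₁ * 4 := by gcongr
      _ ≤ 4 * N := by linarith
  linarith

/-- The trivial bound for the mean square of smooth short sums. -/
lemma integral_norm_sq_short_sum_le {ι : Type} (I : Finset ι) (b : ι → ℂ) (ν : ι → ℕ) {N R : ℕ}
    (hν : ∀ i ∈ I, 1 ≤ ν i ∧ ν i ≤ N) (hR : ∀ l, (I.filter fun i => ν i = l).card ≤ R)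
    {T : ℝ} (hT : 0 < T) :
    ∫ w : ℝ, ‖∑ i ∈ I, b i * (bump (w - T * Real.log (ν i)) : ℝ)‖ ^ 2 ≤
      (∫ w : ℝ, bump w ^ 2) * R * (1 + 4 * N / T) * ∑ i ∈ I, ‖b i‖ ^ 2 := by
  classical
  have hpt : ∀ w : ℝ, ‖∑ i ∈ I, b i * (bump (w - T * Real.log (ν i)) : ℝ)‖ ^ 2 ≤
      ∑ i ∈ I, (R * (1 + 4 * N / T) * ‖b i‖ ^ 2) * bump (w - T * Real.log (ν i)) ^ 2 := by
    intro w
    set J := I.filter fun i => bump (w - T * Real.log (ν i)) ≠ 0 with hJ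
    -- Only the integers in one logarithmic window are active at w, each with multiplicity at most
    -- R. Cauchy–Schwarz over the active terms then loses just their number.
    have hcard : (J.card : ℝ) ≤ R * (1 + 4 * N / T) := by
      have h1 : J.card ≤ R * (J.image ν).card := by
        refine Finset.card_le_mul_card_image _ _ fun l _ => ?_
        refine (Finset.card_le_card ?_).trans (hR l)
        exact Finset.filter_subset_filter _ (Finset.filter_subset _ _)
      have h2 : ((J.image ν).card : ℝ) ≤ 1 + 4 * N / T := by
        refine card_le_of_log_window (w := w) hT fun l hl => ?_
        obtain ⟨i, hi, rfl⟩ := Finset.mem_image.mp hl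
        obtain ⟨hi1, hi2⟩ := Finset.mem_filter.mp hi
        exact ⟨(hν i hi1).1, (hν i hi1).2, abs_lt_two_of_bump_ne_zero hi2⟩
      calc (J.card : ℝ) ≤ R * (J.image ν).card := by exact_mod_cast h1
        _ ≤ _ := by gcongr
    have h3 : ∑ i ∈ I, b i * (bump (w - T * Real.log (ν i)) : ℝ) =
        ∑ i ∈ J, b i * (bump (w - T * Real.log (ν i)) : ℝ) := by
      symm
      refine Finset.sum_subset (Finset.filter_subset _ _) fun i hi hi' => ?_
      have : bump (w - T * Real.log (ν i)) = 0 := by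
        by_contra h
        exact hi' (Finset.mem_filter.mpr ⟨hi, h⟩)
      rw [this]; simp
    have h4 : ‖∑ i ∈ J, b i * (bump (w - T * Real.log (ν i)) : ℝ)‖ ^ 2 ≤
        J.card * ∑ i ∈ J, (‖b i‖ * bump (w - T * Real.log (ν i))) ^ 2 := by
      calc _ ≤ (∑ i ∈ J, ‖b i‖ * bump (w - T * Real.log (ν i))) ^ 2 := by
            gcongr
            refine norm_sum_le_of_le _ fun i _ => ?_
            rw [norm_mul, Complex.norm_real, Real.norm_of_nonneg bump.nonneg]
        _ ≤ _ := sq_sum_le_card_mul_sum_sq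
    rw [h3]
    refine h4.trans ?_
    calc _ ≤ (R * (1 + 4 * N / T)) * ∑ i ∈ J, (‖b i‖ * bump (w - T * Real.log (ν i))) ^ 2 := by
          gcongr
      _ ≤ (R * (1 + 4 * N / T)) * ∑ i ∈ I, (‖b i‖ * bump (w - T * Real.log (ν i))) ^ 2 := by
          gcongr
          exact Finset.filter_subset _ _
      _ = _ := by
          rw [Finset.mul_sum]
          refine Finset.sum_congr rfl fun i _ => ?_
          ring
  have hint : Integrable fun w : ℝ => bump w ^ 2 := by
    refine Continuous.integrable_of_hasCompactSupport (bump.continuous.pow 2) ?_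
    exact bump.hasCompactSupport.comp_left (g := fun x : ℝ => x ^ 2) (by simp)
  calc _ ≤ ∫ w : ℝ, ∑ i ∈ I, (R * (1 + 4 * N / T) * ‖b i‖ ^ 2) *
        bump (w - T * Real.log (ν i)) ^ 2 := by
        refine integral_mono_of_nonneg (Eventually.of_forall fun w => by positivity) ?_
          (Eventually.of_forall hpt)
        exact integrable_finsetSum _ fun i _ => (hint.comp_sub_right _).const_mul _
    _ = ∑ i ∈ I, (R * (1 + 4 * N / T) * ‖b i‖ ^ 2) * ∫ w : ℝ, bump w ^ 2 := by
        rw [integral_finsetSum _ fun i _ => (hint.comp_sub_right _).const_mul _]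
        refine Finset.sum_congr rfl fun i _ => ?_
        rw [integral_const_mul, integral_sub_right_eq_self (fun w : ℝ => bump w ^ 2)]
    _ = _ := by
        rw [← Finset.sum_mul, ← Finset.mul_sum]
        ring

/-- The Dirichlet polynomial `∑ b_i ν_i^{-2πiξ}`. -/
noncomputable def dirichletPoly {ι : Type} (I : Finset ι) (b : ι → ℂ) (ν : ι → ℕ) (ξ : ℝ) : ℂ :=
  ∑ i ∈ I, b i * Complex.exp (-(2 * Real.pi * ξ * Real.log (ν i) * Complex.I))

lemma continuous_dirichletPoly {ι : Type} (I : Finset ι) (b : ι → ℂ) (ν : ι → ℕ) :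
    Continuous (dirichletPoly I b ν) := by
  unfold dirichletPoly
  fun_prop

lemma integral_short_sum_eq {ι : Type} (I : Finset ι) (b : ι → ℂ) (ν : ι → ℕ) (T : ℝ) :
    ∫ w : ℝ, ‖∑ i ∈ I, b i * (bump (w - T * Real.log (ν i)) : ℝ)‖ ^ 2 =
      ∫ ξ : ℝ, ‖bumpHat ξ‖ ^ 2 * ‖dirichletPoly I b ν (T * ξ)‖ ^ 2 := by
  rw [integral_norm_sq_sum_bump]
  refine integral_congr_ae (Eventually.of_forall fun ξ => ?_)
  simp only [dirichletPoly]
  congr 3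
  refine Finset.sum_congr rfl fun i _ => ?_
  congr 3
  push_cast
  ring

lemma integrable_bumpHat_sq : Integrable fun ξ : ℝ => ‖bumpHat ξ‖ ^ 2 := by
  have := (bumpHat.memLp 2 (μ := volume)).integrable_norm_pow (by norm_num)
  simpa using this

lemma norm_dirichletPoly_le {ι : Type} (I : Finset ι) (b : ι → ℂ) (ν : ι → ℕ) (ξ : ℝ) :
    ‖dirichletPoly I b ν ξ‖ ≤ ∑ i ∈ I, ‖b i‖ := by
  refine norm_sum_le_of_le _ fun i _ => ?_
  rw [norm_mul, norm_exp_neg_two_pi, mul_one]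

lemma integrable_bumpHat_sq_mul_dirichletPoly {ι : Type} (I : Finset ι) (b : ι → ℂ) (ν : ι → ℕ)
    (T : ℝ) : Integrable fun ξ : ℝ => ‖bumpHat ξ‖ ^ 2 * ‖dirichletPoly I b ν (T * ξ)‖ ^ 2 := by
  refine Integrable.mono' (integrable_bumpHat_sq.mul_const ((∑ i ∈ I, ‖b i‖) ^ 2)) ?_
    (Eventually.of_forall fun ξ => ?_)
  · refine Continuous.aestronglyMeasurable ?_
    have := bumpHat.continuous
    have := continuous_dirichletPoly I b ν
    fun_prop
  · rw [Real.norm_of_nonneg (by positivity)]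
    gcongr
    exact norm_dirichletPoly_le _ _ _ _

/-- At 0 the transform is the integral of the bump, which is positive; continuity does the rest. -/
lemma exists_bumpHat_lower : ∃ ξ₀ c : ℝ, 0 < ξ₀ ∧ 0 < c ∧ ∀ ξ : ℝ, |ξ| ≤ ξ₀ → c ≤ ‖bumpHat ξ‖ ^ 2 := by
  have h0 : bumpHat 0 = ((∫ u : ℝ, bump u : ℝ) : ℂ) := by
    rw [bumpHat, SchwartzMap.fourier_coe, Real.fourier_eq', ← integral_complex_ofReal]
    simp [schwartzBump_apply]
  have hpos : 0 < ‖bumpHat 0‖ := by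
    rw [h0, norm_pos_iff]
    exact_mod_cast (bump.integral_pos (μ := volume)).ne'
  have hcont : Continuous fun ξ : ℝ => ‖bumpHat ξ‖ := bumpHat.continuous.norm
  have hev : ∀ᶠ ξ in 𝓝 (0 : ℝ), ‖bumpHat 0‖ / 2 < ‖bumpHat ξ‖ :=
    hcont.continuousAt.eventually_const_lt (by linarith)
  obtain ⟨r, hr, hr'⟩ := Metric.eventually_nhds_iff.mp hev
  refine ⟨r / 2, (‖bumpHat 0‖ / 2) ^ 2, by positivity, by positivity, fun ξ hξ => ?_⟩
  have := hr' (y := ξ) (by rw [dist_zero_right, Real.norm_eq_abs]; linarith)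
  gcongr

/-- The mean value theorem for Dirichlet polynomials. -/
lemma exists_mean_value : ∃ C : ℝ, 0 < C ∧ ∀ {ι : Type} (I : Finset ι) (b : ι → ℂ) (ν : ι → ℕ)
    {N R : ℕ}, (∀ i ∈ I, 1 ≤ ν i ∧ ν i ≤ N) → (∀ l, (I.filter fun i => ν i = l).card ≤ R) →
    ∀ {X : ℝ}, 0 < X → ∫ ξ in (-X)..X, ‖dirichletPoly I b ν ξ‖ ^ 2 ≤
      C * R * (X + N) * ∑ i ∈ I, ‖b i‖ ^ 2 := by
  obtain ⟨ξ₀, c, hξ₀, hc, hlow⟩ := exists_bumpHat_lower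
  set J := ∫ w : ℝ, bump w ^ 2 with hJ
  have hJ0 : 0 ≤ J := integral_nonneg fun w => by positivity
  refine ⟨(J + 1) / c * (1 / ξ₀ + 4), by positivity, ?_⟩
  intro ι I b ν N R hν hR X hX
  -- With this T the interval |Tξ| ≤ X is |ξ| ≤ ξ₀, where the Plancherel weight is at least c.
  set T := X / ξ₀ with hT
  have hT0 : 0 < T := by positivity
  have h1 := integral_norm_sq_short_sum_le I b ν hν hR hT0
  rw [integral_short_sum_eq] at h1
  have hcd := continuous_dirichletPoly I b ν
  have h2 : c * ∫ ξ in (-ξ₀)..ξ₀, ‖dirichletPoly I b ν (T * ξ)‖ ^ 2 ≤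
      ∫ ξ : ℝ, ‖bumpHat ξ‖ ^ 2 * ‖dirichletPoly I b ν (T * ξ)‖ ^ 2 := by
    rw [← intervalIntegral.integral_const_mul, intervalIntegral.integral_of_le (by linarith)]
    refine le_trans ?_ (setIntegral_le_integral (s := Set.Ioc (-ξ₀) ξ₀)
      (integrable_bumpHat_sq_mul_dirichletPoly I b ν T)
      (Eventually.of_forall fun ξ => by positivity))
    refine setIntegral_mono_on ?_ (integrable_bumpHat_sq_mul_dirichletPoly I b ν T).integrableOn
      measurableSet_Ioc fun ξ hξ => ?_
    · refine Continuous.integrableOn_Ioc ?_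
      fun_prop
    · have := hlow ξ (abs_le.mpr ⟨hξ.1.le, hξ.2⟩)
      gcongr
  rw [intervalIntegral.integral_comp_mul_left (fun ξ => ‖dirichletPoly I b ν ξ‖ ^ 2) hT0.ne',
    mul_neg, show T * ξ₀ = X by rw [hT]; field_simp, smul_eq_mul] at h2
  have h3 := h2.trans h1
  have h4 : ∫ ξ in (-X)..X, ‖dirichletPoly I b ν ξ‖ ^ 2 ≤
      T / c * (J * R * (1 + 4 * N / T) * ∑ i ∈ I, ‖b i‖ ^ 2) := by
    rw [← mul_assoc] at h3
    have h5 : T / c * (c * T⁻¹) = 1 := by field_simp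
    calc ∫ ξ in (-X)..X, ‖dirichletPoly I b ν ξ‖ ^ 2
        = T / c * (c * T⁻¹ * ∫ ξ in (-X)..X, ‖dirichletPoly I b ν ξ‖ ^ 2) := by
          rw [← mul_assoc, h5, one_mul]
      _ ≤ _ := by gcongr
  refine h4.trans ?_
  have h6 : T / c * (J * R * (1 + 4 * N / T) * ∑ i ∈ I, ‖b i‖ ^ 2) =
      J / c * R * (X / ξ₀ + 4 * N) * ∑ i ∈ I, ‖b i‖ ^ 2 := by
    rw [← hT]
    field_simp
  rw [h6]
  have hS : 0 ≤ ∑ i ∈ I, ‖b i‖ ^ 2 := Finset.sum_nonneg fun i _ => by positivity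
  have h7 : X / ξ₀ + 4 * N ≤ (1 / ξ₀ + 4) * (X + N) := by
    have h8 : 0 ≤ 1 / ξ₀ * N := by positivity
    have h9 : X / ξ₀ = 1 / ξ₀ * X := by ring
    rw [h9]
    nlinarith
  calc J / c * R * (X / ξ₀ + 4 * N) * ∑ i ∈ I, ‖b i‖ ^ 2
      ≤ (J + 1) / c * R * ((1 / ξ₀ + 4) * (X + N)) * ∑ i ∈ I, ‖b i‖ ^ 2 := by
        gcongr
        linarith
    _ = _ := by ring

/-! ### Mean squares of products over coprime variables. -/

/-- The Dirichlet polynomial with coefficients `α n` over `n ≤ N`, `g ∣ n`. -/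
noncomputable def dvdPoly (N : ℕ) (α : ℕ → ℂ) (g : ℕ) (ξ : ℝ) : ℂ :=
  dirichletPoly ((Finset.Icc 1 N).filter (g ∣ ·)) α id ξ

lemma continuous_dvdPoly (N : ℕ) (α : ℕ → ℂ) (g : ℕ) : Continuous (dvdPoly N α g) :=
  continuous_dirichletPoly _ _ _

/-- Pairs of coprime positive integers up to `N₁` and `N₂`. -/
def coprimePairs (N₁ N₂ : ℕ) : Finset (ℕ × ℕ) :=
  (Finset.Icc 1 N₁ ×ˢ Finset.Icc 1 N₂).filter fun x => x.1.Coprime x.2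

/-- The product of two Dirichlet polynomials, restricted to coprime variables. -/
noncomputable def coprimePoly (N₁ N₂ : ℕ) (α β : ℕ → ℂ) (ξ : ℝ) : ℂ :=
  dirichletPoly (coprimePairs N₁ N₂) (fun x => α x.1 * β x.2) (fun x => x.1 * x.2) ξ

open ArithmeticFunction in
lemma sum_moebius_common_divisors {n m N : ℕ} (hn : n ∈ Finset.Icc 1 N) :
    ∑ g ∈ Finset.Icc 1 N with g ∣ n ∧ g ∣ m, moebius g = if n.Coprime m then 1 else 0 := by
  have h0 : n.gcd m ≠ 0 := by
    have := Finset.mem_Icc.mp hn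
    exact (Nat.gcd_pos_of_pos_left _ (by omega)).ne'
  have h1 : (Finset.Icc 1 N).filter (fun g => g ∣ n ∧ g ∣ m) = (n.gcd m).divisors := by
    ext g
    simp only [Finset.mem_filter, Finset.mem_Icc, Nat.mem_divisors, Nat.dvd_gcd_iff] at hn ⊢
    constructor
    · rintro ⟨_, h⟩
      exact ⟨h, h0⟩
    · rintro ⟨h, _⟩
      have := Nat.le_of_dvd (by omega) h.1
      have := Nat.pos_of_dvd_of_pos h.1 (by omega)
      exact ⟨⟨by omega, by omega⟩, h⟩
  rw [h1, ← coe_zeta_mul_apply, coe_zeta_mul_moebius, one_apply]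

/-- Möbius inversion over common divisors decouples the two variables: for each modulus g the
product is that of two independent Dirichlet polynomials. -/
lemma coprimePoly_eq_sum (N₁ N₂ : ℕ) (α β : ℕ → ℂ) (ξ : ℝ) :
    coprimePoly N₁ N₂ α β ξ = ∑ g ∈ Finset.Icc 1 N₁,
      (ArithmeticFunction.moebius g : ℂ) * (dvdPoly N₁ α g ξ * dvdPoly N₂ β g ξ) := by
  set e : ℕ → ℂ := fun n => Complex.exp (-(2 * Real.pi * ξ * Real.log n * Complex.I)) with he
  have hmul : ∀ n m : ℕ, n ≠ 0 → m ≠ 0 → e (n * m) = e n * e m := by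
    intro n m hn hm
    simp only [he]
    rw [← Complex.exp_add]
    push_cast
    rw [Real.log_mul (by exact_mod_cast hn) (by exact_mod_cast hm)]
    congr 1
    push_cast
    ring
  have h1 : ∀ g, dvdPoly N₁ α g ξ * dvdPoly N₂ β g ξ =
      ∑ x ∈ Finset.Icc 1 N₁ ×ˢ Finset.Icc 1 N₂,
        if g ∣ x.1 ∧ g ∣ x.2 then α x.1 * β x.2 * e (x.1 * x.2) else 0 := by
    intro g
    rw [dvdPoly, dvdPoly, dirichletPoly, dirichletPoly, Finset.sum_mul_sum, Finset.sum_product,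
      Finset.sum_filter]
    refine Finset.sum_congr rfl fun n hn => ?_
    by_cases hgn : g ∣ n
    · rw [if_pos hgn, Finset.sum_filter]
      refine Finset.sum_congr rfl fun m hm => ?_
      by_cases hgm : g ∣ m
      · rw [if_pos hgm, if_pos ⟨hgn, hgm⟩]
        rw [hmul n m (by have := Finset.mem_Icc.mp hn; omega)
          (by have := Finset.mem_Icc.mp hm; omega)]
        simp only [he, id]
        ring
      · rw [if_neg hgm, if_neg (fun h => hgm h.2)]
    · rw [if_neg hgn]
      symm
      exact Finset.sum_eq_zero fun m _ => if_neg fun h => hgn h.1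
  simp_rw [h1, Finset.mul_sum]
  rw [Finset.sum_comm, coprimePoly, dirichletPoly, coprimePairs, Finset.sum_filter]
  refine Finset.sum_congr rfl fun x hx => ?_
  have hx1 := (Finset.mem_product.mp hx).1
  have h2 := sum_moebius_common_divisors (m := x.2) hx1
  have h3 : ∑ g ∈ Finset.Icc 1 N₁, (ArithmeticFunction.moebius g : ℂ) *
      (if g ∣ x.1 ∧ g ∣ x.2 then α x.1 * β x.2 * e (x.1 * x.2) else 0) =
      ((∑ g ∈ Finset.Icc 1 N₁ with g ∣ x.1 ∧ g ∣ x.2, ArithmeticFunction.moebius g : ℤ) : ℂ) *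
        (α x.1 * β x.2 * e (x.1 * x.2)) := by
    push_cast
    rw [Finset.sum_mul, Finset.sum_filter]
    refine Finset.sum_congr rfl fun g _ => ?_
    split_ifs <;> simp
  rw [h3, h2]
  split_ifs
  · rw [Int.cast_one, one_mul]
  · simp

/-- The sum of `|dvdPoly|²` over all moduli. -/
noncomputable def dvdSquareSum (G N : ℕ) (α : ℕ → ℂ) (ξ : ℝ) : ℝ :=
  ∑ g ∈ Finset.Icc 1 G, ‖dvdPoly N α g ξ‖ ^ 2

lemma continuous_dvdSquareSum (G N : ℕ) (α : ℕ → ℂ) : Continuous (dvdSquareSum G N α) := by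
  unfold dvdSquareSum
  have := continuous_dvdPoly N α
  fun_prop

lemma dvdSquareSum_nonneg (G N : ℕ) (α : ℕ → ℂ) (ξ : ℝ) : 0 ≤ dvdSquareSum G N α ξ :=
  Finset.sum_nonneg fun _ _ => by positivity

/-- Cauchy–Schwarz over the moduli, with |μ(g)| ≤ 1. The sums over g take over the role of the
squares of the two factors. -/
lemma norm_sq_coprimePoly_le (N₁ N₂ : ℕ) (α β : ℕ → ℂ) (ξ : ℝ) :
    ‖coprimePoly N₁ N₂ α β ξ‖ ^ 2 ≤ dvdSquareSum N₁ N₁ α ξ * dvdSquareSum N₁ N₂ β ξ := by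
  rw [coprimePoly_eq_sum]
  calc _ ≤ (∑ g ∈ Finset.Icc 1 N₁, ‖dvdPoly N₁ α g ξ‖ * ‖dvdPoly N₂ β g ξ‖) ^ 2 := by
        gcongr
        refine norm_sum_le_of_le _ fun g _ => ?_
        rw [norm_mul, norm_mul]
        refine mul_le_of_le_one_left (by positivity) ?_
        rw [Complex.norm_intCast]
        exact_mod_cast ArithmeticFunction.abs_moebius_le_one
    _ ≤ _ := Finset.sum_mul_sq_le_sq_mul_sq _ _ _

lemma sum_sum_dvd_le (G N : ℕ) (f : ℕ → ℝ) (hf : ∀ n, 0 ≤ f n) :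
    ∑ g ∈ Finset.Icc 1 G, ∑ n ∈ Finset.Icc 1 N with g ∣ n, f n ≤
      ∑ n ∈ Finset.Icc 1 N, (n.divisors.card : ℝ) * f n := by
  simp_rw [Finset.sum_filter]
  rw [Finset.sum_comm]
  refine Finset.sum_le_sum fun n hn => ?_
  rw [← Finset.sum_filter, Finset.sum_const, nsmul_eq_mul]
  gcongr
  · exact hf n
  · intro g hg
    have hn' := Finset.mem_Icc.mp hn
    exact Nat.mem_divisors.mpr ⟨(Finset.mem_filter.mp hg).2, by omega⟩

lemma exists_integral_dvdSquareSum_le : ∃ C : ℝ, 0 < C ∧ ∀ (G N : ℕ) (β : ℕ → ℂ) {X : ℝ}, 0 < X →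
    ∫ ξ in (-X)..X, dvdSquareSum G N β ξ ≤
      C * (X + N) * ∑ n ∈ Finset.Icc 1 N, (n.divisors.card : ℝ) * ‖β n‖ ^ 2 := by
  obtain ⟨C, hC, hmv⟩ := exists_mean_value
  refine ⟨C, hC, fun G N β X hX => ?_⟩
  unfold dvdSquareSum
  rw [intervalIntegral.integral_finsetSum]
  · calc _ ≤ ∑ g ∈ Finset.Icc 1 G, C * (1 : ℕ) * (X + N) *
          ∑ n ∈ Finset.Icc 1 N with g ∣ n, ‖β n‖ ^ 2 := by
          refine Finset.sum_le_sum fun g _ => hmv _ _ _ ?_ ?_ hX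
          · intro i hi
            exact Finset.mem_Icc.mp (Finset.mem_filter.mp hi).1
          · intro l
            refine Finset.card_le_one.mpr fun a ha b hb => ?_
            exact (Finset.mem_filter.mp ha).2.trans (Finset.mem_filter.mp hb).2.symm
      _ = C * (X + N) * ∑ g ∈ Finset.Icc 1 G, ∑ n ∈ Finset.Icc 1 N with g ∣ n, ‖β n‖ ^ 2 := by
          rw [Finset.mul_sum]
          refine Finset.sum_congr rfl fun g _ => ?_
          simp
      _ ≤ _ := by
          gcongr
          exact sum_sum_dvd_le G N (fun n => ‖β n‖ ^ 2) fun n => by positivity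
  · intro g _
    have := continuous_dvdPoly N β g
    exact Continuous.intervalIntegrable (by fun_prop) _ _

lemma prod_dvdPoly_eq {k : ℕ} (N : ℕ) (α : ℕ → ℂ) (g : Fin k → ℕ) (ξ : ℝ) :
    ∏ i, dvdPoly N α (g i) ξ =
      dirichletPoly (Fintype.piFinset fun i => (Finset.Icc 1 N).filter (g i ∣ ·))
        (fun n => ∏ i, α (n i)) (fun n => ∏ i, n i) ξ := by
  simp only [dvdPoly, dirichletPoly]
  rw [Finset.prod_univ_sum]
  refine Finset.sum_congr rfl fun n hn => ?_
  rw [Finset.prod_mul_distrib, ← Complex.exp_sum]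
  congr 2
  push_cast
  rw [Real.log_prod]
  · push_cast
    rw [Finset.mul_sum, Finset.sum_mul, ← Finset.sum_neg_distrib]
    rfl
  · intro i _
    have := Finset.mem_filter.mp (Fintype.mem_piFinset.mp hn i)
    have := Finset.mem_Icc.mp this.1
    exact_mod_cast (by omega : n i ≠ 0)

/-- The k-th power expands over k-tuples of moduli into squares of Dirichlet polynomials of length
N^k. The mean value theorem applies to each, since an integer l is a product of k factors in at most
d(l)^k ways. -/
lemma exists_integral_dvdSquareSum_pow_le : ∃ C : ℝ, 0 < C ∧ ∀ (G N k R : ℕ) (α : ℕ → ℂ),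
    (∀ l, 1 ≤ l → l ≤ N ^ k → l.divisors.card ^ k ≤ R) → ∀ {X : ℝ}, 0 < X →
    ∫ ξ in (-X)..X, dvdSquareSum G N α ξ ^ k ≤
      C * R * (X + N ^ k) * (∑ n ∈ Finset.Icc 1 N, (n.divisors.card : ℝ) * ‖α n‖ ^ 2) ^ k := by
  classical
  obtain ⟨C, hC, hmv⟩ := exists_mean_value
  refine ⟨C, hC, fun G N k R α hR X hX => ?_⟩
  have h1 : ∀ ξ, dvdSquareSum G N α ξ ^ k =
      ∑ g ∈ Fintype.piFinset (fun _ : Fin k => Finset.Icc 1 G),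
        ‖dirichletPoly (Fintype.piFinset fun i => (Finset.Icc 1 N).filter (g i ∣ ·))
        (fun n => ∏ i, α (n i)) (fun n => ∏ i, n i) ξ‖ ^ 2 := by
    intro ξ
    rw [dvdSquareSum, Finset.sum_pow']
    refine Finset.sum_congr rfl fun g _ => ?_
    rw [← prod_dvdPoly_eq, norm_prod, Finset.prod_pow]
  simp_rw [h1]
  rw [intervalIntegral.integral_finsetSum]
  · calc _ ≤ ∑ g ∈ Fintype.piFinset (fun _ : Fin k => Finset.Icc 1 G),
          C * R * (X + (N ^ k : ℕ)) *
          ∑ n ∈ Fintype.piFinset fun i => (Finset.Icc 1 N).filter (g i ∣ ·),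
            ‖∏ i, α (n i)‖ ^ 2 := by
          refine Finset.sum_le_sum fun g _ => hmv _ _ _ ?_ ?_ hX
          · intro n hn
            have hn' : ∀ i, 1 ≤ n i ∧ n i ≤ N := fun i =>
              Finset.mem_Icc.mp (Finset.mem_filter.mp (Fintype.mem_piFinset.mp hn i)).1
            constructor
            · exact Finset.one_le_prod' fun i _ => (hn' i).1
            · calc ∏ i, n i ≤ ∏ _i : Fin k, N := Finset.prod_le_prod' fun i _ => (hn' i).2
                _ = N ^ k := by simp
          · intro l
            rcases (Finset.filter (fun n : Fin k → ℕ => ∏ i, n i = l)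
              (Fintype.piFinset fun i => (Finset.Icc 1 N).filter (g i ∣ ·))).eq_empty_or_nonempty
              with he | ⟨n₀, hn₀⟩
            · rw [he]; simp
            have hb : ∀ n ∈ Finset.filter (fun n : Fin k → ℕ => ∏ i, n i = l)
              (Fintype.piFinset fun i => (Finset.Icc 1 N).filter (g i ∣ ·)),
              (∀ i, 1 ≤ n i ∧ n i ≤ N) ∧ ∏ i, n i = l := by
              intro n hn
              obtain ⟨h2, h3⟩ := Finset.mem_filter.mp hn
              exact ⟨fun i => Finset.mem_Icc.mp
                (Finset.mem_filter.mp (Fintype.mem_piFinset.mp h2 i)).1, h3⟩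
            have hl1 : 1 ≤ l := by
              rw [← (hb n₀ hn₀).2]
              exact Finset.one_le_prod' fun i _ => ((hb n₀ hn₀).1 i).1
            have hl2 : l ≤ N ^ k := by
              rw [← (hb n₀ hn₀).2]
              calc ∏ i, n₀ i ≤ ∏ _i : Fin k, N :=
                    Finset.prod_le_prod' fun i _ => ((hb n₀ hn₀).1 i).2
                _ = N ^ k := by simp
            refine le_trans ?_ (hR l hl1 hl2)
            calc _ ≤ (Fintype.piFinset fun _ : Fin k => l.divisors).card := by
                  refine Finset.card_le_card fun n hn => ?_
                  refine Fintype.mem_piFinset.mpr fun i => Nat.mem_divisors.mpr ⟨?_, by omega⟩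
                  rw [← (hb n hn).2]
                  exact Finset.dvd_prod_of_mem _ (Finset.mem_univ i)
              _ = _ := by simp
      _ = C * R * (X + N ^ k) *
          (∑ g ∈ Finset.Icc 1 G, ∑ n ∈ Finset.Icc 1 N with g ∣ n, ‖α n‖ ^ 2) ^ k := by
          rw [← Finset.mul_sum, Finset.sum_pow']
          push_cast
          congr 1
          refine Finset.sum_congr rfl fun g _ => ?_
          rw [Finset.prod_univ_sum]
          refine Finset.sum_congr rfl fun n _ => ?_
          rw [norm_prod, Finset.prod_pow]
      _ ≤ _ := by
          gcongr
          exact sum_sum_dvd_le G N (fun n => ‖α n‖ ^ 2) fun n => by positivity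
  · intro g _
    have := continuous_dirichletPoly (Fintype.piFinset fun i => (Finset.Icc 1 N).filter (g i ∣ ·))
        (fun n => ∏ i, α (n i)) (fun n => ∏ i, n i)
    exact Continuous.intervalIntegrable (by fun_prop) _ _

/-- Mean square of a coprime product of Dirichlet polynomials: where the first factor is small one
uses the mean value theorem, and on the exceptional set a pointwise bound together with a high
moment of the first factor. -/
lemma exists_integral_coprimePoly_le : ∃ C : ℝ, 0 < C ∧ ∀ (N₁ N₂ k R : ℕ) (α β : ℕ → ℂ),
    (∀ l, 1 ≤ l → l ≤ N₁ ^ k → l.divisors.card ^ k ≤ R) →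
    ∀ {X Λ B : ℝ}, 0 < X → 0 < Λ →
    (∀ ξ : ℝ, |ξ| ≤ X → ‖coprimePoly N₁ N₂ α β ξ‖ ≤ B) →
    ∫ ξ in (-X)..X, ‖coprimePoly N₁ N₂ α β ξ‖ ^ 2 ≤
      C * (Λ * (X + N₂) * (∑ m ∈ Finset.Icc 1 N₂, (m.divisors.card : ℝ) * ‖β m‖ ^ 2) +
        B ^ 2 / Λ ^ k * R * (X + N₁ ^ k) *
          (∑ n ∈ Finset.Icc 1 N₁, (n.divisors.card : ℝ) * ‖α n‖ ^ 2) ^ k) := by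
  obtain ⟨C₁, hC₁, h₁⟩ := exists_integral_dvdSquareSum_le
  obtain ⟨C₂, hC₂, h₂⟩ := exists_integral_dvdSquareSum_pow_le
  refine ⟨max C₁ C₂, lt_max_of_lt_left hC₁, fun N₁ N₂ k R α β hR X Λ B hX hΛ hB => ?_⟩
  have hc0 : Continuous (coprimePoly N₁ N₂ α β) := continuous_dirichletPoly _ _ _
  have hc1 := continuous_dvdSquareSum N₁ N₁ α
  have hc2 := continuous_dvdSquareSum N₁ N₂ β
  have hpt : ∀ ξ ∈ Set.Icc (-X) X, ‖coprimePoly N₁ N₂ α β ξ‖ ^ 2 ≤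
      Λ * dvdSquareSum N₁ N₂ β ξ + B ^ 2 / Λ ^ k * dvdSquareSum N₁ N₁ α ξ ^ k := by
    intro ξ hξ
    have hG := dvdSquareSum_nonneg N₁ N₁ α ξ
    have hM := dvdSquareSum_nonneg N₁ N₂ β ξ
    rcases le_total (dvdSquareSum N₁ N₁ α ξ) Λ with h | h
    · have h3 : 0 ≤ B ^ 2 / Λ ^ k * dvdSquareSum N₁ N₁ α ξ ^ k := by positivity
      calc _ ≤ dvdSquareSum N₁ N₁ α ξ * dvdSquareSum N₁ N₂ β ξ := norm_sq_coprimePoly_le _ _ _ _ _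
        _ ≤ Λ * dvdSquareSum N₁ N₂ β ξ := by gcongr
        _ ≤ _ := by linarith
    · have h3 : 0 ≤ Λ * dvdSquareSum N₁ N₂ β ξ := by positivity
      calc _ ≤ B ^ 2 := by
            gcongr
            exact hB ξ (abs_le.mpr hξ)
        _ ≤ B ^ 2 * (dvdSquareSum N₁ N₁ α ξ / Λ) ^ k := by
            refine le_mul_of_one_le_right (by positivity) (one_le_pow₀ ?_)
            rwa [one_le_div hΛ]
        _ = B ^ 2 / Λ ^ k * dvdSquareSum N₁ N₁ α ξ ^ k := by rw [div_pow]; ring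
        _ ≤ _ := by linarith
  have hS1 : 0 ≤ ∑ m ∈ Finset.Icc 1 N₂, (m.divisors.card : ℝ) * ‖β m‖ ^ 2 :=
    Finset.sum_nonneg fun _ _ => by positivity
  have hS2 : 0 ≤ ∑ n ∈ Finset.Icc 1 N₁, (n.divisors.card : ℝ) * ‖α n‖ ^ 2 :=
    Finset.sum_nonneg fun _ _ => by positivity
  calc _ ≤ ∫ ξ in (-X)..X, (Λ * dvdSquareSum N₁ N₂ β ξ +
        B ^ 2 / Λ ^ k * dvdSquareSum N₁ N₁ α ξ ^ k) := by
        refine intervalIntegral.integral_mono_on (by linarith) ?_ ?_ hpt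
        · exact Continuous.intervalIntegrable (by fun_prop) _ _
        · exact Continuous.intervalIntegrable (by fun_prop) _ _
    _ = Λ * (∫ ξ in (-X)..X, dvdSquareSum N₁ N₂ β ξ) +
        B ^ 2 / Λ ^ k * ∫ ξ in (-X)..X, dvdSquareSum N₁ N₁ α ξ ^ k := by
        rw [intervalIntegral.integral_add, intervalIntegral.integral_const_mul,
          intervalIntegral.integral_const_mul]
        · exact Continuous.intervalIntegrable (by fun_prop) _ _
        · exact Continuous.intervalIntegrable (by fun_prop) _ _
    _ ≤ Λ * (C₁ * (X + N₂) * (∑ m ∈ Finset.Icc 1 N₂, (m.divisors.card : ℝ) * ‖β m‖ ^ 2)) +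
        B ^ 2 / Λ ^ k * (C₂ * R * (X + N₁ ^ k) *
          (∑ n ∈ Finset.Icc 1 N₁, (n.divisors.card : ℝ) * ‖α n‖ ^ 2) ^ k) := by
        gcongr
        · exact h₁ N₁ N₂ β hX
        · exact h₂ N₁ N₁ k R α hR hX
    _ ≤ Λ * (max C₁ C₂ * (X + N₂) * (∑ m ∈ Finset.Icc 1 N₂, (m.divisors.card : ℝ) * ‖β m‖ ^ 2)) +
        B ^ 2 / Λ ^ k * (max C₁ C₂ * R * (X + N₁ ^ k) *
          (∑ n ∈ Finset.Icc 1 N₁, (n.divisors.card : ℝ) * ‖α n‖ ^ 2) ^ k) := by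
        gcongr
        · exact le_max_left _ _
        · exact le_max_right _ _
    _ = _ := by ring

/-! ### Detecting sign changes by short sums. -/

-- The index m is the first one after n₁ whose sign is opposite to that of A(n₁). The last non-zero
-- term before m then has the sign of A(n₁), since otherwise m would not be first.
open Classical in
lemma exists_signChange_between {A : ℕ → ℝ} {n₁ n₂ : ℕ} {X : ℝ} (hn₁ : 1 ≤ n₁) (hlt : n₁ < n₂)
    (hn₂ : n₂ ≤ ⌊X⌋₊) (hA : A n₁ * A n₂ < 0) :
    ∃ m ∈ {m ∈ Finset.Icc 1 ⌊X⌋₊ | ∃ n : ℕ, 1 ≤ n ∧ n < m ∧ A n * A m < 0 ∧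
      ∀ j : ℕ, n < j → j < m → A j = 0}, n₁ ≤ m ∧ m ≤ n₂ := by
  have hex : ∃ m, n₁ < m ∧ A n₁ * A m < 0 := ⟨n₂, hlt, hA⟩
  set m := Nat.find hex with hm
  obtain ⟨hm1, hm2⟩ : n₁ < m ∧ A n₁ * A m < 0 := Nat.find_spec hex
  have hm3 : m ≤ n₂ := Nat.find_min' hex ⟨hlt, hA⟩
  have hne : ((Finset.Ico n₁ m).filter fun j => A j ≠ 0).Nonempty := by
    refine ⟨n₁, Finset.mem_filter.mpr ⟨Finset.mem_Ico.mpr ⟨le_rfl, hm1⟩, fun h => ?_⟩⟩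
    rw [h, zero_mul] at hA
    exact lt_irrefl _ hA
  set n := ((Finset.Ico n₁ m).filter fun j => A j ≠ 0).max' hne with hn
  obtain ⟨h1, h2⟩ := Finset.mem_filter.mp (Finset.max'_mem _ hne)
  rw [← hn] at h1 h2
  obtain ⟨h3, h4⟩ := Finset.mem_Ico.mp h1
  have h5 : 0 < A n₁ * A n := by
    rcases h3.eq_or_lt with h | h
    · rw [← h] at h2 ⊢
      exact mul_self_pos.mpr h2
    · have h6 := Nat.find_min hex h4
      push Not at h6
      have h7 : A n₁ ≠ 0 := fun h0 => by simp [h0] at hA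
      exact lt_of_le_of_ne (h6 h) (mul_ne_zero h7 h2).symm
  refine ⟨m, Finset.mem_filter.mpr ⟨Finset.mem_Icc.mpr ⟨by omega, by omega⟩,
    n, by omega, h4, ?_, fun j hj1 hj2 => ?_⟩, hm1.le, hm3⟩
  · by_contra hcon
    push Not at hcon
    nlinarith [mul_nonneg h5.le hcon, mul_neg_of_pos_of_neg h5 hm2, sq_nonneg (A n₁),
      mul_pos h5 (neg_pos.mpr hm2), mul_nonneg (sq_nonneg (A n₁)) hcon]
  · by_contra hj0
    have hjm : j ∈ (Finset.Ico n₁ m).filter fun j => A j ≠ 0 :=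
      Finset.mem_filter.mpr ⟨Finset.mem_Ico.mpr ⟨h3.trans hj1.le, hj2⟩, hj0⟩
    have := Finset.le_max' _ j hjm
    rw [← hn] at this
    omega

lemma hasCompactSupport_sum_bump {ι : Type} (I : Finset ι) (c z : ι → ℝ) :
    HasCompactSupport fun w : ℝ => ∑ i ∈ I, c i * bump (w - z i) := by
  set R := 2 + ∑ i ∈ I, |z i| with hR
  refine HasCompactSupport.of_support_subset_isCompact (isCompact_Icc (a := -R) (b := R)) ?_
  intro w hw
  by_contra hcon
  apply hw
  refine Finset.sum_eq_zero fun i hi => ?_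
  have h1 : |z i| ≤ ∑ i ∈ I, |z i| :=
    Finset.single_le_sum (f := fun i => |z i|) (fun _ _ => abs_nonneg _) hi
  have h2 : R < |w| := by
    by_contra h3
    exact hcon (abs_le.mp (not_lt.mp h3))
  have h4 : 2 ≤ |w - z i| := by
    have := abs_sub_abs_le_abs_sub w (z i)
    linarith
  rw [bump_eq_zero h4, mul_zero]

lemma continuous_sum_bump {ι : Type} (I : Finset ι) (c z : ι → ℝ) :
    Continuous fun w : ℝ => ∑ i ∈ I, c i * bump (w - z i) := by
  have := bump.continuous
  fun_prop

lemma Continuous.integrable_sq_of_hasCompactSupport {f : ℝ → ℝ} (h1 : Continuous f)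
    (h2 : HasCompactSupport f) : Integrable fun w => f w ^ 2 := by
  have h3 : HasCompactSupport fun w => f w ^ 2 :=
    h2.comp_left (g := fun x : ℝ => x ^ 2) (zero_pow two_ne_zero)
  have h4 : Continuous fun w => f w ^ 2 := h1.pow 2
  exact h4.integrable_of_hasCompactSupport h3

lemma integrable_sum_bump_sq {ι : Type} (I : Finset ι) (c z : ι → ℝ) :
    Integrable fun w : ℝ => (∑ i ∈ I, c i * bump (w - z i)) ^ 2 :=
  (continuous_sum_bump I c z).integrable_sq_of_hasCompactSupport
    (hasCompactSupport_sum_bump I c z)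

lemma integral_sum_bump {ι : Type} (I : Finset ι) (c z : ι → ℝ) :
    ∫ w : ℝ, ∑ i ∈ I, c i * bump (w - z i) = (∑ i ∈ I, c i) * ∫ w : ℝ, bump w := by
  have hint : Integrable fun w : ℝ => bump w := bump.integrable
  rw [integral_finsetSum _ fun i _ => (hint.comp_sub_right _).const_mul _, Finset.sum_mul]
  refine Finset.sum_congr rfl fun i _ => ?_
  rw [integral_const_mul, integral_sub_right_eq_self (fun w : ℝ => bump w)]

/-- If short sums with coefficients of the sign of `A` are on average much smaller than the
corresponding sums of absolute values, then `A` has many sign changes. -/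
lemma le_signChanges_of_short_sums {ι : Type} {A : ℕ → ℝ} (I : Finset ι) (p : ι → ℝ) (ν : ι → ℕ)
    {X T Δ F : ℝ} (hT : 0 < T) (hΔ : 0 ≤ Δ) (hp : ∀ i ∈ I, 0 ≤ p i)
    (hν : ∀ i ∈ I, 1 ≤ ν i ∧ ν i ≤ ⌊X⌋₊ ∧ Real.log (ν i) ≤ Δ)
    (hF0 : 0 < F)
    (hF : ∫ w : ℝ, (∑ i ∈ I, |A (ν i) * p i| * bump (w - T * Real.log (ν i))) ^ 2 ≤ F)
    (hW : 0 < ∑ i ∈ I, |A (ν i) * p i|)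
    (hE : (∫ w : ℝ, (∑ i ∈ I, A (ν i) * p i * bump (w - T * Real.log (ν i))) ^ 2) * (T * Δ + 4) ≤
      ((∑ i ∈ I, |A (ν i) * p i|) * ∫ w : ℝ, bump w) ^ 2 / 8) :
    ((∑ i ∈ I, |A (ν i) * p i|) * ∫ w : ℝ, bump w) ^ 2 ≤ 16 * F * signChanges A X := by
  classical
  set S : ℝ → ℝ := fun w => ∑ i ∈ I, A (ν i) * p i * bump (w - T * Real.log (ν i)) with hS
  set S' : ℝ → ℝ := fun w => ∑ i ∈ I, |A (ν i) * p i| * bump (w - T * Real.log (ν i)) with hS'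
  set W := ∑ i ∈ I, |A (ν i) * p i|
  set J := ∫ w : ℝ, bump w with hJ
  have hJ0 : 0 < J := bump.integral_pos
  have hWJ : 0 < W * J := by positivity
  set E := ∫ w : ℝ, S w ^ 2
  have hE0 : 0 ≤ E := integral_nonneg fun w => by positivity
  set C := {m ∈ Finset.Icc 1 ⌊X⌋₊ | ∃ n : ℕ, 1 ≤ n ∧ n < m ∧ A n * A m < 0 ∧
      ∀ j : ℕ, n < j → j < m → A j = 0} with hC
  have hcard : signChanges A X = C.card := by
    rw [signChanges, hC]
  have hbn : ∀ u : ℝ, 0 ≤ bump u := fun u => bump.nonneg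
  have hS'0 : ∀ w, 0 ≤ S' w := fun w =>
    Finset.sum_nonneg fun i _ => mul_nonneg (abs_nonneg _) (hbn _)
  -- The parameters l and μ are tuned so that, after integration, the window length, the signed
  -- moment and the absolute moment cost at most WJ/4, WJ/8 and WJ/8. The remaining half of WJ must
  -- be paid for by sign changes, each of which covers a set of measure 4.
  have hlam : 0 < W * J / (2 * (T * Δ + 4)) := by positivity
  set l := W * J / (2 * (T * Δ + 4)) with hl
  have hmu : 0 < 4 * F / (W * J) := by positivity
  set μ := 4 * F / (W * J) with hμ
  set χ : ℕ → ℝ → ℝ := fun m => (Set.Icc (T * Real.log m - 2) (T * Real.log m + 2)).indicator 1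
    with hχ
  set χK : ℝ → ℝ := (Set.Icc (-2 : ℝ) (T * Δ + 2)).indicator 1 with hχK
  have hχ0 : ∀ m w, 0 ≤ χ m w := fun m w => Set.indicator_nonneg (fun _ _ => zero_le_one) _
  have hχK0 : ∀ w, 0 ≤ χK w := fun w => Set.indicator_nonneg (fun _ _ => zero_le_one) _
  have amgm : ∀ a x : ℝ, 0 < a → x ≤ a / 2 + x ^ 2 / (2 * a) := by
    intro a x ha
    have : a / 2 + x ^ 2 / (2 * a) - x = (a - x) ^ 2 / (2 * a) := by field_simp; ring
    have h2 : 0 ≤ (a - x) ^ 2 / (2 * a) := by positivity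
    linarith
  -- At each w one of two things holds: a sign change lies in the window, and the μ-terms dominate
  -- by the arithmetic-geometric inequality; or none does, S' = |S|, and the l-terms dominate.
  have hpt : ∀ w, S' w ≤ l / 2 * χK w + 1 / (2 * l) * S w ^ 2 + μ / 2 * (∑ m ∈ C, χ m w) +
      1 / (2 * μ) * S' w ^ 2 := by
    intro w
    have hsum0 : 0 ≤ ∑ m ∈ C, χ m w := Finset.sum_nonneg fun m _ => hχ0 m w
    have t1 : 0 ≤ l / 2 * χK w := mul_nonneg (by positivity) (hχK0 w)
    have t2 : 0 ≤ 1 / (2 * l) * S w ^ 2 := by positivity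
    have t3 : 0 ≤ μ / 2 * (∑ m ∈ C, χ m w) := by positivity
    have t4 : 0 ≤ 1 / (2 * μ) * S' w ^ 2 := by positivity
    by_cases hw : ∃ m ∈ C, |w - T * Real.log m| < 2
    · obtain ⟨m, hm, hmw⟩ := hw
      have h1 : 1 ≤ ∑ m ∈ C, χ m w := by
        have h2 : χ m w = 1 := by
          rw [abs_lt] at hmw
          simp only [hχ]
          rw [Set.indicator_of_mem (Set.mem_Icc.mpr ⟨by linarith, by linarith⟩)]
          rfl
        rw [← h2]
        exact Finset.single_le_sum (f := fun m => χ m w) (fun m _ => hχ0 m w) hm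
      have h3 := amgm μ (S' w) hmu
      have h4 : μ / 2 * 1 ≤ μ / 2 * (∑ m ∈ C, χ m w) := by gcongr
      have h5 : S' w ^ 2 / (2 * μ) = 1 / (2 * μ) * S' w ^ 2 := by ring
      linarith
    · push Not at hw
      rcases (hS'0 w).eq_or_lt with h0 | h0
      · rw [← h0] at t4 ⊢
        linarith
      obtain ⟨i, hi, hne⟩ := Finset.exists_ne_zero_of_sum_ne_zero h0.ne'
      have hci : A (ν i) * p i ≠ 0 := fun h => hne (by rw [h]; simp)
      have hbi : |w - T * Real.log (ν i)| < 2 :=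
        abs_lt_two_of_bump_ne_zero fun h => hne (by rw [h]; simp)
      have hwK : χK w = 1 := by
        simp only [hχK]
        rw [Set.indicator_of_mem]
        · rfl
        · have h1 : 0 ≤ Real.log (ν i) := Real.log_nonneg (by exact_mod_cast (hν i hi).1)
          have h2 := (hν i hi).2.2
          have h3 : T * Real.log (ν i) ≤ T * Δ := by gcongr
          have h4 : 0 ≤ T * Real.log (ν i) := by positivity
          rw [abs_lt] at hbi
          exact Set.mem_Icc.mpr ⟨by linarith, by linarith⟩
      -- Two active indices of opposite sign would enclose a sign change, which by monotonicity of
      -- log would lie within the same window.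
      have key : ∀ j ∈ I, bump (w - T * Real.log (ν j)) ≠ 0 → 0 ≤ A (ν i) * A (ν j) := by
        intro j hj hbj
        by_contra hneg
        push Not at hneg
        have hbj' := abs_lt_two_of_bump_ne_zero hbj
        have main : ∀ a b : ℕ, 1 ≤ a → a < b → b ≤ ⌊X⌋₊ → A a * A b < 0 →
            |w - T * Real.log a| < 2 → |w - T * Real.log b| < 2 → False := by
          intro a b ha hab hb hneg h1 h2
          obtain ⟨m, hm, hm1, hm2⟩ := exists_signChange_between (X := X) ha hab hb hneg
          have hmC : m ∈ C := by
            rw [hC]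
            convert hm
          have h3 := hw m hmC
          have ha0 : (0 : ℝ) < a := by exact_mod_cast ha
          have hm0 : (0 : ℝ) < m := by
            have : 0 < m := by omega
            exact_mod_cast this
          have h4 : T * Real.log a ≤ T * Real.log m := by
            have := Real.log_le_log ha0 (by exact_mod_cast hm1 : (a : ℝ) ≤ m)
            gcongr
          have h5 : T * Real.log m ≤ T * Real.log b := by
            have := Real.log_le_log hm0 (by exact_mod_cast hm2 : (m : ℝ) ≤ b)
            gcongr
          rw [abs_lt] at h1 h2
          have : |w - T * Real.log m| < 2 := abs_lt.mpr ⟨by linarith, by linarith⟩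
          linarith
        rcases lt_trichotomy (ν i) (ν j) with h | h | h
        · exact main _ _ (hν i hi).1 h (hν j hj).2.1 hneg hbi hbj'
        · rw [h] at hneg
          exact absurd hneg (not_lt.mpr (mul_self_nonneg _))
        · exact main _ _ (hν j hj).1 h (hν i hi).2.1 (by rwa [mul_comm]) hbj' hbi
      have hAi : A (ν i) ≠ 0 := fun h => hci (by rw [h, zero_mul])
      have hSS : S' w = |S w| := by
        rcases lt_or_gt_of_ne hAi with hneg | hpos
        · have h1 : S w = -S' w := by
            rw [hS, hS', ← Finset.sum_neg_distrib]
            refine Finset.sum_congr rfl fun j hj => ?_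
            by_cases hb : bump (w - T * Real.log (ν j)) = 0
            · rw [hb]; simp
            · have h2 : A (ν j) ≤ 0 := by
                by_contra h3
                exact absurd (key j hj hb) (not_le.mpr (mul_neg_of_neg_of_pos hneg (not_le.mp h3)))
              rw [abs_of_nonpos (mul_nonpos_of_nonpos_of_nonneg h2 (hp j hj))]
              ring
          rw [h1, abs_neg, abs_of_nonneg (hS'0 w)]
        · have h1 : S w = S' w := by
            rw [hS, hS']
            refine Finset.sum_congr rfl fun j hj => ?_
            by_cases hb : bump (w - T * Real.log (ν j)) = 0
            · rw [hb]; simp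
            · have h2 : 0 ≤ A (ν j) := by
                by_contra h3
                exact absurd (key j hj hb) (not_le.mpr (mul_neg_of_pos_of_neg hpos (not_le.mp h3)))
              rw [abs_of_nonneg (mul_nonneg h2 (hp j hj))]
          rw [h1, abs_of_nonneg (hS'0 w)]
      have h3 := amgm l (S' w) hlam
      have h4 : S' w ^ 2 = S w ^ 2 := by rw [hSS, sq_abs]
      rw [h4] at h3
      rw [hwK]
      have h5 : S w ^ 2 / (2 * l) = 1 / (2 * l) * S w ^ 2 := by ring
      linarith
  have iS : Integrable fun w => S w ^ 2 := integrable_sum_bump_sq _ _ _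
  have iS' : Integrable fun w => S' w ^ 2 := integrable_sum_bump_sq _ _ _
  have iχ : ∀ m, Integrable (χ m) := fun m =>
    (integrable_indicator_iff measurableSet_Icc).mpr (integrableOn_const (by simp))
  have iχK : Integrable χK :=
    (integrable_indicator_iff measurableSet_Icc).mpr (integrableOn_const (by simp))
  have iS1 : Integrable S' := (continuous_sum_bump _ _ _).integrable_of_hasCompactSupport
    (hasCompactSupport_sum_bump _ _ _)
  have vχ : ∀ m, ∫ w, χ m w = 4 := by
    intro m
    simp only [hχ]
    rw [integral_indicator_one measurableSet_Icc, Real.volume_real_Icc_of_le (by linarith)]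
    ring
  have vχK : ∫ w, χK w = T * Δ + 4 := by
    simp only [hχK]
    have : 0 ≤ T * Δ := by positivity
    rw [integral_indicator_one measurableSet_Icc, Real.volume_real_Icc_of_le (by linarith)]
    ring
  have j1 : Integrable fun w => l / 2 * χK w := iχK.const_mul _
  have j2 : Integrable fun w => 1 / (2 * l) * S w ^ 2 := iS.const_mul _
  have j3 : Integrable fun w => μ / 2 * (∑ m ∈ C, χ m w) :=
    (integrable_finsetSum C fun m _ => iχ m).const_mul _
  have j4 : Integrable fun w => 1 / (2 * μ) * S' w ^ 2 := iS'.const_mul _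
  have j12 : Integrable fun w => l / 2 * χK w + 1 / (2 * l) * S w ^ 2 := j1.add j2
  have j123 : Integrable fun w => l / 2 * χK w + 1 / (2 * l) * S w ^ 2 +
    μ / 2 * (∑ m ∈ C, χ m w) := j12.add j3
  have j1234 : Integrable fun w => l / 2 * χK w + 1 / (2 * l) * S w ^ 2 +
    μ / 2 * (∑ m ∈ C, χ m w) + 1 / (2 * μ) * S' w ^ 2 := j123.add j4
  have hint := integral_mono iS1 j1234 hpt
  have hcalc : ∫ w, (l / 2 * χK w + 1 / (2 * l) * S w ^ 2 + μ / 2 * (∑ m ∈ C, χ m w) +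
      1 / (2 * μ) * S' w ^ 2) =
      l / 2 * (T * Δ + 4) + 1 / (2 * l) * E + μ / 2 * (4 * C.card) +
      1 / (2 * μ) * ∫ w, S' w ^ 2 := by
    rw [integral_add j123 j4, integral_add j12 j3, integral_add j1 j2,
      integral_const_mul, integral_const_mul, integral_const_mul, integral_const_mul,
      integral_finsetSum _ fun m _ => iχ m, vχK]
    simp_rw [vχ]
    rw [Finset.sum_const, nsmul_eq_mul]
    ring
  have hS'int : ∫ w, S' w = W * J := integral_sum_bump _ _ _
  rw [hcalc, hS'int] at hint
  have hK : 0 < T * Δ + 4 := by positivity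
  have e1 : l / 2 * (T * Δ + 4) = W * J / 4 := by
    rw [hl]; field_simp; ring
  have e2 : 1 / (2 * l) * E ≤ W * J / 8 := by
    have : 1 / (2 * l) * E = E * (T * Δ + 4) / (W * J) := by rw [hl]; field_simp
    rw [this, div_le_iff₀ hWJ]
    calc _ ≤ (W * J) ^ 2 / 8 := hE
      _ = _ := by ring
  have e3 : 1 / (2 * μ) * ∫ w, S' w ^ 2 ≤ W * J / 8 := by
    calc 1 / (2 * μ) * ∫ w, S' w ^ 2 ≤ 1 / (2 * μ) * F := by gcongr
      _ = W * J / 8 := by rw [hμ]; field_simp; ring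
  have e4 : μ / 2 * (4 * C.card) = 8 * F * C.card / (W * J) := by
    rw [hμ]; field_simp; ring
  rw [e1, e4] at hint
  have h9 : W * J / 2 ≤ 8 * F * C.card / (W * J) := by linarith
  rw [le_div_iff₀ hWJ] at h9
  rw [hcard]
  nlinarith

lemma norm_sq_sum_ofReal_bump {ι : Type} (I : Finset ι) (c z : ι → ℝ) (w : ℝ) :
    ‖∑ i ∈ I, (c i : ℂ) * (bump (w - z i) : ℝ)‖ ^ 2 = (∑ i ∈ I, c i * bump (w - z i)) ^ 2 := by
  have : ∑ i ∈ I, (c i : ℂ) * (bump (w - z i) : ℝ) = ((∑ i ∈ I, c i * bump (w - z i) : ℝ) : ℂ) := by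
    push_cast; rfl
  rw [this, Complex.norm_real, Real.norm_eq_abs, sq_abs]

/-- The mean square of smooth short sums in terms of a truncated mean square of the Dirichlet
polynomial. -/
lemma exists_integral_short_sum_le (j : ℕ) : ∃ C : ℝ, 0 < C ∧ ∀ {ι : Type} (I : Finset ι)
    (b : ι → ℂ) (ν : ι → ℕ) {T Z : ℝ}, 0 < T → 0 < Z →
    ∫ w : ℝ, ‖∑ i ∈ I, b i * (bump (w - T * Real.log (ν i)) : ℝ)‖ ^ 2 ≤
      C * (T⁻¹ * (∫ ξ in (-(T * Z))..(T * Z), ‖dirichletPoly I b ν ξ‖ ^ 2) +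
        (∑ i ∈ I, ‖b i‖) ^ 2 / Z ^ j) := by
  obtain ⟨C₀, hC₀⟩ : ∃ C, ∀ ξ : ℝ, (1 + ‖ξ‖) ^ (j + 2) * ‖bumpHat ξ‖ ≤ C := by
    refine ⟨2 ^ (j + 2) * ((Finset.Iic (j + 2, 0)).sup
      fun m => SchwartzMap.seminorm ℝ m.1 m.2) bumpHat, fun ξ => ?_⟩
    have := SchwartzMap.one_add_le_sup_seminorm_apply (𝕜 := ℝ) (m := (j + 2, 0))
      (le_refl (j + 2)) (le_refl 0) bumpHat ξ
    simpa using this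
  have hC₀0 : 0 ≤ C₀ := le_trans (by positivity) (hC₀ 0)
  have hb : ∀ ξ, ‖bumpHat ξ‖ ≤ C₀ := fun ξ => by
    refine le_trans (le_mul_of_one_le_left (norm_nonneg _) (one_le_pow₀ ?_)) (hC₀ ξ)
    linarith [norm_nonneg ξ]
  set Q := ∫ ξ : ℝ, (1 + ‖ξ‖) ^ (-(2 : ℝ)) with hQ
  have hQ0 : 0 ≤ Q := integral_nonneg fun ξ => by positivity
  have hQi : Integrable fun ξ : ℝ => (1 + ‖ξ‖) ^ (-(2 : ℝ)) := integrable_one_add_norm (by simp)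
  refine ⟨(C₀ ^ 2 + 1) * (Q + 1), by positivity, ?_⟩
  intro ι I b ν T Z hT hZ
  rw [integral_short_sum_eq]
  set D := dirichletPoly I b ν
  have hD : Continuous D := continuous_dirichletPoly I b ν
  set W := ∑ i ∈ I, ‖b i‖
  have hW0 : 0 ≤ W := Finset.sum_nonneg fun _ _ => norm_nonneg _
  have hDW : ∀ ξ, ‖D ξ‖ ≤ W := norm_dirichletPoly_le I b ν
  have hcont : Continuous fun ξ => C₀ ^ 2 * ‖D (T * ξ)‖ ^ 2 := by fun_prop
  have i1 : Integrable ((Set.Ioc (-Z) Z).indicator fun ξ => C₀ ^ 2 * ‖D (T * ξ)‖ ^ 2) :=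
    (integrable_indicator_iff measurableSet_Ioc).mpr hcont.integrableOn_Ioc
  have i2 : Integrable fun ξ : ℝ => C₀ ^ 2 * W ^ 2 / Z ^ j * (1 + ‖ξ‖) ^ (-(2 : ℝ)) :=
    hQi.const_mul _
  have hpt : ∀ ξ, ‖bumpHat ξ‖ ^ 2 * ‖D (T * ξ)‖ ^ 2 ≤
      (Set.Ioc (-Z) Z).indicator (fun ξ => C₀ ^ 2 * ‖D (T * ξ)‖ ^ 2) ξ +
        C₀ ^ 2 * W ^ 2 / Z ^ j * (1 + ‖ξ‖) ^ (-(2 : ℝ)) := by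
    intro ξ
    by_cases hξ : ξ ∈ Set.Ioc (-Z) Z
    · rw [Set.indicator_of_mem hξ]
      have h1 : 0 ≤ C₀ ^ 2 * W ^ 2 / Z ^ j * (1 + ‖ξ‖) ^ (-(2 : ℝ)) := by positivity
      have h2 : ‖bumpHat ξ‖ ^ 2 * ‖D (T * ξ)‖ ^ 2 ≤ C₀ ^ 2 * ‖D (T * ξ)‖ ^ 2 := by
        gcongr
        exact hb ξ
      linarith
    · rw [Set.indicator_of_notMem hξ, zero_add]
      -- Outside the truncated range the rapid decay of the transform gains Z^(-j) and leaves an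
      -- integrable factor, while the polynomial is bounded trivially.
      have hZξ : Z ≤ 1 + ‖ξ‖ := by
        by_contra h
        push Not at h
        apply hξ
        rw [Real.norm_eq_abs] at h
        have := abs_lt.mp (show |ξ| < Z by linarith)
        exact ⟨this.1, this.2.le⟩
      have hpos : 0 < 1 + ‖ξ‖ := by positivity
      have h1 : ‖bumpHat ξ‖ ^ 2 ≤ C₀ ^ 2 / Z ^ j * (1 + ‖ξ‖) ^ (-(2 : ℝ)) := by
        have h2 : Z ^ j * (1 + ‖ξ‖) ^ 2 * ‖bumpHat ξ‖ ≤ C₀ := by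
          refine le_trans ?_ (hC₀ ξ)
          rw [pow_add]
          gcongr
        have h3 : Z ^ j * (1 + ‖ξ‖) ^ 2 * ‖bumpHat ξ‖ ^ 2 ≤ C₀ ^ 2 := by
          calc _ = (Z ^ j * (1 + ‖ξ‖) ^ 2 * ‖bumpHat ξ‖) * ‖bumpHat ξ‖ := by ring
            _ ≤ C₀ * C₀ := by
                gcongr
                exact hb ξ
            _ = _ := by ring
        rw [Real.rpow_neg hpos.le, Real.rpow_two, ← div_eq_mul_inv, div_div, le_div_iff₀ (by positivity)]
        linarith
      calc _ ≤ C₀ ^ 2 / Z ^ j * (1 + ‖ξ‖) ^ (-(2 : ℝ)) * W ^ 2 := by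
            gcongr
            exact hDW _
        _ = _ := by ring
  calc _ ≤ ∫ ξ, ((Set.Ioc (-Z) Z).indicator (fun ξ => C₀ ^ 2 * ‖D (T * ξ)‖ ^ 2) ξ +
        C₀ ^ 2 * W ^ 2 / Z ^ j * (1 + ‖ξ‖) ^ (-(2 : ℝ))) :=
        integral_mono (integrable_bumpHat_sq_mul_dirichletPoly I b ν T) (i1.add i2) hpt
    _ = C₀ ^ 2 * (T⁻¹ * ∫ ξ in (-(T * Z))..(T * Z), ‖D ξ‖ ^ 2) + C₀ ^ 2 * W ^ 2 / Z ^ j * Q := by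
        rw [integral_add i1 i2, integral_const_mul, integral_indicator measurableSet_Ioc,
          ← intervalIntegral.integral_of_le (by linarith), intervalIntegral.integral_const_mul,
          intervalIntegral.integral_comp_mul_left (fun ξ => ‖D ξ‖ ^ 2) hT.ne', smul_eq_mul, mul_neg]
    _ ≤ _ := by
        have h1 : 0 ≤ T⁻¹ * ∫ ξ in (-(T * Z))..(T * Z), ‖D ξ‖ ^ 2 := by
          refine mul_nonneg (by positivity) (intervalIntegral.integral_nonneg ?_ fun _ _ => by positivity)
          have : 0 < T * Z := by positivity
          linarith
        have h2 : 0 ≤ W ^ 2 / Z ^ j := by positivity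
        have h3 : C₀ ^ 2 ≤ (C₀ ^ 2 + 1) * (Q + 1) := by nlinarith [sq_nonneg C₀]
        have h4 : C₀ ^ 2 * Q ≤ (C₀ ^ 2 + 1) * (Q + 1) := by nlinarith [sq_nonneg C₀]
        calc _ = C₀ ^ 2 * (T⁻¹ * ∫ ξ in (-(T * Z))..(T * Z), ‖D ξ‖ ^ 2) +
              C₀ ^ 2 * Q * (W ^ 2 / Z ^ j) := by ring
          _ ≤ (C₀ ^ 2 + 1) * (Q + 1) * (T⁻¹ * ∫ ξ in (-(T * Z))..(T * Z), ‖D ξ‖ ^ 2) +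
              (C₀ ^ 2 + 1) * (Q + 1) * (W ^ 2 / Z ^ j) := by gcongr
          _ = _ := by ring

/-! ### The coprime weights: pointwise bound and total mass. -/

/-- A smooth cut-off to `m ≤ e^J`. -/
noncomputable def cutoff (J m : ℕ) : ℝ := ∑ j ∈ Finset.range (J + 1), bump (Real.log m - j)

lemma cutoff_nonneg (J m : ℕ) : 0 ≤ cutoff J m := Finset.sum_nonneg fun _ _ => bump.nonneg

lemma cutoff_le (J m : ℕ) : cutoff J m ≤ J + 1 := by
  calc cutoff J m ≤ ∑ _j ∈ Finset.range (J + 1), (1 : ℝ) := Finset.sum_le_sum fun _ _ => bump.le_one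
    _ = _ := by simp

lemma one_le_cutoff {J m : ℕ} (hm : 1 ≤ m) (hmJ : (m : ℝ) ≤ Real.exp J) : 1 ≤ cutoff J m := by
  have hm0 : (0 : ℝ) < m := by exact_mod_cast hm
  have h0 : 0 ≤ Real.log m := Real.log_nonneg (by exact_mod_cast hm)
  have hl : Real.log m ≤ J := (Real.log_le_iff_le_exp hm0).mpr hmJ
  have h1 := Nat.floor_le h0
  have h2 := Nat.lt_floor_add_one (Real.log m)
  have h3 : bump (Real.log m - (⌊Real.log m⌋₊ : ℕ)) = 1 :=
    bump_eq_one (abs_le.mpr ⟨by linarith, by linarith⟩)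
  rw [← h3]
  refine Finset.single_le_sum (f := fun j : ℕ => bump (Real.log m - j))
    (fun _ _ => bump.nonneg) ?_
  rw [Finset.mem_range]
  have : ⌊Real.log m⌋₊ ≤ J := Nat.floor_le_of_le hl
  omega

/-- `A(n) n^{-σ}`, restricted to `n` free of prime factors in `S`. -/
noncomputable def sievedCoeff (A : ℕ → ℝ) (S : Finset ℕ) (σ : ℝ) (n : ℕ) : ℝ :=
  if ∀ q ∈ S, ¬ q ∣ n then A n * (n : ℝ) ^ (-σ) else 0

/-- `A(m) m^{-σ}`, smoothly cut off at `e^J`. -/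
noncomputable def smoothCoeff (A : ℕ → ℝ) (J : ℕ) (σ : ℝ) (m : ℕ) : ℝ :=
  A m * (m : ℝ) ^ (-σ) * cutoff J m

lemma natCast_cpow_neg_line {m : ℕ} (hm : m ≠ 0) (σ ξ : ℝ) :
    (m : ℂ) ^ (-((σ : ℂ) + 2 * Real.pi * ξ * Complex.I)) =
      (((m : ℝ) ^ (-σ) : ℝ) : ℂ) * Complex.exp (-(2 * Real.pi * ξ * Real.log m * Complex.I)) := by
  have hm' : (m : ℂ) ≠ 0 := Nat.cast_ne_zero.mpr hm
  rw [neg_add, Complex.cpow_add _ _ hm', Complex.ofReal_cpow (by positivity),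
    Complex.cpow_def_of_ne_zero hm' (-(2 * Real.pi * ξ * Complex.I)), ← Complex.natCast_log]
  push_cast
  congr 2
  ring

lemma coprime_iff_forall_primeFactors {n m : ℕ} (hn : n ≠ 0) :
    n.Coprime m ↔ ∀ q ∈ n.primeFactors, ¬ q ∣ m := by
  constructor
  · intro h q hq hd
    have hqp := Nat.prime_of_mem_primeFactors hq
    exact Nat.not_coprime_of_dvd_of_dvd hqp.one_lt (Nat.dvd_of_mem_primeFactors hq) hd h
  · intro h
    refine Nat.coprime_of_dvd fun k hk hkn hkm => ?_
    exact h k (Nat.mem_primeFactors.mpr ⟨hk, hkn, hn⟩) hkm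

/-- For fixed n, coprimality says that m avoids the primes of n. As the cut-off is a sum of bumps at
integer points, the inner sum is a sum of J + 1 sieved smoothed sums. -/
lemma coprimePoly_eq_sum_smoothSum (A : ℕ → ℝ) (S : Finset ℕ) (N₁ N₂ J : ℕ) (σ ξ : ℝ) :
    coprimePoly N₁ N₂ (fun n => (sievedCoeff A S σ n : ℂ)) (fun m => (smoothCoeff A J σ m : ℂ)) ξ =
      ∑ n ∈ Finset.Icc 1 N₁, (sievedCoeff A S σ n : ℂ) *
        Complex.exp (-(2 * Real.pi * ξ * Real.log n * Complex.I)) *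
        ∑ j ∈ Finset.range (J + 1),
          smoothSum A n.primeFactors N₂ j ((σ : ℂ) + 2 * Real.pi * ξ * Complex.I) := by
  rw [coprimePoly, dirichletPoly, coprimePairs, Finset.sum_filter, Finset.sum_product]
  refine Finset.sum_congr rfl fun n hn => ?_
  have hn0 : n ≠ 0 := by have := Finset.mem_Icc.mp hn; omega
  have h1 : ∑ j ∈ Finset.range (J + 1),
      smoothSum A n.primeFactors N₂ j ((σ : ℂ) + 2 * Real.pi * ξ * Complex.I) =
      ∑ m ∈ Finset.Icc 1 N₂, if n.Coprime m then (smoothCoeff A J σ m : ℂ) *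
        Complex.exp (-(2 * Real.pi * ξ * Real.log m * Complex.I)) else 0 := by
    simp only [smoothSum]
    rw [Finset.sum_comm, Finset.sum_filter]
    refine Finset.sum_congr rfl fun m hm => ?_
    have hm0 : m ≠ 0 := by have := Finset.mem_Icc.mp hm; omega
    simp only [← coprime_iff_forall_primeFactors hn0]
    split_ifs with hc
    · simp_rw [natCast_cpow_neg_line hm0]
      rw [smoothCoeff, cutoff, ← Finset.sum_mul, ← Finset.mul_sum]
      push_cast
      ring
    · rfl
  rw [h1, Finset.mul_sum]
  refine Finset.sum_congr rfl fun m hm => ?_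
  have hm0 : m ≠ 0 := by have := Finset.mem_Icc.mp hm; omega
  simp only
  split_ifs with hc
  · have h2 : Complex.exp (-(2 * Real.pi * ξ * Real.log ((n * m : ℕ) : ℝ) * Complex.I)) =
        Complex.exp (-(2 * Real.pi * ξ * Real.log n * Complex.I)) *
        Complex.exp (-(2 * Real.pi * ξ * Real.log m * Complex.I)) := by
      rw [← Complex.exp_add]
      have : Real.log ((n * m : ℕ) : ℝ) = Real.log n + Real.log m := by
        push_cast
        exact Real.log_mul (by exact_mod_cast hn0) (by exact_mod_cast hm0)
      rw [this]
      congr 1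
      push_cast
      ring
    rw [h2]
    ring
  · rw [mul_zero]

/-- All primes of a contributing n are at least p₀, so removing them from the inner sum costs 2^ω(n)
≤ d(n). -/
lemma norm_coprimePoly_le {A : ℕ → ℝ} (hA : CoprimeMul A) {p₀ N₁ N₂ J : ℕ} {σ ξ B : ℝ} (hB : 0 ≤ B)
    (hgood : ∀ p : ℕ, p.Prime → p₀ ≤ p → ∀ K,
      ∑ k ∈ Finset.Ico 1 K, |A (p ^ k)| * ((p ^ k : ℕ) : ℝ) ^ (-σ) ≤ 1 / 2)
    (hJ : Real.exp (J + 2) ≤ N₂)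
    (hbound : ∀ x : ℝ, Real.exp (x + 2) ≤ N₂ →
      ‖smoothSum A ∅ N₂ x ((σ : ℂ) + 2 * Real.pi * ξ * Complex.I)‖ ≤ B) :
    ‖coprimePoly N₁ N₂ (fun n => (sievedCoeff A p₀.primesBelow σ n : ℂ))
      (fun m => (smoothCoeff A J σ m : ℂ)) ξ‖ ≤
      (∑ n ∈ Finset.Icc 1 N₁, (n.divisors.card : ℝ) * |sievedCoeff A p₀.primesBelow σ n|) *
        ((J + 1) * B) := by
  rw [coprimePoly_eq_sum_smoothSum, Finset.sum_mul]
  refine norm_sum_le_of_le _ fun n hn => ?_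
  have hn0 : n ≠ 0 := by have := Finset.mem_Icc.mp hn; omega
  rw [norm_mul, norm_mul, norm_exp_neg_two_pi, mul_one, Complex.norm_real, Real.norm_eq_abs]
  by_cases hns : ∀ q ∈ p₀.primesBelow, ¬ q ∣ n
  · have h1 : ∀ p ∈ n.primeFactors, p₀ ≤ p := by
      intro p hp
      by_contra hlt
      exact hns p (Nat.mem_primesBelow.mpr ⟨not_le.mp hlt, Nat.prime_of_mem_primeFactors hp⟩)
        (Nat.dvd_of_mem_primeFactors hp)
    have hre : ((σ : ℂ) + 2 * Real.pi * ξ * Complex.I).re = σ := by simp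
    have h2 := norm_smoothSum_le_two_pow hA hB hbound n.primeFactors
      (fun q hq => Nat.prime_of_mem_primeFactors hq) (fun p hp K => by
        rw [hre]; exact hgood p (Nat.prime_of_mem_primeFactors hp) (h1 p hp) K)
    have h3 : ‖∑ j ∈ Finset.range (J + 1),
          smoothSum A n.primeFactors N₂ j ((σ : ℂ) + 2 * Real.pi * ξ * Complex.I)‖ ≤
        (J + 1) * (n.divisors.card * B) := by
      calc _ ≤ ∑ _j ∈ Finset.range (J + 1), (n.divisors.card : ℝ) * B := by
            refine norm_sum_le_of_le _ fun j hj => ?_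
            have hjJ : (j : ℝ) ≤ J := by
              have := Finset.mem_range.mp hj
              exact_mod_cast (by omega : j ≤ J)
            refine (h2 j (le_trans (Real.exp_le_exp.mpr (by linarith)) hJ)).trans ?_
            gcongr
            exact_mod_cast two_pow_card_primeFactors_le hn0
        _ = _ := by
            rw [Finset.sum_const, Finset.card_range, nsmul_eq_mul]
            push_cast
            ring
    calc _ ≤ |sievedCoeff A p₀.primesBelow σ n| * ((J + 1) * (n.divisors.card * B)) := by gcongr
      _ = _ := by ring
  · have : sievedCoeff A p₀.primesBelow σ n = 0 := if_neg hns
    rw [this]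
    simp

/-- A lower bound for the total mass of the coprime products. -/
lemma absSum_mul_absSum_le {A : ℕ → ℝ} (hA : CoprimeMul A) {p₀ N₁ N₂ J : ℕ} {σ Z D : ℝ}
    (hZ1 : 1 ≤ Z) (hZ : ∀ p : ℕ, p.Prime →
      ∀ K, ∑ k ∈ Finset.range K, |A (p ^ k)| * ((p ^ k : ℕ) : ℝ) ^ (-σ) ≤ Z)
    (hgood : ∀ p : ℕ, p.Prime → p₀ ≤ p → ∀ K,
      ∑ k ∈ Finset.Ico 1 K, |A (p ^ k)| * ((p ^ k : ℕ) : ℝ) ^ (-σ) ≤ 1 / 2)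
    (hD : ∀ n ∈ Finset.Icc 1 N₁, (n.divisors.card : ℝ) ≤ D)
    (hJ : Real.exp J ≤ N₂) :
    absSum A ∅ N₁ σ * absSum A ∅ ⌊Real.exp J⌋₊ σ ≤ Z ^ p₀.primesBelow.card * D *
      ∑ x ∈ coprimePairs N₁ N₂, |sievedCoeff A p₀.primesBelow σ x.1 * smoothCoeff A J σ x.2| := by
  set S := p₀.primesBelow with hS
  have h1 := absSum_le_pow_mul (M := N₁) hA (by linarith : 0 ≤ Z) S
    (fun q hq => Nat.prime_of_mem_primesBelow hq)
    (fun p hp => hZ p (Nat.prime_of_mem_primesBelow hp))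
  have hE0 := absSum_nonneg A ∅ ⌊Real.exp J⌋₊ σ
  -- Freeing n of the primes below p₀ cost Z for each of them. Freeing m of a prime of n costs only
  -- 1 + 1/2 ≤ 2, hence d(n) in total.
  have h2 : absSum A S N₁ σ * absSum A ∅ ⌊Real.exp J⌋₊ σ ≤ D *
      ∑ x ∈ coprimePairs N₁ N₂, |sievedCoeff A S σ x.1 * smoothCoeff A J σ x.2| := by
    rw [coprimePairs, Finset.sum_filter, Finset.sum_product, Finset.mul_sum, absSum,
      Finset.sum_mul, Finset.sum_filter]
    refine Finset.sum_le_sum fun n hn => ?_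
    have hn0 : n ≠ 0 := by have := Finset.mem_Icc.mp hn; omega
    have hD0 : 0 ≤ D := le_trans (by positivity) (hD n hn)
    split_ifs with hns
    · have hp : ∀ p ∈ n.primeFactors, p₀ ≤ p := by
        intro p hp
        by_contra hlt
        exact hns p (Nat.mem_primesBelow.mpr ⟨not_le.mp hlt, Nat.prime_of_mem_primeFactors hp⟩)
          (Nat.dvd_of_mem_primeFactors hp)
      have h3 : absSum A ∅ ⌊Real.exp J⌋₊ σ ≤
          2 ^ n.primeFactors.card * absSum A n.primeFactors ⌊Real.exp J⌋₊ σ := by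
        refine absSum_le_pow_mul hA zero_le_two _
          (fun q hq => Nat.prime_of_mem_primeFactors hq) fun p hp' K => ?_
        have hpp := Nat.prime_of_mem_primeFactors hp'
        rcases Nat.eq_zero_or_pos K with rfl | hK
        · simp
        rw [← Finset.sum_range_add_sum_Ico _ (show 1 ≤ K from hK), Finset.sum_range_one]
        have := hgood p hpp (hp p hp') K
        simp only [pow_zero, hA.1, Nat.cast_one, Real.one_rpow, abs_one, mul_one]
        linarith
      have h4 : (2 : ℝ) ^ n.primeFactors.card ≤ D :=
        le_trans (by exact_mod_cast two_pow_card_primeFactors_le hn0) (hD n hn)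
      have h5 : |A n| * (n : ℝ) ^ (-σ) * absSum A n.primeFactors ⌊Real.exp J⌋₊ σ ≤
          ∑ m ∈ Finset.Icc 1 N₂, if n.Coprime m then
            |sievedCoeff A S σ n * smoothCoeff A J σ m| else 0 := by
        rw [← Finset.sum_filter, absSum, Finset.mul_sum]
        calc _ ≤ ∑ m ∈ Finset.Icc 1 ⌊Real.exp J⌋₊ with ∀ q ∈ n.primeFactors, ¬ q ∣ m,
              |sievedCoeff A S σ n * smoothCoeff A J σ m| := by
              refine Finset.sum_le_sum fun m hm => ?_
              have hm' := Finset.mem_Icc.mp (Finset.mem_filter.mp hm).1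
              have h6 : 1 ≤ cutoff J m := one_le_cutoff hm'.1
                ((Nat.le_floor_iff (Real.exp_pos _).le).mp hm'.2)
              rw [sievedCoeff, if_pos hns, smoothCoeff, abs_mul, abs_mul, abs_mul (A m * _), abs_mul,
                abs_of_nonneg (by positivity : (0 : ℝ) ≤ (n : ℝ) ^ (-σ)),
                abs_of_nonneg (by positivity : (0 : ℝ) ≤ (m : ℝ) ^ (-σ)),
                abs_of_nonneg (cutoff_nonneg J m)]
              exact mul_le_mul_of_nonneg_left (le_mul_of_one_le_right (by positivity) h6)
                (by positivity)
          _ ≤ _ := by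
              refine Finset.sum_le_sum_of_subset_of_nonneg ?_ fun _ _ _ => abs_nonneg _
              intro m hm
              obtain ⟨hm1, hm2⟩ := Finset.mem_filter.mp hm
              have hm' := Finset.mem_Icc.mp hm1
              have h7 : (m : ℝ) ≤ N₂ :=
                ((Nat.le_floor_iff (Real.exp_pos _).le).mp hm'.2).trans hJ
              exact Finset.mem_filter.mpr ⟨Finset.mem_Icc.mpr ⟨hm'.1, by exact_mod_cast h7⟩,
                (coprime_iff_forall_primeFactors hn0).mpr hm2⟩
      have h8 := absSum_nonneg A n.primeFactors ⌊Real.exp J⌋₊ σ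
      calc |A n| * (n : ℝ) ^ (-σ) * absSum A ∅ ⌊Real.exp J⌋₊ σ
          ≤ |A n| * (n : ℝ) ^ (-σ) * (D * absSum A n.primeFactors ⌊Real.exp J⌋₊ σ) := by
            gcongr
            exact h3.trans (by gcongr)
        _ = D * (|A n| * (n : ℝ) ^ (-σ) * absSum A n.primeFactors ⌊Real.exp J⌋₊ σ) := by ring
        _ ≤ _ := by gcongr
    · refine mul_nonneg hD0 (Finset.sum_nonneg fun m _ => ?_)
      split_ifs
      · exact abs_nonneg _
      · exact le_rfl
  calc _ ≤ Z ^ S.card * absSum A S N₁ σ * absSum A ∅ ⌊Real.exp J⌋₊ σ := by gcongr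
    _ = Z ^ S.card * (absSum A S N₁ σ * absSum A ∅ ⌊Real.exp J⌋₊ σ) := by ring
    _ ≤ Z ^ S.card * (D *
      ∑ x ∈ coprimePairs N₁ N₂, |sievedCoeff A S σ x.1 * smoothCoeff A J σ x.2|) := by gcongr
    _ = _ := by ring

/-- Only the dyadic block (y/2, y] is kept, on which m^(-σ) ≥ y^(-σ). -/
lemma NonvanishingExponent.exists_le_absSum {A : ℕ → ℝ} {κ : ℝ} (h : NonvanishingExponent A κ)
    {σ ε : ℝ} (hσ : 0 ≤ σ) (hε : 0 < ε) : ∃ c : ℝ, 0 < c ∧ ∃ y₀ : ℝ, ∀ y : ℝ, y₀ ≤ y →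
      c * y ^ (κ - σ - ε) ≤ absSum A ∅ ⌊y⌋₊ σ := by
  obtain ⟨c, hc, X₀, hX₀⟩ := h ε hε
  refine ⟨c * (1 / 2) ^ (κ - ε), by positivity, max 2 (2 * X₀), fun y hy => ?_⟩
  have hy2 : 2 ≤ y := (le_max_left _ _).trans hy
  have hyX : 2 * X₀ ≤ y := (le_max_right _ _).trans hy
  have h1 := hX₀ (y / 2) (by linarith) (by linarith)
  rw [mul_div_cancel₀ y two_ne_zero] at h1
  have hy0 : 0 < y := by linarith
  calc c * (1 / 2) ^ (κ - ε) * y ^ (κ - σ - ε) = y ^ (-σ) * (c * (y / 2) ^ (κ - ε)) := by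
        rw [show κ - σ - ε = -σ + (κ - ε) by ring, Real.rpow_add hy0,
          show y / 2 = 1 / 2 * y by ring, Real.mul_rpow (by norm_num) hy0.le]
        ring
    _ ≤ y ^ (-σ) * ∑ m ∈ Finset.Ioc ⌊y / 2⌋₊ ⌊y⌋₊, |A m| := by gcongr
    _ ≤ ∑ m ∈ Finset.Ioc ⌊y / 2⌋₊ ⌊y⌋₊, |A m| * (m : ℝ) ^ (-σ) := by
        rw [Finset.mul_sum]
        refine Finset.sum_le_sum fun m hm => ?_
        have hm' := Finset.mem_Ioc.mp hm
        have hm0 : (0 : ℝ) < m := by exact_mod_cast (by omega : 0 < m)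
        have hmy : (m : ℝ) ≤ y := (Nat.le_floor_iff hy0.le).mp hm'.2
        rw [mul_comm]
        exact mul_le_mul_of_nonneg_left (Real.rpow_le_rpow_of_nonpos hm0 hmy (neg_nonpos.mpr hσ))
          (abs_nonneg _)
    _ ≤ absSum A ∅ ⌊y⌋₊ σ := by
        refine Finset.sum_le_sum_of_subset_of_nonneg ?_ fun _ _ _ => by positivity
        intro m hm
        have hm' := Finset.mem_Ioc.mp hm
        simp only [Finset.notMem_empty, IsEmpty.forall_iff, implies_true, Finset.filter_true]
        exact Finset.mem_Icc.mpr ⟨by omega, hm'.2⟩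

/-- Weighted second moments of `A(n) n^{-σ}` are bounded. -/
lemma RankinSelbergBound.exists_sum_divisors_sq_le {A : ℕ → ℝ} (hRS : RankinSelbergBound A) {η : ℝ}
    (hη : 0 < η) : ∃ K : ℝ, 0 < K ∧ ∀ N : ℕ, ∑ n ∈ Finset.Icc 1 N,
      (n.divisors.card : ℝ) ^ 2 * (|A n| * (n : ℝ) ^ (-(1 / 2 + η))) ^ 2 ≤ K := by
  obtain ⟨C, hC1, hC⟩ := card_divisors_le_rpow (ε := η / 2) (by positivity)
  have hs := hRS.summable_sq hη
  set Q := ∑' m : ℕ, |A m| ^ 2 * (m : ℝ) ^ (-(1 + η)) with hQ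
  have hQ0 : 0 ≤ Q := tsum_nonneg fun m => by positivity
  refine ⟨C ^ 2 * (Q + 1), by positivity, fun N => ?_⟩
  calc _ ≤ ∑ n ∈ Finset.Icc 1 N, C ^ 2 * (|A n| ^ 2 * (n : ℝ) ^ (-(1 + η))) := by
        refine Finset.sum_le_sum fun n hn => ?_
        have hn0 : n ≠ 0 := by have := Finset.mem_Icc.mp hn; omega
        have hnp : (0 : ℝ) < n := by exact_mod_cast Nat.pos_of_ne_zero hn0
        calc _ ≤ (C * (n : ℝ) ^ (η / 2)) ^ 2 * (|A n| * (n : ℝ) ^ (-(1 / 2 + η))) ^ 2 := by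
              gcongr
              exact hC n hn0
          _ = C ^ 2 * (|A n| ^ 2 * ((n : ℝ) ^ (η / 2) * (n : ℝ) ^ (-(1 / 2 + η))) ^ 2) := by ring
          _ = _ := by
              rw [← Real.rpow_add hnp, ← Real.rpow_natCast ((n : ℝ) ^ _), ← Real.rpow_mul hnp.le]
              congr 3
              push_cast
              ring
    _ ≤ C ^ 2 * Q := by
        rw [← Finset.mul_sum]
        gcongr
        exact hs.sum_le_tsum _ fun m _ => by positivity
    _ ≤ _ := by gcongr; linarith

/-! ### Choice of lengths and bookkeeping of exponents. -/

open Asymptotics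

/-- The length `X^δ` of the short variable. -/
noncomputable def shortLength (δ X : ℝ) : ℕ := ⌊X ^ δ⌋₊

/-- The index at which the long variable is cut off. -/
noncomputable def cutIndex (δ X : ℝ) : ℕ := ⌊(1 - δ) * Real.log X⌋₊

/-- The length of the long variable, of order `X^(1-δ)`. -/
noncomputable def longLength (δ X : ℝ) : ℕ := ⌈Real.exp (cutIndex δ X + 2)⌉₊

section Lengths

variable {δ X : ℝ}

lemma shortLength_le (hX : 1 ≤ X) : (shortLength δ X : ℝ) ≤ X ^ δ := Nat.floor_le (by positivity)

lemma exp_cutIndex_le (hδ : δ ≤ 1) (hX : 1 ≤ X) : Real.exp (cutIndex δ X) ≤ X ^ (1 - δ) := by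
  have h0 : 0 < X := by linarith
  rw [Real.rpow_def_of_pos h0, mul_comm]
  exact Real.exp_le_exp.mpr (Nat.floor_le (mul_nonneg (by linarith) (Real.log_nonneg hX)))

lemma le_exp_cutIndex (hX : 1 ≤ X) : Real.exp (-1) * X ^ (1 - δ) ≤ Real.exp (cutIndex δ X) := by
  have h0 : 0 < X := by linarith
  rw [Real.rpow_def_of_pos h0, mul_comm (Real.log X), ← Real.exp_add]
  refine Real.exp_le_exp.mpr ?_
  have := Nat.lt_floor_add_one ((1 - δ) * Real.log X)
  rw [cutIndex]
  linarith

lemma exp_cutIndex_add_two_le : Real.exp (cutIndex δ X + 2) ≤ longLength δ X := Nat.le_ceil _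

lemma longLength_le (hδ : δ ≤ 1) (hX : 1 ≤ X) : (longLength δ X : ℝ) ≤ 9 * X ^ (1 - δ) := by
  have h1 : (longLength δ X : ℝ) < Real.exp (cutIndex δ X + 2) + 1 :=
    Nat.ceil_lt_add_one (Real.exp_pos _).le
  have h2 := exp_cutIndex_le hδ hX
  have h3 : 1 ≤ X ^ (1 - δ) := Real.one_le_rpow hX (by linarith)
  -- The constant 9 is 8 from e² plus 1 from rounding up.
  have h4 : Real.exp 2 ≤ 8 := by
    have h5 := Real.exp_one_lt_d9
    have h6 : Real.exp 2 = Real.exp 1 * Real.exp 1 := by rw [← Real.exp_add]; norm_num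
    nlinarith [Real.exp_pos 1]
  rw [Real.exp_add] at h1
  nlinarith [Real.exp_pos (cutIndex δ X : ℝ)]

lemma shortLength_mul_longLength_le (hδ : δ ≤ 1) (hX : 1 ≤ X) :
    (shortLength δ X : ℝ) * longLength δ X ≤ 9 * X := by
  have h0 : 0 < X := by linarith
  calc _ ≤ X ^ δ * (9 * X ^ (1 - δ)) :=
        mul_le_mul (shortLength_le hX) (longLength_le hδ hX) (by positivity) (by positivity)
    _ = 9 * (X ^ δ * X ^ (1 - δ)) := by ring
    _ = 9 * X := by rw [← Real.rpow_add h0]; simp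

end Lengths

lemma rpow_isBigO_rpow {a b : ℝ} (h : a ≤ b) :
    (fun X : ℝ => X ^ a) =O[atTop] fun X : ℝ => X ^ b := by
  refine IsBigO.of_bound 1 ?_
  filter_upwards [eventually_ge_atTop 1] with X hX
  rw [Real.norm_of_nonneg (by positivity), Real.norm_of_nonneg (by positivity), one_mul]
  exact Real.rpow_le_rpow_of_exponent_le hX h

lemma isBigO_rpow_mul {f g : ℝ → ℝ} {a b c : ℝ} (hf : f =O[atTop] fun X : ℝ => X ^ a)
    (hg : g =O[atTop] fun X : ℝ => X ^ b) (h : a + b ≤ c) :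
    (fun X => f X * g X) =O[atTop] fun X : ℝ => X ^ c := by
  refine (hf.mul hg).trans (IsBigO.trans (EventuallyEq.isBigO ?_) (rpow_isBigO_rpow h))
  filter_upwards [eventually_gt_atTop 0] with X hX
  rw [Real.rpow_add hX]

lemma isBigO_rpow_rpow {f : ℝ → ℝ} {a b r : ℝ} (hr : 0 ≤ r)
    (hf : f =O[atTop] fun X : ℝ => X ^ a) (h : a * r ≤ b) :
    (fun X => f X ^ r) =O[atTop] fun X : ℝ => X ^ b := by
  refine (hf.rpow hr ?_).trans (IsBigO.trans (EventuallyEq.isBigO ?_) (rpow_isBigO_rpow h))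
  · filter_upwards [eventually_gt_atTop 0] with X hX
    exact Real.rpow_nonneg hX.le _
  · filter_upwards [eventually_gt_atTop 0] with X hX
    rw [Real.rpow_mul hX.le]

lemma const_isBigO_rpow (c : ℝ) {a : ℝ} (ha : 0 ≤ a) :
    (fun _ : ℝ => c) =O[atTop] fun X : ℝ => X ^ a := by
  refine IsBigO.trans ?_ (rpow_isBigO_rpow ha)
  simpa using isBigO_const_const c (one_ne_zero : (1 : ℝ) ≠ 0) atTop

lemma isBigO_rpow_of_le {f : ℝ → ℝ} {c a : ℝ} (h : ∀ X : ℝ, 1 ≤ X → 0 ≤ f X ∧ f X ≤ c * X ^ a) :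
    f =O[atTop] fun X : ℝ => X ^ a := by
  refine IsBigO.of_bound c ?_
  filter_upwards [eventually_ge_atTop 1] with X hX
  rw [Real.norm_of_nonneg (h X hX).1, Real.norm_of_nonneg (by positivity)]
  exact (h X hX).2

lemma cutIndex_isBigO {δ η : ℝ} (hη : 0 < η) (hδ0 : 0 ≤ δ) (hδ : δ ≤ 1) :
    (fun X => (cutIndex δ X : ℝ) + 1) =O[atTop] fun X : ℝ => X ^ η := by
  refine IsBigO.add (IsBigO.trans (g := Real.log) (IsBigO.of_bound 1 ?_)
    (isLittleO_log_rpow_atTop hη).isBigO) (const_isBigO_rpow 1 hη.le)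
  filter_upwards [eventually_ge_atTop 1] with X hX
  have hl := Real.log_nonneg hX
  rw [Real.norm_of_nonneg (by positivity), Real.norm_of_nonneg hl, one_mul]
  refine (Nat.floor_le (mul_nonneg (by linarith) hl)).trans ?_
  nlinarith

/-- Lower bound for the total mass of the coprime products. -/
lemma exists_mass_lower {A : ℕ → ℝ} (hA : CoprimeMul A) {κ η δ : ℝ} (hη : 0 < η)
    (hAκ : NonvanishingExponent A κ) (hδ0 : 0 < δ) (hδ : δ < 1) (hκ : 1 / 2 + 2 * η ≤ κ) {p₀ : ℕ}
    {Z : ℝ} (hZ1 : 1 ≤ Z) (hZ : ∀ p : ℕ, p.Prime →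
      ∀ K, ∑ k ∈ Finset.range K, |A (p ^ k)| * ((p ^ k : ℕ) : ℝ) ^ (-(1 / 2 + η)) ≤ Z)
    (hgood : ∀ p : ℕ, p.Prime → p₀ ≤ p → ∀ K,
      ∑ k ∈ Finset.Ico 1 K, |A (p ^ k)| * ((p ^ k : ℕ) : ℝ) ^ (-(1 / 2 + η)) ≤ 1 / 2) :
    ∃ c : ℝ, 0 < c ∧ ∀ᶠ X in atTop, c * X ^ (κ - 1 / 2 - 3 * η) ≤
      ∑ x ∈ coprimePairs (shortLength δ X) (longLength δ X),
        |sievedCoeff A p₀.primesBelow (1 / 2 + η) x.1 *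
          smoothCoeff A (cutIndex δ X) (1 / 2 + η) x.2| := by
  obtain ⟨c, hc, y₀, hy₀⟩ := hAκ.exists_le_absSum (σ := 1 / 2 + η) (by positivity) hη
  obtain ⟨C, hC1, hC⟩ := card_divisors_le_rpow hη
  set a := κ - (1 / 2 + η) - η with ha
  have ha0 : 0 ≤ a := by rw [ha]; linarith
  set q := Z ^ p₀.primesBelow.card * C with hq
  have hq0 : 0 < q := by positivity
  have e1 : Tendsto (fun X : ℝ => X ^ δ) atTop atTop := tendsto_rpow_atTop hδ0
  have e2 : Tendsto (fun X : ℝ => Real.exp (-1) * X ^ (1 - δ)) atTop atTop :=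
    (tendsto_rpow_atTop (by linarith : 0 < 1 - δ)).const_mul_atTop (Real.exp_pos _)
  refine ⟨c * (c * Real.exp (-1) ^ a) / q, by positivity, ?_⟩
  filter_upwards [eventually_ge_atTop 1, e1.eventually_ge_atTop y₀, e2.eventually_ge_atTop y₀] with
    X hX h1 h2
  have hX0 : 0 < X := by linarith
  have h3 := hy₀ _ h1
  have h4 := hy₀ _ (h2.trans (le_exp_cutIndex hX))
  have h5 : c * Real.exp (-1) ^ a * X ^ ((1 - δ) * a) ≤
      absSum A ∅ ⌊Real.exp (cutIndex δ X)⌋₊ (1 / 2 + η) := by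
    refine le_trans ?_ h4
    rw [mul_assoc, Real.rpow_mul hX0.le, ← Real.mul_rpow (Real.exp_pos _).le (by positivity)]
    gcongr
    exact le_exp_cutIndex hX
  have hD : ∀ n ∈ Finset.Icc 1 (shortLength δ X), (n.divisors.card : ℝ) ≤ C * X ^ η := by
    intro n hn
    obtain ⟨hn1, hn2⟩ := Finset.mem_Icc.mp hn
    refine (hC n (by omega)).trans ?_
    gcongr
    calc (n : ℝ) ≤ shortLength δ X := by exact_mod_cast hn2
      _ ≤ X ^ δ := shortLength_le hX
      _ ≤ X ^ (1 : ℝ) := Real.rpow_le_rpow_of_exponent_le hX hδ.le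
      _ = X := Real.rpow_one X
  have h6 := absSum_mul_absSum_le hA hZ1 hZ hgood hD
    ((Real.exp_le_exp.mpr (by linarith)).trans
      (exp_cutIndex_add_two_le (δ := δ) (X := X)) : Real.exp (cutIndex δ X) ≤ longLength δ X)
  set W := ∑ x ∈ coprimePairs (shortLength δ X) (longLength δ X),
        |sievedCoeff A p₀.primesBelow (1 / 2 + η) x.1 *
          smoothCoeff A (cutIndex δ X) (1 / 2 + η) x.2|
  have h7 : c * X ^ (δ * a) * (c * Real.exp (-1) ^ a * X ^ ((1 - δ) * a)) ≤
      Z ^ p₀.primesBelow.card * (C * X ^ η) * W := by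
    refine le_trans (mul_le_mul ?_ h5 (by positivity) (absSum_nonneg _ _ _ _)) h6
    rw [Real.rpow_mul hX0.le]
    exact h3
  rw [div_mul_eq_mul_div, div_le_iff₀ hq0]
  -- The lower bounds for the lengths X^δ and X^(1-δ) multiply to X^a, independently of δ; the
  -- divisor bound costs a further X^η.
  have h8 : X ^ (δ * a) * X ^ ((1 - δ) * a) = X ^ (κ - 1 / 2 - 3 * η) * X ^ η := by
    rw [← Real.rpow_add hX0, ← Real.rpow_add hX0]
    congr 1
    rw [ha]
    ring
  have h9 : 0 < X ^ η := by positivity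
  refine le_of_mul_le_mul_right ?_ h9
  calc _ = c * (c * Real.exp (-1) ^ a) * (X ^ (κ - 1 / 2 - 3 * η) * X ^ η) := by ring
    _ = c * X ^ (δ * a) * (c * Real.exp (-1) ^ a * X ^ ((1 - δ) * a)) := by rw [← h8]; ring
    _ ≤ _ := h7
    _ = _ := by rw [hq]; ring

lemma abs_sievedCoeff_le (A : ℕ → ℝ) (S : Finset ℕ) (σ : ℝ) (n : ℕ) :
    |sievedCoeff A S σ n| ≤ |A n| * (n : ℝ) ^ (-σ) := by
  rw [sievedCoeff]
  split_ifs
  · rw [abs_mul, abs_of_nonneg (by positivity : (0 : ℝ) ≤ (n : ℝ) ^ (-σ))]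
  · rw [abs_zero]
    positivity

lemma abs_smoothCoeff_le (A : ℕ → ℝ) (J : ℕ) (σ : ℝ) (m : ℕ) :
    |smoothCoeff A J σ m| ≤ (J + 1) * (|A m| * (m : ℝ) ^ (-σ)) := by
  rw [smoothCoeff, abs_mul, abs_mul, abs_of_nonneg (by positivity : (0 : ℝ) ≤ (m : ℝ) ^ (-σ)),
    abs_of_nonneg (cutoff_nonneg J m), mul_comm]
  exact mul_le_mul_of_nonneg_right (cutoff_le J m) (by positivity)

lemma one_le_card_divisors {n : ℕ} (hn : n ≠ 0) : (1 : ℝ) ≤ n.divisors.card := by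
  exact_mod_cast Finset.card_pos.mpr ⟨1, Nat.one_mem_divisors.mpr hn⟩

section SecondMoments

variable {A : ℕ → ℝ} {σ K : ℝ}
  (hK : ∀ N : ℕ, ∑ n ∈ Finset.Icc 1 N,
    (n.divisors.card : ℝ) ^ 2 * (|A n| * (n : ℝ) ^ (-σ)) ^ 2 ≤ K)
include hK

lemma sum_divisors_sq_sievedCoeff_le (S : Finset ℕ) (N : ℕ) :
    ∑ n ∈ Finset.Icc 1 N, (n.divisors.card : ℝ) ^ 2 * sievedCoeff A S σ n ^ 2 ≤ K := by
  refine le_trans (Finset.sum_le_sum fun n _ => ?_) (hK N)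
  rw [← sq_abs (sievedCoeff A S σ n)]
  gcongr
  exact abs_sievedCoeff_le A S σ n

lemma sum_divisors_sq_smoothCoeff_le (J N : ℕ) :
    ∑ m ∈ Finset.Icc 1 N, (m.divisors.card : ℝ) ^ 2 * smoothCoeff A J σ m ^ 2 ≤
      (J + 1) ^ 2 * K := by
  refine le_trans ?_ (mul_le_mul_of_nonneg_left (hK N) (by positivity))
  rw [Finset.mul_sum]
  refine Finset.sum_le_sum fun m _ => ?_
  rw [← sq_abs (smoothCoeff A J σ m)]
  calc _ ≤ (m.divisors.card : ℝ) ^ 2 * ((J + 1) * (|A m| * (m : ℝ) ^ (-σ))) ^ 2 := by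
        gcongr
        exact abs_smoothCoeff_le A J σ m
    _ = _ := by ring

lemma sum_divisors_sievedCoeff_sq_le (S : Finset ℕ) (N : ℕ) :
    ∑ n ∈ Finset.Icc 1 N, (n.divisors.card : ℝ) * ‖(sievedCoeff A S σ n : ℂ)‖ ^ 2 ≤ K := by
  refine le_trans (Finset.sum_le_sum fun n hn => ?_) (sum_divisors_sq_sievedCoeff_le hK S N)
  have hn0 : n ≠ 0 := by have := Finset.mem_Icc.mp hn; omega
  rw [Complex.norm_real, Real.norm_eq_abs, sq_abs]
  gcongr
  exact le_self_pow₀ (one_le_card_divisors hn0) two_ne_zero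

lemma sum_divisors_smoothCoeff_sq_le (J N : ℕ) :
    ∑ m ∈ Finset.Icc 1 N, (m.divisors.card : ℝ) * ‖(smoothCoeff A J σ m : ℂ)‖ ^ 2 ≤
      (J + 1) ^ 2 * K := by
  refine le_trans (Finset.sum_le_sum fun n hn => ?_) (sum_divisors_sq_smoothCoeff_le hK J N)
  have hn0 : n ≠ 0 := by have := Finset.mem_Icc.mp hn; omega
  rw [Complex.norm_real, Real.norm_eq_abs, sq_abs]
  gcongr
  exact le_self_pow₀ (one_le_card_divisors hn0) two_ne_zero

lemma sum_divisors_abs_sievedCoeff_sq_le (S : Finset ℕ) (N : ℕ) :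
    (∑ n ∈ Finset.Icc 1 N, (n.divisors.card : ℝ) * |sievedCoeff A S σ n|) ^ 2 ≤ N * K := by
  refine (sq_sum_le_card_mul_sum_sq).trans ?_
  rw [Nat.card_Icc, Nat.add_sub_cancel]
  refine mul_le_mul_of_nonneg_left ?_ (by positivity)
  simp_rw [mul_pow, sq_abs]
  exact sum_divisors_sq_sievedCoeff_le hK S N

lemma sum_coprimePairs_sq_le (hK0 : 0 ≤ K) (S : Finset ℕ) (N₁ N₂ J : ℕ) :
    ∑ x ∈ coprimePairs N₁ N₂, (sievedCoeff A S σ x.1 * smoothCoeff A J σ x.2) ^ 2 ≤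
      K * ((J + 1) ^ 2 * K) := by
  have h1 : ∀ n ∈ Finset.Icc 1 N₁, sievedCoeff A S σ n ^ 2 ≤
      (n.divisors.card : ℝ) ^ 2 * sievedCoeff A S σ n ^ 2 := fun n hn =>
    le_mul_of_one_le_left (sq_nonneg _) (one_le_pow₀ (one_le_card_divisors
      (by have := Finset.mem_Icc.mp hn; omega)))
  have h2 : ∀ n ∈ Finset.Icc 1 N₂, smoothCoeff A J σ n ^ 2 ≤
      (n.divisors.card : ℝ) ^ 2 * smoothCoeff A J σ n ^ 2 := fun n hn =>
    le_mul_of_one_le_left (sq_nonneg _) (one_le_pow₀ (one_le_card_divisors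
      (by have := Finset.mem_Icc.mp hn; omega)))
  calc _ ≤ ∑ x ∈ Finset.Icc 1 N₁ ×ˢ Finset.Icc 1 N₂,
        (sievedCoeff A S σ x.1 * smoothCoeff A J σ x.2) ^ 2 :=
        Finset.sum_le_sum_of_subset_of_nonneg (Finset.filter_subset _ _) fun _ _ _ => sq_nonneg _
    _ = (∑ n ∈ Finset.Icc 1 N₁, sievedCoeff A S σ n ^ 2) *
          ∑ m ∈ Finset.Icc 1 N₂, smoothCoeff A J σ m ^ 2 := by
        rw [Finset.sum_mul_sum, Finset.sum_product]
        simp_rw [mul_pow]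
    _ ≤ _ := by
        refine mul_le_mul ((Finset.sum_le_sum h1).trans (sum_divisors_sq_sievedCoeff_le hK S N₁))
          ((Finset.sum_le_sum h2).trans (sum_divisors_sq_smoothCoeff_le hK J N₂))
          (Finset.sum_nonneg fun _ _ => sq_nonneg _) hK0

end SecondMoments

lemma smoothSum_empty (A : ℕ → ℝ) (M : ℕ) (x : ℝ) (s : ℂ) : smoothSum A ∅ M x s =
    ∑ m ∈ Finset.Icc 1 M, (A m : ℂ) * (bump (Real.log m - x) : ℝ) * (m : ℂ) ^ (-s) := by
  simp [smoothSum]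

/-- The general mean square bound with its pointwise bound supplied by the growth of L at height
2πX, and with all second moments bounded through K. -/
lemma IsSelbergLFunction.exists_integral_coprimePoly_le {A : ℕ → ℝ} {L : ℂ → ℂ}
    (hL : IsSelbergLFunction A L) (hA : CoprimeMul A) {θ : ℝ} (hθ : 0 ≤ θ)
    (hLθ : LindelofExponent L θ) {η σ K : ℝ} (hη : 0 < η) (hσ : 1 / 2 < σ)
    (hK : ∀ N : ℕ, ∑ n ∈ Finset.Icc 1 N,
      (n.divisors.card : ℝ) ^ 2 * (|A n| * (n : ℝ) ^ (-σ)) ^ 2 ≤ K) {p₀ : ℕ}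
    (hgood : ∀ p : ℕ, p.Prime → p₀ ≤ p → ∀ K,
      ∑ k ∈ Finset.Ico 1 K, |A (p ^ k)| * ((p ^ k : ℕ) : ℝ) ^ (-σ) ≤ 1 / 2) :
    ∃ C₁ C₂ : ℝ, 0 < C₁ ∧ 0 < C₂ ∧ ∀ N₁ N₂ J k R : ℕ, Real.exp (J + 2) ≤ N₂ →
      (∀ l, 1 ≤ l → l ≤ N₁ ^ k → l.divisors.card ^ k ≤ R) → ∀ X Λ : ℝ, 0 < X → 0 < Λ →
      ∫ ξ in (-X)..X, ‖coprimePoly N₁ N₂ (fun n => (sievedCoeff A p₀.primesBelow σ n : ℂ))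
        (fun m => (smoothCoeff A J σ m : ℂ)) ξ‖ ^ 2 ≤
      C₂ * (Λ * (X + N₂) * (((J : ℝ) + 1) ^ 2 * K) +
        ((∑ n ∈ Finset.Icc 1 N₁, (n.divisors.card : ℝ) * |sievedCoeff A p₀.primesBelow σ n|) *
          (((J : ℝ) + 1) * (C₁ * (1 + (σ + 2 * Real.pi * X)) ^ (θ + η)))) ^ 2 / Λ ^ k * R *
          (X + (N₁ : ℝ) ^ k) * K ^ k) := by
  obtain ⟨C₁, hC₁, hsm⟩ := hL.norm_smooth_sum_le hθ hLθ hη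
  obtain ⟨C₂, hC₂, hint⟩ := _root_.exists_integral_coprimePoly_le
  refine ⟨C₁, C₂, hC₁, hC₂, fun N₁ N₂ J k R hJ hR X Λ hX hΛ => ?_⟩
  have hpi := Real.pi_pos
  refine (hint N₁ N₂ k R _ _ hR hX hΛ (B := (∑ n ∈ Finset.Icc 1 N₁, (n.divisors.card : ℝ) *
    |sievedCoeff A p₀.primesBelow σ n|) * (((J : ℝ) + 1) *
      (C₁ * (1 + (σ + 2 * Real.pi * X)) ^ (θ + η)))) ?_).trans ?_
  · intro ξ hξ
    refine norm_coprimePoly_le hA (by positivity) hgood hJ fun x hx => ?_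
    rw [smoothSum_empty]
    refine (hsm _ x _ (by simpa using hσ) hx).trans ?_
    have h1 : ‖(σ : ℂ) + 2 * Real.pi * ξ * Complex.I‖ ≤ σ + 2 * Real.pi * X := by
      refine (norm_add_le _ _).trans ?_
      rw [Complex.norm_real, Real.norm_of_nonneg (by linarith)]
      simp only [norm_mul, Complex.norm_I, Complex.norm_real, mul_one, Complex.norm_ofNat,
        Real.norm_eq_abs, abs_of_pos hpi]
      gcongr
    gcongr
  · refine mul_le_mul_of_nonneg_left (add_le_add ?_ ?_) hC₂.le
    · exact mul_le_mul_of_nonneg_left (sum_divisors_smoothCoeff_sq_le hK _ _) (by positivity)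
    · exact mul_le_mul_of_nonneg_left (pow_le_pow_left₀ (Finset.sum_nonneg fun _ _ => by positivity)
        (sum_divisors_sievedCoeff_sq_le hK _ _) _) (by positivity)

set_option maxHeartbeats 400000 in
/-- The truncated mean square of the coprime product polynomial. -/
lemma integral_coprimePoly_isBigO {A : ℕ → ℝ} {L : ℂ → ℂ} (hL : IsSelbergLFunction A L)
    (hA : CoprimeMul A) {θ : ℝ} (hθ : 1 / 2 ≤ θ) (hLθ : LindelofExponent L θ)
    (hRS : RankinSelbergBound A) {δ η τ : ℝ} (hδ0 : 0 < δ) (hδ : δ < 1 / 6)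
    (hη : η = δ ^ 2 / (22 * θ + 30)) (hτ : τ = (1 - 6 * δ) / (2 * θ) + 10 * η) {p₀ : ℕ}
    (hgood : ∀ p : ℕ, p.Prime → p₀ ≤ p → ∀ K,
      ∑ k ∈ Finset.Ico 1 K, |A (p ^ k)| * ((p ^ k : ℕ) : ℝ) ^ (-(1 / 2 + η)) ≤ 1 / 2) :
    (fun X : ℝ => ∫ ξ in (-(X ^ τ * X ^ η))..(X ^ τ * X ^ η),
      ‖coprimePoly (shortLength δ X) (longLength δ X)
        (fun n => (sievedCoeff A p₀.primesBelow (1 / 2 + η) n : ℂ))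
        (fun m => (smoothCoeff A (cutIndex δ X) (1 / 2 + η) m : ℂ)) ξ‖ ^ 2) =O[atTop]
      fun X : ℝ => X ^ (1 - δ ^ 2 - 8 * η) := by
  have hη0 : 0 < η := by rw [hη]; positivity
  -- This value of η keeps all the losses of size η, including those multiplied by θ, below δ².
  have hη1 : η * (22 * θ + 30) = δ ^ 2 := by
    rw [hη]
    field_simp
  have hη41 : 41 * η ≤ δ ^ 2 := by nlinarith
  have hτθ : 2 * τ * θ = 1 - 6 * δ + 20 * η * θ := by
    rw [hτ]
    field_simp
    ring
  have hτ0 : 0 < τ := by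
    rw [hτ]
    have : 0 < (1 - 6 * δ) / (2 * θ) := div_pos (by linarith) (by linarith)
    positivity
  have hτ1 : τ ≤ 1 - 6 * δ + 10 * η := by
    rw [hτ]
    gcongr
    exact div_le_self (by linarith) (by linarith)
  set σ := 1 / 2 + η with hσ
  obtain ⟨K, hK0, hK⟩ := hRS.exists_sum_divisors_sq_le hη0
  obtain ⟨C₁, C₂, hC₁, hC₂, hint⟩ := hL.exists_integral_coprimePoly_le hA (by linarith) hLθ hη0
    (σ := σ) (by linarith) hK hgood
  set k := ⌈1 / δ⌉₊ with hk
  have hk1 : 1 ≤ k * δ := by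
    have := Nat.le_ceil (1 / δ)
    rwa [div_le_iff₀ hδ0] at this
  have hk2 : k * δ ≤ 1 + δ := by
    have := Nat.ceil_lt_add_one (show 0 ≤ 1 / δ by positivity)
    have h := mul_lt_mul_of_pos_right this hδ0
    rw [add_mul, div_mul_cancel₀ _ hδ0.ne', one_mul] at h
    exact h.le
  have hkpos : 0 < (k : ℝ) := by
    by_contra h
    nlinarith
  -- The integers involved are at most X², so the exponent η/(2k) gives d(l)^k ≪ X^η.
  obtain ⟨C₃, hC₃1, hdiv⟩ := card_divisors_le_rpow (ε := η / (2 * k)) (by positivity)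
  set α : ℕ → ℂ := fun n => (sievedCoeff A p₀.primesBelow σ n : ℂ) with hα
  set β : ℝ → ℕ → ℂ := fun X m => (smoothCoeff A (cutIndex δ X) σ m : ℂ) with hβ
  set Ξ : ℝ → ℝ := fun X => X ^ τ * X ^ η with hΞ
  set B : ℝ → ℝ := fun X =>
    (∑ n ∈ Finset.Icc 1 (shortLength δ X), (n.divisors.card : ℝ) *
      |sievedCoeff A p₀.primesBelow σ n|) *
      (((cutIndex δ X : ℝ) + 1) * (C₁ * (1 + (σ + 2 * Real.pi * Ξ X)) ^ (θ + η))) with hB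
  set R : ℝ → ℕ := fun X => ⌊C₃ ^ k * X ^ η⌋₊ with hR
  have key : ∀ X : ℝ, 1 ≤ X →
      (∫ ξ in (-(Ξ X))..(Ξ X), ‖coprimePoly (shortLength δ X) (longLength δ X) α (β X) ξ‖ ^ 2) ≤
      C₂ * (X ^ (δ * (1 - 2 * δ)) * (Ξ X + longLength δ X) * (((cutIndex δ X : ℝ) + 1) ^ 2 * K) +
        B X ^ 2 / (X ^ (δ * (1 - 2 * δ))) ^ k * R X * (Ξ X + (shortLength δ X : ℝ) ^ k) * K ^ k) := by
    intro X hX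
    have hX0 : 0 < X := by linarith
    have hΞ0 : 0 < Ξ X := by positivity
    refine hint (shortLength δ X) (longLength δ X) (cutIndex δ X) k (R X)
      exp_cutIndex_add_two_le ?_ (Ξ X) (X ^ (δ * (1 - 2 * δ))) hΞ0 (by positivity)
    · intro l hl1 hl2
      refine Nat.le_floor ?_
      push_cast
      have hl : (l : ℝ) ≤ X ^ (2 : ℝ) := by
        calc (l : ℝ) ≤ (shortLength δ X : ℝ) ^ k := by exact_mod_cast hl2
          _ ≤ (X ^ δ) ^ k := by gcongr; exact shortLength_le hX
          _ = X ^ (δ * k) := by rw [Real.rpow_mul hX0.le, Real.rpow_natCast]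
          _ ≤ X ^ (2 : ℝ) := Real.rpow_le_rpow_of_exponent_le hX (by linarith)
      calc (l.divisors.card : ℝ) ^ k ≤ (C₃ * (l : ℝ) ^ (η / (2 * k))) ^ k := by
            gcongr
            exact hdiv l (by omega)
        _ ≤ (C₃ * (X ^ (2 : ℝ)) ^ (η / (2 * k))) ^ k := by gcongr
        _ = C₃ ^ k * X ^ η := by
            rw [mul_pow, ← Real.rpow_natCast (_ ^ (η / (2 * k))), ← Real.rpow_mul hX0.le,
              ← Real.rpow_mul hX0.le]
            congr 2
            field_simp
  have oΞ : Ξ =O[atTop] fun X : ℝ => X ^ (τ + η) :=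
    isBigO_rpow_mul (isBigO_refl _ _) (isBigO_refl _ _) le_rfl
  have oJ : (fun X => (cutIndex δ X : ℝ) + 1) =O[atTop] fun X : ℝ => X ^ (η / 2) :=
    cutIndex_isBigO (by positivity) hδ0.le (by linarith)
  have oJ2 : (fun X => ((cutIndex δ X : ℝ) + 1) ^ 2) =O[atTop] fun X : ℝ => X ^ η := by
    simp_rw [pow_two]
    exact isBigO_rpow_mul oJ oJ (by linarith)
  have oN₂ : (fun X => (longLength δ X : ℝ)) =O[atTop] fun X : ℝ => X ^ (1 - δ) :=
    isBigO_rpow_of_le fun X hX => ⟨by positivity, longLength_le (by linarith) hX⟩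
  have oN₁ : (fun X => (shortLength δ X : ℝ)) =O[atTop] fun X : ℝ => X ^ δ :=
    isBigO_rpow_of_le (c := 1) fun X hX => ⟨by positivity, by rw [one_mul]; exact shortLength_le hX⟩
  have oN₁k : (fun X => (shortLength δ X : ℝ) ^ k) =O[atTop] fun X : ℝ => X ^ (1 + δ) := by
    simp_rw [← Real.rpow_natCast]
    exact isBigO_rpow_rpow (by positivity) oN₁ (by linarith)
  have oR : (fun X => (R X : ℝ)) =O[atTop] fun X : ℝ => X ^ η :=
    isBigO_rpow_of_le fun X hX => ⟨by positivity, Nat.floor_le (by positivity)⟩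
  have oα : (fun X => (∑ n ∈ Finset.Icc 1 (shortLength δ X), (n.divisors.card : ℝ) *
      |sievedCoeff A p₀.primesBelow σ n|) ^ 2) =O[atTop] fun X : ℝ => X ^ δ :=
    isBigO_rpow_of_le (c := K) fun X hX => ⟨sq_nonneg _, by
      refine (sum_divisors_abs_sievedCoeff_sq_le hK _ _).trans ?_
      rw [mul_comm]
      gcongr
      exact shortLength_le hX⟩
  have os : (fun X => 1 + (σ + 2 * Real.pi * Ξ X)) =O[atTop] fun X : ℝ => X ^ (τ + η) :=
    IsBigO.add (const_isBigO_rpow _ (by positivity))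
      (IsBigO.add (const_isBigO_rpow _ (by positivity)) (oΞ.const_mul_left _))
  have hpi := Real.pi_pos
  -- Here 2(τ+η)(θ+η) is expanded with 2τθ = 1 - 6δ + 20ηθ; the remaining cross terms are at most
  -- 2ηθ + 4η.
  have os2 : (fun X => ((1 + (σ + 2 * Real.pi * Ξ X)) ^ (θ + η)) ^ 2) =O[atTop]
      fun X : ℝ => X ^ (1 - 6 * δ + η * (22 * θ + 4)) := by
    have h := isBigO_rpow_rpow (r := θ + η) (b := (τ + η) * (θ + η)) (by linarith) os le_rfl
    simp_rw [pow_two]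
    refine isBigO_rpow_mul h h ?_
    have e1 := mul_le_mul_of_nonneg_left (by nlinarith : τ ≤ 1) hη0.le
    have e2 := mul_le_mul_of_nonneg_left (by nlinarith : η ≤ 1) hη0.le
    linarith
  have oB : (fun X => B X ^ 2) =O[atTop] fun X : ℝ => X ^ (1 - 5 * δ + η * (22 * θ + 5)) := by
    have h := isBigO_rpow_mul (isBigO_rpow_mul oα oJ2 (le_refl _))
      (os2.const_mul_left (C₁ ^ 2)) (c := 1 - 5 * δ + η * (22 * θ + 5)) (by linarith)
    refine h.congr_left fun X => ?_
    simp only [hB]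
    ring
  have oΛ : (fun X : ℝ => X ^ (δ * (1 - 2 * δ))) =O[atTop] fun X : ℝ => X ^ (δ * (1 - 2 * δ)) :=
    isBigO_refl _ _
  have oΛk : (fun X : ℝ => ((X ^ (δ * (1 - 2 * δ))) ^ k)⁻¹) =O[atTop]
      fun X : ℝ => X ^ (-(1 - 2 * δ)) := by
    refine IsBigO.trans (EventuallyEq.isBigO ?_)
      (rpow_isBigO_rpow (a := -(δ * (1 - 2 * δ) * k)) ?_)
    · filter_upwards [eventually_gt_atTop 0] with X hX
      rw [Real.rpow_neg hX.le, Real.rpow_mul hX.le _ (k : ℝ), Real.rpow_natCast]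
    · nlinarith
  -- The exponent is δ(1-2δ) + (1-δ) + η = 1 - 2δ² + η, and 9η ≤ δ².
  have o1 : (fun X => X ^ (δ * (1 - 2 * δ)) * (Ξ X + longLength δ X) *
      (((cutIndex δ X : ℝ) + 1) ^ 2 * K)) =O[atTop] fun X : ℝ => X ^ (1 - δ ^ 2 - 8 * η) := by
    have h1 : (fun X => Ξ X + longLength δ X) =O[atTop] fun X : ℝ => X ^ (1 - δ) :=
      IsBigO.add (oΞ.trans (rpow_isBigO_rpow (by nlinarith))) oN₂
    have h2 : (fun X => ((cutIndex δ X : ℝ) + 1) ^ 2 * K) =O[atTop] fun X : ℝ => X ^ η := by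
      simp_rw [mul_comm _ K]
      exact oJ2.const_mul_left _
    exact isBigO_rpow_mul (isBigO_rpow_mul oΛ h1 le_rfl) h2 (by nlinarith)
  -- Up to multiples of η the exponent is (1-5δ) - (1-2δ) + (1+δ) = 1 - 2δ, which is well below 1 -
  -- δ².
  have o2 : (fun X => B X ^ 2 / (X ^ (δ * (1 - 2 * δ))) ^ k * R X *
      (Ξ X + (shortLength δ X : ℝ) ^ k) * K ^ k) =O[atTop]
      fun X : ℝ => X ^ (1 - δ ^ 2 - 8 * η) := by
    have h1 : (fun X => Ξ X + (shortLength δ X : ℝ) ^ k) =O[atTop] fun X : ℝ => X ^ (1 + δ) :=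
      IsBigO.add (oΞ.trans (rpow_isBigO_rpow (by nlinarith))) oN₁k
    simp_rw [mul_comm _ (K ^ k), div_eq_mul_inv]
    refine IsBigO.const_mul_left ?_ _
    exact isBigO_rpow_mul (isBigO_rpow_mul (isBigO_rpow_mul oB oΛk le_rfl) oR le_rfl) h1
      (by nlinarith)
  refine IsBigO.trans (IsBigO.of_bound 1 ?_) ((o1.add o2).const_mul_left C₂)
  filter_upwards [eventually_ge_atTop 1] with X hX
  have h0 : 0 ≤ ∫ ξ in (-(Ξ X))..(Ξ X),
      ‖coprimePoly (shortLength δ X) (longLength δ X) α (β X) ξ‖ ^ 2 := by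
    refine intervalIntegral.integral_nonneg ?_ fun _ _ => by positivity
    have : 0 ≤ Ξ X := by positivity
    linarith
  rw [Real.norm_of_nonneg h0, one_mul]
  exact (key X hX).trans (le_abs_self _)

/-! ### Moments of the short sums and the count of sign changes. -/

lemma card_coprimePairs_filter_mul_eq_le (N₁ N₂ : ℕ) {l : ℕ} (hl : l ≠ 0) :
    ((coprimePairs N₁ N₂).filter fun x => x.1 * x.2 = l).card ≤ l.divisors.card := by
  refine Finset.card_le_card_of_injOn Prod.fst (fun x hx => ?_) fun x hx y hy hxy => ?_
  · have h := (Finset.mem_filter.mp hx).2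
    exact Nat.mem_divisors.mpr ⟨⟨_, h.symm⟩, hl⟩
  · obtain ⟨h1, h2⟩ := Finset.mem_filter.mp hx
    obtain ⟨-, h3⟩ := Finset.mem_filter.mp hy
    have h4 := Finset.mem_product.mp (Finset.mem_filter.mp h1).1
    have h5 : 0 < x.1 := by have := Finset.mem_Icc.mp h4.1; omega
    refine Prod.ext hxy (Nat.eq_of_mul_eq_mul_left h5 ?_)
    rw [h2, ← h3, hxy]

lemma mul_mem_of_mem_coprimePairs {N₁ N₂ : ℕ} {x : ℕ × ℕ} (hx : x ∈ coprimePairs N₁ N₂) :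
    1 ≤ x.1 * x.2 ∧ x.1 * x.2 ≤ N₁ * N₂ := by
  have h := Finset.mem_product.mp (Finset.mem_filter.mp hx).1
  have h1 := Finset.mem_Icc.mp h.1
  have h2 := Finset.mem_Icc.mp h.2
  exact ⟨Nat.mul_pos h1.1 h2.1, Nat.mul_le_mul h1.2 h2.2⟩

/-- The nonnegative weight with which `A (n * m)` occurs in the coprime product. -/
noncomputable def pairWeight (S : Finset ℕ) (J : ℕ) (σ : ℝ) (x : ℕ × ℕ) : ℝ :=
  (if ∀ q ∈ S, ¬ q ∣ x.1 then (x.1 : ℝ) ^ (-σ) else 0) * ((x.2 : ℝ) ^ (-σ) * cutoff J x.2)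

lemma pairWeight_nonneg (S : Finset ℕ) (J : ℕ) (σ : ℝ) (x : ℕ × ℕ) : 0 ≤ pairWeight S J σ x := by
  have := cutoff_nonneg J x.2
  refine mul_nonneg ?_ (by positivity)
  split_ifs <;> positivity

lemma mul_pairWeight {A : ℕ → ℝ} (hA : CoprimeMul A) (S : Finset ℕ) (J : ℕ) (σ : ℝ) {N₁ N₂ : ℕ}
    {x : ℕ × ℕ} (hx : x ∈ coprimePairs N₁ N₂) :
    A (x.1 * x.2) * pairWeight S J σ x = sievedCoeff A S σ x.1 * smoothCoeff A J σ x.2 := by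
  obtain ⟨h, hc⟩ := Finset.mem_filter.mp hx
  obtain ⟨h1, h2⟩ := Finset.mem_product.mp h
  have h1 := Finset.mem_Icc.mp h1
  have h2 := Finset.mem_Icc.mp h2
  rw [hA.2 _ _ hc (by omega) (by omega), pairWeight, sievedCoeff, smoothCoeff]
  split_ifs <;> ring

/-- Second moment of the short sums of absolute values. -/
lemma exists_absolute_moment {A : ℕ → ℝ} (hRS : RankinSelbergBound A) {δ η τ : ℝ} (hδ0 : 0 < δ)
    (hδ : δ < 1) (hη : 0 < η) (hτ1 : τ ≤ 1) (S : Finset ℕ) :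
    ∃ F : ℝ → ℝ, F =O[atTop] (fun X : ℝ => X ^ (1 - τ + 2 * η)) ∧ ∀ X : ℝ, 1 ≤ X → 0 < F X ∧
      ∫ w : ℝ, (∑ x ∈ coprimePairs (shortLength δ X) (longLength δ X),
        |sievedCoeff A S (1 / 2 + η) x.1 * smoothCoeff A (cutIndex δ X) (1 / 2 + η) x.2| *
          bump (w - X ^ τ * Real.log ((x.1 * x.2 : ℕ) : ℝ))) ^ 2 ≤ F X := by
  obtain ⟨K, hK0, hK⟩ := hRS.exists_sum_divisors_sq_le hη
  obtain ⟨C, hC1, hC⟩ := card_divisors_le_rpow hη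
  set b := ∫ w : ℝ, bump w ^ 2
  have hb : 0 ≤ b := integral_nonneg fun w => sq_nonneg _
  refine ⟨fun X => b * (C * (9 * X) ^ η) * (1 + 4 * (9 * X) / X ^ τ) *
    (K * (((cutIndex δ X : ℝ) + 1) ^ 2 * K)) + 1, ?_, fun X hX => ⟨?_, ?_⟩⟩
  · have oR : (fun X : ℝ => b * (C * (9 * X) ^ η)) =O[atTop] fun X : ℝ => X ^ η := by
      refine IsBigO.const_mul_left (IsBigO.const_mul_left ?_ _) _
      refine isBigO_rpow_of_le (c := 9 ^ η) fun X hX => ⟨by positivity, ?_⟩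
      rw [Real.mul_rpow (by norm_num) (by linarith)]
    have oT : (fun X : ℝ => 1 + 4 * (9 * X) / X ^ τ) =O[atTop] fun X : ℝ => X ^ (1 - τ) := by
      refine IsBigO.add (const_isBigO_rpow _ (by linarith)) ?_
      refine isBigO_rpow_of_le (c := 36) fun X hX => ⟨by positivity, ?_⟩
      rw [Real.rpow_sub (by linarith), Real.rpow_one]
      exact le_of_eq (by ring)
    have oJ : (fun X => (cutIndex δ X : ℝ) + 1) =O[atTop] fun X : ℝ => X ^ (η / 2) :=
      cutIndex_isBigO (by positivity) hδ0.le (by linarith)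
    have oJ2 : (fun X => K * (((cutIndex δ X : ℝ) + 1) ^ 2 * K)) =O[atTop]
        fun X : ℝ => X ^ η := by
      simp_rw [pow_two, mul_comm _ K]
      exact IsBigO.const_mul_left (IsBigO.const_mul_left (isBigO_rpow_mul oJ oJ (by linarith)) _) _
    exact IsBigO.add (isBigO_rpow_mul (isBigO_rpow_mul oR oT le_rfl) oJ2 (by linarith))
      (const_isBigO_rpow _ (by linarith))
  · positivity
  · have hX0 : 0 < X := by linarith
    have hN : shortLength δ X * longLength δ X ≤ ⌊9 * X⌋₊ := Nat.le_floor (by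
      push_cast
      exact shortLength_mul_longLength_le hδ.le hX)
    have h1 := integral_norm_sq_short_sum_le (coprimePairs (shortLength δ X) (longLength δ X))
      (fun x => ((|sievedCoeff A S (1 / 2 + η) x.1 *
        smoothCoeff A (cutIndex δ X) (1 / 2 + η) x.2| : ℝ) : ℂ)) (fun x => x.1 * x.2)
      (N := ⌊9 * X⌋₊) (R := ⌊C * (9 * X) ^ η⌋₊)
      (fun x hx => ⟨(mul_mem_of_mem_coprimePairs hx).1,
        (mul_mem_of_mem_coprimePairs hx).2.trans hN⟩) (fun l => ?_) (T := X ^ τ) (by positivity)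
    · simp_rw [norm_sq_sum_ofReal_bump] at h1
      refine h1.trans ?_
      have h2 := sum_coprimePairs_sq_le hK hK0.le S (shortLength δ X) (longLength δ X)
        (cutIndex δ X)
      have h3 : (⌊9 * X⌋₊ : ℝ) ≤ 9 * X := Nat.floor_le (by positivity)
      have h4 : (⌊C * (9 * X) ^ η⌋₊ : ℝ) ≤ C * (9 * X) ^ η := Nat.floor_le (by positivity)
      simp_rw [Complex.norm_real, Real.norm_eq_abs, abs_abs, sq_abs]
      refine le_trans ?_ (le_add_of_nonneg_right zero_le_one)
      refine mul_le_mul ?_ h2 (Finset.sum_nonneg fun _ _ => sq_nonneg _) (by positivity)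
      gcongr
    · rcases ((coprimePairs (shortLength δ X) (longLength δ X)).filter
        fun x => x.1 * x.2 = l).eq_empty_or_nonempty with he | ⟨x, hx⟩
      · rw [he]
        exact Nat.zero_le _
      · obtain ⟨hx1, hx2⟩ := Finset.mem_filter.mp hx
        have h2 := mul_mem_of_mem_coprimePairs hx1
        rw [hx2] at h2
        have hl0 : l ≠ 0 := by omega
        refine (card_coprimePairs_filter_mul_eq_le _ _ hl0).trans (Nat.le_floor ?_)
        refine (hC l hl0).trans ?_
        gcongr
        calc (l : ℝ) ≤ (⌊9 * X⌋₊ : ℝ) := by exact_mod_cast h2.2.trans hN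
          _ ≤ 9 * X := Nat.floor_le (by positivity)

lemma eventually_le_of_isBigO {f : ℝ → ℝ} {a b c : ℝ} (hf : f =O[atTop] fun X : ℝ => X ^ a)
    (hab : a < b) (hc : 0 < c) : ∀ᶠ X in atTop, f X ≤ c * X ^ b := by
  obtain ⟨C, hC⟩ := hf.bound
  filter_upwards [hC, eventually_gt_atTop 0,
    (tendsto_rpow_atTop (sub_pos.mpr hab)).eventually_ge_atTop (C / c)] with X hX h0 h1
  rw [Real.norm_of_nonneg (Real.rpow_nonneg h0.le a)] at hX
  rw [div_le_iff₀ hc] at h1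
  calc f X ≤ C * X ^ a := (le_abs_self _).trans hX
    _ ≤ X ^ (b - a) * c * X ^ a := by gcongr
    _ = c * (X ^ (b - a) * X ^ a) := by ring
    _ = c * X ^ b := by rw [← Real.rpow_add h0, sub_add_cancel]

/-- Mean square of the signed short sums, compared with their total mass. -/
lemma eventually_signed_moment_le {A : ℕ → ℝ} {L : ℂ → ℂ} (hL : IsSelbergLFunction A L)
    (hA : CoprimeMul A) {θ : ℝ} (hθ : 1 / 2 ≤ θ) (hLθ : LindelofExponent L θ)
    (hRS : RankinSelbergBound A) {κ δ η τ : ℝ} (hδ0 : 0 < δ) (hδ : δ < 1 / 6)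
    (hκδ : 2 - 2 * κ ≤ δ ^ 2)
    (hη : η = δ ^ 2 / (22 * θ + 30)) (hη0 : 0 < η) (hη1 : η ≤ 1)
    (hτ : τ = (1 - 6 * δ) / (2 * θ) + 10 * η) (hτ0 : 0 < τ) (hτ1 : τ ≤ 1) {p₀ : ℕ}
    (hgood : ∀ p : ℕ, p.Prime → p₀ ≤ p → ∀ K,
      ∑ k ∈ Finset.Ico 1 K, |A (p ^ k)| * ((p ^ k : ℕ) : ℝ) ^ (-(1 / 2 + η)) ≤ 1 / 2)
    {W : ℝ → ℝ} (hW : ∀ X, W X = ∑ x ∈ coprimePairs (shortLength δ X) (longLength δ X),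
      |sievedCoeff A p₀.primesBelow (1 / 2 + η) x.1 *
        smoothCoeff A (cutIndex δ X) (1 / 2 + η) x.2|)
    {c b : ℝ} (hc : 0 < c) (hb : 0 < b)
    (hWc : ∀ᶠ X in atTop, c * X ^ (κ - 1 / 2 - 3 * η) ≤ W X) :
    ∀ᶠ X in atTop, (∫ w : ℝ, (∑ x ∈ coprimePairs (shortLength δ X) (longLength δ X),
      sievedCoeff A p₀.primesBelow (1 / 2 + η) x.1 *
        smoothCoeff A (cutIndex δ X) (1 / 2 + η) x.2 *
          bump (w - X ^ τ * Real.log ((x.1 * x.2 : ℕ) : ℝ))) ^ 2) *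
        (X ^ τ * Real.log (9 * X) + 4) ≤ b * W X ^ 2 := by
  -- With truncation at Z = X^η this makes Z^(-j) ≤ X^(-4), so the tail is negligible against W²
  -- even after multiplication by the number of windows.
  obtain ⟨j, hj⟩ := exists_nat_ge (4 / η)
  rw [div_le_iff₀ hη0] at hj
  obtain ⟨C, hC, hE⟩ := exists_integral_short_sum_le j
  have hI := integral_coprimePoly_isBigO hL hA hθ hLθ hRS hδ0 hδ hη hτ hgood
  set I : ℝ → ℝ := fun X : ℝ => ∫ ξ in (-(X ^ τ * X ^ η))..(X ^ τ * X ^ η),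
      ‖coprimePoly (shortLength δ X) (longLength δ X)
        (fun n => (sievedCoeff A p₀.primesBelow (1 / 2 + η) n : ℂ))
        (fun m => (smoothCoeff A (cutIndex δ X) (1 / 2 + η) m : ℂ)) ξ‖ ^ 2 with hIdef
  have olog : (fun X : ℝ => Real.log (9 * X)) =O[atTop] fun X : ℝ => X ^ η := by
    have h1 : (fun X : ℝ => Real.log 9 + Real.log X) =O[atTop] fun X : ℝ => X ^ η :=
      IsBigO.add (const_isBigO_rpow _ hη0.le) (isLittleO_log_rpow_atTop hη0).isBigO
    refine IsBigO.congr' h1 ?_ EventuallyEq.rfl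
    filter_upwards [eventually_gt_atTop 0] with X hX
    rw [Real.log_mul (by norm_num) hX.ne']
  have oL : (fun X : ℝ => X ^ τ * Real.log (9 * X) + 4) =O[atTop] fun X : ℝ => X ^ (τ + η) :=
    IsBigO.add (isBigO_rpow_mul (isBigO_refl _ _) olog le_rfl)
      (const_isBigO_rpow _ (by positivity))
  have oinv : (fun X : ℝ => (X ^ τ)⁻¹) =O[atTop] fun X : ℝ => X ^ (-τ) :=
    isBigO_rpow_of_le (c := 1) fun X hX => ⟨by positivity, by
      rw [Real.rpow_neg (by linarith), one_mul]⟩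
  have ojinv : (fun X : ℝ => ((X ^ η) ^ j)⁻¹) =O[atTop] fun X : ℝ => X ^ (-(4 : ℝ)) :=
    isBigO_rpow_of_le (c := 1) fun X hX => ⟨by positivity, by
      rw [one_mul, Real.rpow_neg (by linarith), ← Real.rpow_natCast, ← Real.rpow_mul (by linarith)]
      have : X ^ (4 : ℝ) ≤ X ^ (η * j) := Real.rpow_le_rpow_of_exponent_le hX (by linarith)
      gcongr⟩
  have o1 : (fun X => (X ^ τ)⁻¹ * I X * (X ^ τ * Real.log (9 * X) + 4)) =O[atTop]
      fun X : ℝ => X ^ (1 - δ ^ 2 - 7 * η) :=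
    isBigO_rpow_mul (isBigO_rpow_mul oinv hI le_rfl) oL (by linarith)
  have o2 : (fun X => ((X ^ η) ^ j)⁻¹ * (X ^ τ * Real.log (9 * X) + 4)) =O[atTop]
      fun X : ℝ => X ^ (-(1 : ℝ)) := isBigO_rpow_mul ojinv oL (by linarith)
  -- The gap is η: 1 - δ² - 7η < 2κ - 1 - 6η, because 2 - 2κ ≤ δ².
  have e1 := eventually_le_of_isBigO o1 (b := 2 * (κ - 1 / 2 - 3 * η)) (by linarith)
    (c := b * c ^ 2 / (2 * C)) (by positivity)
  have e2 := eventually_le_of_isBigO o2 (b := 0) (by norm_num) (c := b / (2 * C)) (by positivity)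
  filter_upwards [e1, e2, eventually_ge_atTop 1, hWc] with X h1 h2 hX hWX
  have hX0 : 0 < X := by linarith
  have hlog : 0 ≤ Real.log (9 * X) := Real.log_nonneg (by linarith)
  have hL0 : 0 ≤ X ^ τ * Real.log (9 * X) + 4 := by positivity
  have h3 := hE (coprimePairs (shortLength δ X) (longLength δ X))
    (fun x => ((sievedCoeff A p₀.primesBelow (1 / 2 + η) x.1 *
        smoothCoeff A (cutIndex δ X) (1 / 2 + η) x.2 : ℝ) : ℂ)) (fun x => x.1 * x.2)
    (T := X ^ τ) (Z := X ^ η) (by positivity) (by positivity)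
  simp_rw [norm_sq_sum_ofReal_bump, Complex.norm_real, Real.norm_eq_abs] at h3
  rw [← hW X] at h3
  have h4 : (∫ ξ in (-(X ^ τ * X ^ η))..(X ^ τ * X ^ η),
      ‖dirichletPoly (coprimePairs (shortLength δ X) (longLength δ X))
        (fun x => ((sievedCoeff A p₀.primesBelow (1 / 2 + η) x.1 *
        smoothCoeff A (cutIndex δ X) (1 / 2 + η) x.2 : ℝ) : ℂ)) (fun x => x.1 * x.2) ξ‖ ^ 2) =
      I X := by
    simp only [hIdef, coprimePoly, Complex.ofReal_mul]
  rw [h4] at h3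
  have hW2 : c ^ 2 * X ^ (2 * (κ - 1 / 2 - 3 * η)) ≤ W X ^ 2 := by
    calc _ = (c * X ^ (κ - 1 / 2 - 3 * η)) ^ 2 := by
          rw [mul_pow, mul_comm 2, Real.rpow_mul hX0.le, Real.rpow_two]
      _ ≤ _ := by gcongr
  refine (mul_le_mul_of_nonneg_right h3 hL0).trans ?_
  rw [Real.rpow_zero, mul_one] at h2
  calc _ = C * ((X ^ τ)⁻¹ * I X * (X ^ τ * Real.log (9 * X) + 4)) +
        C * W X ^ 2 * (((X ^ η) ^ j)⁻¹ * (X ^ τ * Real.log (9 * X) + 4)) := by ring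
    _ ≤ C * (b * c ^ 2 / (2 * C) * X ^ (2 * (κ - 1 / 2 - 3 * η))) +
        C * W X ^ 2 * (b / (2 * C)) := by gcongr
    _ = b / 2 * (c ^ 2 * X ^ (2 * (κ - 1 / 2 - 3 * η))) + b / 2 * W X ^ 2 := by
        field_simp
    _ ≤ b / 2 * W X ^ 2 + b / 2 * W X ^ 2 := by gcongr
    _ = _ := by ring

/-- Many sign changes, for `δ` small. -/
lemma exists_signChanges_lower {A : ℕ → ℝ} {L : ℂ → ℂ} (hL : IsSelbergLFunction A L)
    (hA : CoprimeMul A) {θ κ : ℝ} (hθ : 1 / 2 ≤ θ) (hLθ : LindelofExponent L θ)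
    (hRS : RankinSelbergBound A) (hAκ : NonvanishingExponent A κ) {δ : ℝ} (hδ0 : 0 < δ)
    (hδ : δ < 1 / 6) (hκδ : 2 - 2 * κ ≤ δ ^ 2) :
    ∃ c η : ℝ, 0 < c ∧ 0 < η ∧ ∀ᶠ X in atTop,
      c * X ^ (2 * κ - 2 + (1 - 6 * δ) / (2 * θ) + η) ≤ signChanges A (9 * X) := by
  obtain ⟨η, hη⟩ : ∃ η, η = δ ^ 2 / (22 * θ + 30) := ⟨_, rfl⟩
  obtain ⟨τ, hτ⟩ : ∃ τ, τ = (1 - 6 * δ) / (2 * θ) + 10 * η := ⟨_, rfl⟩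
  have hη0 : 0 < η := by rw [hη]; positivity
  have hη41 : 41 * η ≤ δ ^ 2 := by
    have : η * (22 * θ + 30) = δ ^ 2 := by
      rw [hη]
      field_simp
    nlinarith
  have hη1 : η ≤ 1 := by nlinarith
  have hτ0 : 0 < τ := by
    rw [hτ]
    have : 0 < (1 - 6 * δ) / (2 * θ) := div_pos (by linarith) (by linarith)
    positivity
  have hτ1 : τ ≤ 1 := by
    have : (1 - 6 * δ) / (2 * θ) ≤ 1 - 6 * δ := div_le_self (by linarith) (by linarith)
    rw [hτ]
    nlinarith
  obtain ⟨Z, hZ1, p₀, hloc⟩ := hRS.local_sums hη0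
  have hgood : ∀ p : ℕ, p.Prime → p₀ ≤ p → ∀ K,
      ∑ k ∈ Finset.Ico 1 K, |A (p ^ k)| * ((p ^ k : ℕ) : ℝ) ^ (-(1 / 2 + η)) ≤ 1 / 2 :=
    fun p hp h K => (hloc p hp).2 h K
  obtain ⟨c, hc, hmass⟩ := exists_mass_lower hA hη0 hAκ hδ0 (by linarith) (by nlinarith) hZ1
    (fun p hp K => (hloc p hp).1 K) hgood
  obtain ⟨F, oF, hF⟩ := exists_absolute_moment hRS hδ0 (by linarith) hη0 hτ1 p₀.primesBelow
  obtain ⟨W, hW⟩ : ∃ W : ℝ → ℝ, ∀ X,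
      W X = ∑ x ∈ coprimePairs (shortLength δ X) (longLength δ X),
      |sievedCoeff A p₀.primesBelow (1 / 2 + η) x.1 *
        smoothCoeff A (cutIndex δ X) (1 / 2 + η) x.2| := ⟨_, fun _ => rfl⟩
  simp_rw [← hW] at hmass
  have hj0 : 0 < ∫ w : ℝ, bump w := bump.integral_pos
  set j := ∫ w : ℝ, bump w
  have hE := eventually_signed_moment_le hL hA hθ hLθ hRS hδ0 hδ hκδ hη hη0 hη1 hτ hτ0 hτ1 hgood hW
    hc (show 0 < j ^ 2 / 8 by positivity) hmass
  obtain ⟨C, hC0, hC⟩ := oF.exists_pos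
  refine ⟨(c * j) ^ 2 / (16 * C), 2 * η, by positivity, by positivity, ?_⟩
  filter_upwards [hE, hmass, hC.bound, eventually_ge_atTop 1] with X h1 h2 h3 hX
  have hX0 : 0 < X := by linarith
  have hWpos : 0 < W X := lt_of_lt_of_le (by positivity) h2
  obtain ⟨hF0, hF1⟩ := hF X hX
  set S := p₀.primesBelow
  have hpw : ∀ x ∈ coprimePairs (shortLength δ X) (longLength δ X),
      A (x.1 * x.2) * pairWeight S (cutIndex δ X) (1 / 2 + η) x =
        sievedCoeff A S (1 / 2 + η) x.1 * smoothCoeff A (cutIndex δ X) (1 / 2 + η) x.2 :=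
    fun x hx => mul_pairWeight hA S _ _ hx
  have hWX : ∑ x ∈ coprimePairs (shortLength δ X) (longLength δ X),
      |A (x.1 * x.2) * pairWeight S (cutIndex δ X) (1 / 2 + η) x| = W X := by
    rw [hW]
    exact Finset.sum_congr rfl fun x hx => by rw [hpw x hx]
  have h4 := le_signChanges_of_short_sums (A := A)
    (coprimePairs (shortLength δ X) (longLength δ X))
    (pairWeight S (cutIndex δ X) (1 / 2 + η)) (fun x => x.1 * x.2) (X := 9 * X) (T := X ^ τ)
    (Δ := Real.log (9 * X)) (F := F X) (by positivity) (Real.log_nonneg (by linarith))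
    (fun x _ => pairWeight_nonneg _ _ _ _) (fun x hx => ?_) hF0 ?_ ?_ ?_
  · rw [hWX] at h4
    rw [Real.norm_of_nonneg hF0.le, Real.norm_of_nonneg (by positivity)] at h3
    have h5 : (c * j) ^ 2 * X ^ (2 * (κ - 1 / 2 - 3 * η)) ≤
        16 * (C * X ^ (1 - τ + 2 * η)) * signChanges A (9 * X) := by
      calc _ = (c * X ^ (κ - 1 / 2 - 3 * η) * j) ^ 2 := by
            rw [mul_comm 2, Real.rpow_mul hX0.le, Real.rpow_two]
            ring
        _ ≤ (W X * j) ^ 2 := by gcongr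
        _ ≤ 16 * F X * signChanges A (9 * X) := h4
        _ ≤ _ := by gcongr
    -- The term 10η in τ outweighs the losses 6η from W² and 2η from F. The surplus 2η later absorbs
    -- the constants and the passage from 9X to X.
    have h6 : X ^ (2 * (κ - 1 / 2 - 3 * η)) =
        X ^ (2 * κ - 2 + (1 - 6 * δ) / (2 * θ) + 2 * η) * X ^ (1 - τ + 2 * η) := by
      rw [← Real.rpow_add hX0]
      congr 1
      rw [hτ]
      ring
    rw [h6] at h5
    have h7 : 0 < X ^ (1 - τ + 2 * η) := by positivity
    rw [div_mul_eq_mul_div, div_le_iff₀ (by positivity)]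
    refine le_of_mul_le_mul_right ?_ h7
    linarith
  · obtain ⟨h5, h6⟩ := mul_mem_of_mem_coprimePairs hx
    have h7 : ((x.1 * x.2 : ℕ) : ℝ) ≤ 9 * X :=
      (by exact_mod_cast h6 : ((x.1 * x.2 : ℕ) : ℝ) ≤
        (shortLength δ X : ℝ) * longLength δ X).trans
        (shortLength_mul_longLength_le (by linarith) hX)
    exact ⟨h5, Nat.le_floor h7, Real.log_le_log (by exact_mod_cast h5) h7⟩
  · refine le_trans (le_of_eq ?_) hF1
    congr 1
    ext w
    congr 1
    exact Finset.sum_congr rfl fun x hx => by rw [hpw x hx]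
  · rw [hWX]
    exact hWpos
  · rw [hWX]
    refine le_trans (le_of_eq ?_) (h1.trans (le_of_eq (by ring)))
    congr 2
    ext w
    congr 1
    exact Finset.sum_congr rfl fun x hx => by rw [hpw x hx]

/-! ### Nonpositive exponents and conclusion. -/

lemma signChanges_mono (A : ℕ → ℝ) {X Y : ℝ} (h : X ≤ Y) : signChanges A X ≤ signChanges A Y := by
  classical
  unfold signChanges
  refine Finset.card_le_card fun m hm => ?_
  obtain ⟨h1, h2⟩ := Finset.mem_filter.mp hm
  have h3 := Finset.mem_Icc.mp h1
  exact Finset.mem_filter.mpr ⟨Finset.mem_Icc.mpr ⟨h3.1, h3.2.trans (Nat.floor_mono h)⟩, h2⟩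

lemma LindelofExponent.mono {L : ℂ → ℂ} {θ θ' : ℝ} (h : LindelofExponent L θ) (hθ : θ ≤ θ') :
    LindelofExponent L θ' := by
  intro ε hε
  obtain ⟨C, hC⟩ := h ε hε
  refine ⟨C, fun t => (hC t).trans ?_⟩
  have h0 : 0 ≤ C := by
    have := (norm_nonneg _).trans (hC 0)
    simpa using this
  gcongr
  linarith [abs_nonneg t]

lemma NonvanishingExponent.exists_ne_zero {A : ℕ → ℝ} {κ : ℝ} (h : NonvanishingExponent A κ) :
    ∃ m ≠ 0, A m ≠ 0 := by
  obtain ⟨c, hc, X₀, hX₀⟩ := h 1 one_pos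
  have h1 := hX₀ (max X₀ 1) (le_max_left _ _) (le_max_right _ _)
  have h2 : 0 < max X₀ 1 := lt_of_lt_of_le one_pos (le_max_right _ _)
  have h3 : 0 < ∑ m ∈ Finset.Ioc ⌊max X₀ 1⌋₊ ⌊2 * max X₀ 1⌋₊, |A m| :=
    lt_of_lt_of_le (by positivity) h1
  obtain ⟨m, hm, hm0⟩ := Finset.exists_ne_zero_of_sum_ne_zero h3.ne'
  exact ⟨m, by have := Finset.mem_Ioc.mp hm; omega, fun h0 => hm0 (by rw [h0, abs_zero])⟩

/-- The non-vanishing exponent is at most `1`. -/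
lemma NonvanishingExponent.le_one {A : ℕ → ℝ} {κ : ℝ} (h : NonvanishingExponent A κ)
    (hRS : RankinSelbergBound A) : κ ≤ 1 := by
  by_contra! hκ
  obtain ⟨e, he⟩ : ∃ e, e = (κ - 1) / 4 := ⟨_, rfl⟩
  have he0 : 0 < e := by rw [he]; linarith
  obtain ⟨c, hc, X₀, hX₀⟩ := h e he0
  obtain ⟨C, hC⟩ := hRS e he0
  have o : (fun X : ℝ => (∑ m ∈ Finset.Ioc ⌊X⌋₊ ⌊2 * X⌋₊, |A m|) ^ 2) =O[atTop]
      fun X : ℝ => X ^ (2 + e) := by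
    -- Cauchy–Schwarz on a dyadic block bounds the squared sum by X^(2+e), whereas it is at least of
    -- order X^(2κ-2e) with κ = 1 + 4e.
    refine isBigO_rpow_of_le (c := 2 * (C * 2 ^ (1 + e))) fun X hX => ⟨sq_nonneg _, ?_⟩
    have hX0 : 0 < X := by linarith
    have h1 : ∑ m ∈ Finset.Ioc ⌊X⌋₊ ⌊2 * X⌋₊, |A m| ^ 2 ≤ C * (2 * X) ^ (1 + e) := by
      refine le_trans ?_ (hC (2 * X) (by linarith))
      refine Finset.sum_le_sum_of_subset_of_nonneg (fun m hm => ?_) fun _ _ _ => sq_nonneg _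
      have := Finset.mem_Ioc.mp hm
      exact Finset.mem_Icc.mpr ⟨by omega, this.2⟩
    have h2 : ((Finset.Ioc ⌊X⌋₊ ⌊2 * X⌋₊).card : ℝ) ≤ 2 * X := by
      rw [Nat.card_Ioc]
      exact le_trans (by exact_mod_cast Nat.sub_le _ _) (Nat.floor_le (by linarith))
    calc _ ≤ ((Finset.Ioc ⌊X⌋₊ ⌊2 * X⌋₊).card : ℝ) *
          ∑ m ∈ Finset.Ioc ⌊X⌋₊ ⌊2 * X⌋₊, |A m| ^ 2 := sq_sum_le_card_mul_sum_sq
      _ ≤ 2 * X * (C * (2 * X) ^ (1 + e)) :=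
          mul_le_mul h2 h1 (Finset.sum_nonneg fun _ _ => sq_nonneg _) (by linarith)
      _ = 2 * (C * 2 ^ (1 + e)) * (X ^ (1 : ℝ) * X ^ (1 + e)) := by
          rw [Real.mul_rpow (by norm_num) hX0.le, Real.rpow_one]
          ring
      _ = _ := by
          rw [← Real.rpow_add hX0]
          congr 2
          ring
  have h1 := eventually_le_of_isBigO o (b := (κ - e) * 2) (by linarith)
    (c := c ^ 2 / 2) (by positivity)
  obtain ⟨X, h2, h3, h4⟩ := (h1.and ((eventually_ge_atTop X₀).and (eventually_ge_atTop 1))).exists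
  have hX0 : 0 < X := by linarith
  have h5 : (c * X ^ (κ - e)) ^ 2 ≤ (∑ m ∈ Finset.Ioc ⌊X⌋₊ ⌊2 * X⌋₊, |A m|) ^ 2 := by
    gcongr
    exact hX₀ X h3 h4
  rw [mul_pow, ← Real.rpow_two (X ^ _), ← Real.rpow_mul hX0.le] at h5
  have h6 : 0 < c ^ 2 * X ^ ((κ - e) * 2) := by positivity
  linarith

/-- There is at least one sign change. -/
lemma exists_one_le_signChanges {A : ℕ → ℝ} {L : ℂ → ℂ} (hL : IsSelbergLFunction A L)
    (hA1 : A 1 = 1) {θ κ : ℝ} (hθ : 0 ≤ θ) (hLθ : LindelofExponent L θ)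
    (hAκ : NonvanishingExponent A κ) (hκ : 1 / 2 < κ) : ∃ X : ℝ, 1 ≤ signChanges A X := by
  classical
  by_contra! hcon
  -- As A(1) = 1, the absence of sign changes forces all terms to be nonnegative, so smoothed sums
  -- at a real point dominate sums of |A|.
  have hpos : ∀ m : ℕ, 1 ≤ m → 0 ≤ A m := by
    intro m hm
    by_contra! hneg
    have hm1 : 1 < m := by
      rcases hm.eq_or_lt with h | h
      · rw [← h, hA1] at hneg
        linarith
      · exact h
    obtain ⟨l, hl, -⟩ := exists_signChange_between (A := A) (X := m) le_rfl hm1 (Nat.floor_natCast m).ge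
      (by rw [hA1]; linarith)
    have h1 : 0 < signChanges A m := by
      rw [signChanges]
      exact Finset.card_pos.mpr ⟨l, hl⟩
    have := hcon m
    omega
  obtain ⟨e, he⟩ : ∃ e, e = (κ - 1 / 2) / 4 := ⟨_, rfl⟩
  have he0 : 0 < e := by rw [he]; linarith
  obtain ⟨C, hC0, hC⟩ := hL.norm_smooth_sum_le hθ hLθ one_pos
  obtain ⟨c, hc, X₀, hX₀⟩ := hAκ e he0
  set σ := 1 / 2 + e with hσ
  set B := C * (1 + ‖(σ : ℂ)‖) ^ (θ + 1)
  -- The smoothed sum around Y at σ = 1/2 + e is at least of order Y^(κ-e-σ) = Y^(2e), yet bounded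
  -- uniformly in Y.
  have key : ∀ Y : ℝ, X₀ ≤ Y → 1 ≤ Y → c * 2 ^ (-σ) * Y ^ (2 * e) ≤ B := by
    intro Y hY hY1
    have hY0 : 0 < Y := by linarith
    have h1 := hC σ (Real.log Y) ⌈Real.exp (Real.log Y + 2)⌉₊ (by simp [hσ]; linarith)
      (Nat.le_ceil _)
    set M := ⌈Real.exp (Real.log Y + 2)⌉₊
    have hM : 2 * Y ≤ M := by
      refine le_trans ?_ (Nat.le_ceil _)
      rw [Real.exp_add, Real.exp_log hY0]
      have := Real.add_one_le_exp 2
      nlinarith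
    have h2 : ∑ m ∈ Finset.Icc 1 M, (A m : ℂ) * (bump (Real.log m - Real.log Y) : ℝ) *
        (m : ℂ) ^ (-(σ : ℂ)) = ((∑ m ∈ Finset.Icc 1 M, A m * bump (Real.log m - Real.log Y) *
        (m : ℝ) ^ (-σ) : ℝ) : ℂ) := by
      push_cast
      refine Finset.sum_congr rfl fun m _ => ?_
      rw [Complex.ofReal_cpow (by positivity)]
      push_cast
      rfl
    rw [h2, Complex.norm_real] at h1
    calc c * 2 ^ (-σ) * Y ^ (2 * e) = (2 * Y) ^ (-σ) * (c * Y ^ (κ - e)) := by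
          rw [Real.mul_rpow (by norm_num) hY0.le, show 2 * e = -σ + (κ - e) by rw [hσ, he]; ring,
            Real.rpow_add hY0]
          ring
      _ ≤ (2 * Y) ^ (-σ) * ∑ m ∈ Finset.Ioc ⌊Y⌋₊ ⌊2 * Y⌋₊, |A m| := by
          gcongr
          exact hX₀ Y hY hY1
      _ ≤ ∑ m ∈ Finset.Ioc ⌊Y⌋₊ ⌊2 * Y⌋₊, A m * bump (Real.log m - Real.log Y) *
          (m : ℝ) ^ (-σ) := by
          rw [Finset.mul_sum]
          refine Finset.sum_le_sum fun m hm => ?_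
          obtain ⟨hm1, hm2⟩ := Finset.mem_Ioc.mp hm
          have hm3 : Y < m := Nat.lt_of_floor_lt hm1
          have hm4 : (m : ℝ) ≤ 2 * Y := (Nat.le_floor_iff (by positivity)).mp hm2
          have hm0 : (0 : ℝ) < m := by linarith
          have hl1 : Real.log Y ≤ Real.log m := Real.log_le_log hY0 hm3.le
          have hl2 : Real.log m ≤ Real.log 2 + Real.log Y := by
            rw [← Real.log_mul (by norm_num) hY0.ne']
            exact Real.log_le_log hm0 hm4
          have hl3 : Real.log 2 < 1 := by linarith [Real.log_two_lt_d9]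
          rw [bump_eq_one (abs_le.mpr ⟨by linarith, by linarith⟩), mul_one,
            abs_of_nonneg (hpos m (by omega)), mul_comm]
          exact mul_le_mul_of_nonneg_left
            (Real.rpow_le_rpow_of_nonpos hm0 hm4 (by rw [hσ]; linarith)) (hpos m (by omega))
      _ ≤ ∑ m ∈ Finset.Icc 1 M, A m * bump (Real.log m - Real.log Y) * (m : ℝ) ^ (-σ) := by
          refine Finset.sum_le_sum_of_subset_of_nonneg (fun m hm => ?_) fun m hm _ => ?_
          · obtain ⟨hm1, hm2⟩ := Finset.mem_Ioc.mp hm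
            have hm4 : (m : ℝ) ≤ 2 * Y := (Nat.le_floor_iff (by positivity)).mp hm2
            exact Finset.mem_Icc.mpr ⟨by omega, by exact_mod_cast hm4.trans hM⟩
          · exact mul_nonneg (mul_nonneg (hpos m (Finset.mem_Icc.mp hm).1) bump.nonneg)
              (by positivity)
      _ ≤ B := (le_abs_self _).trans h1
  have ht : Tendsto (fun Y : ℝ => c * 2 ^ (-σ) * Y ^ (2 * e)) atTop atTop :=
    (tendsto_rpow_atTop (by positivity)).const_mul_atTop (by positivity)
  obtain ⟨Y, h1, h2, h3⟩ := ((ht.eventually_gt_atTop B).and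
    ((eventually_ge_atTop X₀).and (eventually_ge_atTop 1))).exists
  exact absurd (key Y h2 h3) (not_le.mpr h1)

/-- For e ≤ 0 the claim is one sign change. For e > 0 the surplus η in the exponent absorbs the
constant and the rescaling by 9. -/
lemma exists_rpow_le_signChanges {A : ℕ → ℝ} {L : ℂ → ℂ} (hL : IsSelbergLFunction A L)
    {θ κ : ℝ} (hθ : 1 / 2 ≤ θ) (hLθ : LindelofExponent L θ)
    (hRS : RankinSelbergBound A) (hAκ : NonvanishingExponent A κ) (hκ : 1 / 2 < κ) {δ e : ℝ}
    (hδ0 : 0 < δ) (hκδ : 2 - 2 * κ ≤ δ ^ 2) (he : e ≤ 2 * κ - 2 + (1 - 6 * δ) / (2 * θ))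
    (heδ : 0 < e → δ < 1 / 6) :
    ∃ X₀ : ℝ, ∀ X : ℝ, X₀ ≤ X → 1 ≤ X → X ^ e ≤ (signChanges A X : ℝ) := by
  have hne := hAκ.exists_ne_zero
  rcases le_or_gt e 0 with he0 | he0
  · obtain ⟨X₁, hX₁⟩ := exists_one_le_signChanges hL (hL.map_one hne) (by linarith) hLθ hAκ hκ
    refine ⟨X₁, fun X hX hX1 => (Real.rpow_le_one_of_one_le_of_nonpos hX1 he0).trans ?_⟩
    exact_mod_cast hX₁.trans (signChanges_mono A hX)
  · obtain ⟨c, η, hc, hη, h⟩ := exists_signChanges_lower hL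
      ⟨hL.map_one hne, hL.map_mul_of_coprime hne⟩ hθ hLθ hRS hAκ hδ0 (heδ he0) hκδ
    have h1 := eventually_le_of_isBigO
      (isBigO_rpow_of_le (f := fun X : ℝ => (9 * X) ^ e) (c := 9 ^ e) (a := e) fun X hX =>
        ⟨by positivity, by rw [Real.mul_rpow (by norm_num) (by linarith)]⟩)
      (show e < 2 * κ - 2 + (1 - 6 * δ) / (2 * θ) + η by linarith) hc
    obtain ⟨X₀, hX₀⟩ := eventually_atTop.mp (h1.and h)
    refine ⟨9 * X₀, fun X hX _ => ?_⟩
    obtain ⟨h2, h3⟩ := hX₀ (X / 9) (by linarith)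
    rw [mul_div_cancel₀ X (by norm_num : (9 : ℝ) ≠ 0)] at h2 h3
    exact h2.trans h3

theorem theorem1 (A : ℕ → ℝ) (L : ℂ → ℂ) (θ κ : ℝ)
    (hL : IsSelbergLFunction A L)
    (hθ : 0 ≤ θ) (hLθ : LindelofExponent L θ)
    (hRS : RankinSelbergBound A)
    (hκ : 0 < κ) (hAκ : NonvanishingExponent A κ) :
    (1 / 2 ≤ θ →
      1 - (2 * (7 * θ + 3 + Real.sqrt ((7 * θ + 3) ^ 2 + 2)) ^ 2)⁻¹ ≤ κ →
      ∀ ε : ℝ, 0 < ε → ∀ δ : ℝ, δ = Real.sqrt (2 - 2 * κ + ε) →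
        ∃ X₀ : ℝ, ∀ X : ℝ, X₀ ≤ X → 1 ≤ X →
          X ^ (2 * κ - 2 + 1 / (2 * θ) - δ - (6 * δ + 2 * δ ^ 2) / (2 * θ))
            ≤ (signChanges A X : ℝ)) ∧
    (θ ≤ 1 / 2 →
      -(17 / 2) + 3 * Real.sqrt 10 ≤ κ →
      ∀ ε : ℝ, 0 < ε → ∀ δ : ℝ, δ = Real.sqrt (2 - 2 * κ + ε) →
        ∃ X₀ : ℝ, ∀ X : ℝ, X₀ ≤ X → 1 ≤ X →
          X ^ (2 * κ - 1 - 6 * δ) ≤ (signChanges A X : ℝ)) := by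

  have hκ1 := hAκ.le_one hRS
  have hδ : ∀ ε : ℝ, 0 < ε → ∀ δ : ℝ, δ = Real.sqrt (2 - 2 * κ + ε) →
      0 < δ ∧ 2 - 2 * κ ≤ δ ^ 2 := by
    rintro ε hε δ rfl
    exact ⟨Real.sqrt_pos.mpr (by linarith), by rw [Real.sq_sqrt (by linarith)]; linarith⟩
  constructor
  · intro hθ2 hκθ ε hε δ hδε
    obtain ⟨hδ0, hκδ⟩ := hδ ε hε δ hδε
    -- Since θ ≥ 1/2 gives 7θ + 3 ≥ 13/2, the assumed lower bound for κ exceeds 1/2.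
    have hκ2 : 1 / 2 < κ := by
      have hs := Real.sqrt_nonneg ((7 * θ + 3) ^ 2 + 2)
      set y := 7 * θ + 3 + Real.sqrt ((7 * θ + 3) ^ 2 + 2)
      have hy : 6 ≤ y := by linarith
      have h1 : (2 * y ^ 2)⁻¹ < 1 / 2 := by
        rw [inv_lt_comm₀ (by positivity) (by norm_num)]
        nlinarith
      linarith
    refine exists_rpow_le_signChanges hL hθ2 hLθ hRS hAκ hκ2 hδ0 hκδ ?_ fun he => ?_
    · have h1 : 0 ≤ 2 * δ ^ 2 / (2 * θ) := by positivity
      rw [sub_div, add_div]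
      linarith
    -- If δ ≥ 1/6 then 6δ + 2δ² ≥ 1, and κ ≤ 1 makes the exponent negative.
    · by_contra! h6
      have h1 : 1 / (2 * θ) ≤ (6 * δ + 2 * δ ^ 2) / (2 * θ) := by
        gcongr
        nlinarith
      linarith
  · intro hθ2 hκθ ε hε δ hδε
    obtain ⟨hδ0, hκδ⟩ := hδ ε hε δ hδε
    have hκ2 : 1 / 2 < κ := by
      have : (31 / 10 : ℝ) ≤ Real.sqrt 10 := Real.le_sqrt_of_sq_le (by norm_num)
      linarith
    -- The exponent θ is enlarged to 1/2, where the general bound is exactly 2κ - 1 - 6δ; its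
    -- positivity with κ ≤ 1 forces δ < 1/6.
    refine exists_rpow_le_signChanges hL le_rfl (hLθ.mono hθ2) hRS hAκ hκ2 hδ0 hκδ ?_ fun he => ?_
    · norm_num
      linarith
    · linarith
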